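/- Let $N=2^n$ and consider a system of $n=\log N$ qubits (logarithms are base 2). A superoperator on operators of a finite-dimensional space is a \emph{Lindbladian} if it has the form $$\mathcal{L}(\rho)=-i[H,\rho]+\sum_j\Big(L_j\rho L_j^\dagger-\tfrac12\big(L_j^\dagger L_j\rho+\rho L_j^\dagger L_j\big)\Big)$$ with $H$ Hermitian and finitely many operators $L_j$. A Lindbladian on $n$ qubits is \emph{$c$-local} if it is a finite sum of superoperators, each of which is of the form $\mathcal{K}\otimes\mathcal{I}$, where $\mathcal{K}$ is a Lindbladian on some set of at most $c$ of the qubits and $\mathcal{I}$ is the identity on the remaining qubits. The diamond norm is $\|\mathcal{T}\|_\diamond=\max_{\|X\|_1=1}\|(\mathcal{T}\otimes\mathcal{I}_N)(X)\|_1$, where $\|\cdot\|_1$ is the trace norm. A superoperator $\mathcal{L}$ \emph{can be simulated for time $t$ within error $\epsilon$ using $G$ two-qubit gates} if there is a quantum operation $\mathcal{E}$ with $\|\mathcal{E}-e^{\mathcal{L}t}\|_\diamond<\epsilon$ that is implemented by adjoining some number of ancilla qubits in the state $|0\rangle$, applying a circuit of at most $G$ two-qubit gates (arbitrary unitaries on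 pairs of qubits), and discarding the ancillas. Theorem. There is an absolute constant $C>0$ such that for all integers $n,c\ge 0$, every $c$-local Lindbladian $\mathcal{L}$ on $n=\log N$ qubits, every $t>0$ and every $\epsilon>0$, with $\tau:=\|\mathcal{L}\|_\diamond t$, the evolution of $\mathcal{L}$ can be simulated for time $t$ within error $\epsilon$ using at most $$C\cdot\max\Big\{\frac{\tau^{1.5}}{\sqrt{\epsilon}}\cdot 2^{2c}(\log N+2^{6c})(\log N)^{2.5c},\;\; 2^{2c}(\log N+2^{6c})(\log N)^{c}\Big\}$$ two-qubit gates (with the convention $0^0=1$). In particular, whenever $\tau^{1.5}(\log N)^{1.5c}\ge\sqrt{\epsilon}$, $$O\Big(\frac{\tau^{1.5}}{\sqrt{\epsilon}}\cdot 2^{2c}(\log N+2^{6c})(\log N)^{2.5c}\Big)$$ two-qubit gates suffice. -/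

import Mathlib

noncomputable section

namespace OpenQuantum

/-- Computational basis states (bit strings) of a system whose qubits are labelled by `q`.
For `q = Fin n` this is a basis of a space of dimension `N = 2 ^ n`. -/
abbrev BitString (q : Type*) : Type _ := q → Fin 2

/-- Linear operators on `ℂ^ι`. -/
abbrev Op (ι : Type*) : Type _ := Matrix ι ι ℂ

/-- Superoperators: linear maps from operators on `ℂ^ι` to operators on `ℂ^ι`. -/
abbrev SuperOp (ι : Type*) : Type _ := Op ι →ₗ[ℂ] Op ι

/-! ### Trace norm and diamond norm -/

/-- The trace norm: the sum of the singular values. -/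
def traceNorm {ι : Type*} [Fintype ι] [DecidableEq ι] (A : Op ι) : ℝ :=
  ∑ i ∈ Finset.range (Fintype.card ι), (Matrix.toEuclideanLin A).singularValues i

/-- The superoperator `T ⊗ I` on operators on `ℂ^ι ⊗ ℂ^κ`. -/
def ampliation {ι : Type*} (κ : Type*) (T : SuperOp ι) : SuperOp (ι × κ) where
  toFun X := Matrix.of fun x y =>
    T (Matrix.of fun i j => X (i, x.2) (j, y.2)) x.1 y.1
  map_add' X Y := by
    ext x y
    exact congrFun (congrFun (T.map_add (Matrix.of fun i j => X (i, x.2) (j, y.2))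
      (Matrix.of fun i j => Y (i, x.2) (j, y.2))) x.1) y.1
  map_smul' a X := by
    ext x y
    exact congrFun (congrFun (T.map_smul a (Matrix.of fun i j => X (i, x.2) (j, y.2))) x.1) y.1

/-- The diamond norm `max { ‖(T ⊗ I_N) X‖₁ : ‖X‖₁ = 1 }`, with an ancilla of the same
dimension `N` as the system. -/
def diamondNorm {ι : Type*} [Fintype ι] [DecidableEq ι] (T : SuperOp ι) : ℝ :=
  sSup {r : ℝ | ∃ X : Op (ι × ι), traceNorm X = 1 ∧ r = traceNorm (ampliation ι T X)}

/-! ### Lindbladians and the evolution that they generate -/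

/-- `T` is a Lindbladian: for some Hermitian `H` and finitely many Lindblad operators `L j`,
`T ρ = -i [H, ρ] + ∑ j, (L j ρ (L j)† - ½ ((L j)† (L j) ρ + ρ (L j)† (L j)))`. -/
def IsLindbladian {ι : Type*} [Fintype ι] (T : SuperOp ι) : Prop :=
  ∃ (H : Op ι) (k : ℕ) (L : Fin k → Op ι), H.IsHermitian ∧
    ∀ ρ : Op ι, T ρ = -Complex.I • (H * ρ - ρ * H) +
      ∑ j, (L j * ρ * (L j).conjTranspose -
        (1 / 2 : ℂ) • ((L j).conjTranspose * L j * ρ + ρ * ((L j).conjTranspose * L j)))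

/-- The exponential of a superoperator, computed as a matrix exponential in the basis
of matrix units. -/
def superExp {ι : Type*} [Fintype ι] [DecidableEq ι] (T : SuperOp ι) : SuperOp ι :=
  Matrix.toLin (Matrix.stdBasis ℂ ι ι) (Matrix.stdBasis ℂ ι ι)
    (NormedSpace.exp
      (LinearMap.toMatrix (Matrix.stdBasis ℂ ι ι) (Matrix.stdBasis ℂ ι ι) T))

/-! ### Locality -/

/-- The bit string that agrees with `u` on the qubits in `S` and with `x` on the others. -/
def glue {q : Type*} [DecidableEq q] (S : Finset q) (u : BitString S) (x : BitString q) :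
    BitString q :=
  fun i => if h : i ∈ S then u ⟨i, h⟩ else x i

/-- The superoperator on all qubits that acts as `K` on the qubits in `S` and as the identity
on the other qubits. -/
def extendByIdentity {q : Type*} [DecidableEq q] (S : Finset q) (K : SuperOp (BitString S)) :
    SuperOp (BitString q) where
  toFun X := Matrix.of fun x y =>
    K (Matrix.of fun u v => X (glue S u x) (glue S v y)) (fun i => x i) (fun i => y i)
  map_add' X Y := by
    ext x y
    exact congrFun (congrFun (K.map_add (Matrix.of fun u v => X (glue S u x) (glue S v y))
      (Matrix.of fun u v => Y (glue S u x) (glue S v y))) _) _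
  map_smul' a X := by
    ext x y
    exact congrFun (congrFun (K.map_smul a
      (Matrix.of fun u v => X (glue S u x) (glue S v y))) _) _

/-- `T` is a Lindbladian that acts nontrivially only on (at most) `c` of the qubits. -/
def IsLindbladianOn {q : Type*} [DecidableEq q] (c : ℕ) (T : SuperOp (BitString q)) : Prop :=
  ∃ S : Finset q, S.card ≤ c ∧
    ∃ K : SuperOp (BitString S), IsLindbladian K ∧ T = extendByIdentity S K

/-- A `c`-local Lindbladian: a finite sum of Lindbladians, each of which acts nontrivially
on at most `c` qubits. -/
def IsLocalLindbladian {q : Type*} [DecidableEq q] (c : ℕ) (T : SuperOp (BitString q)) : Prop :=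
  ∃ (m : ℕ) (F : Fin m → SuperOp (BitString q)),
    (∀ i, IsLindbladianOn c (F i)) ∧ T = ∑ i, F i

/-! ### Circuits of two-qubit gates -/

/-- A two-qubit gate: an arbitrary unitary on two distinct qubits. -/
structure TwoQubitGate (q : Type*) where
  fst : q
  snd : q
  ne : fst ≠ snd
  unitary : Matrix.unitaryGroup (Fin 2 × Fin 2) ℂ

/-- The operator of a two-qubit gate on the whole register: the unitary on the two
chosen qubits, tensored with the identity on all the others. -/
def TwoQubitGate.toOp {q : Type*} [Fintype q] [DecidableEq q] (g : TwoQubitGate q) :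
    Op (BitString q) :=
  Matrix.of fun x y =>
    if ∀ k, k ≠ g.fst → k ≠ g.snd → x k = y k then
      (g.unitary : Matrix (Fin 2 × Fin 2) (Fin 2 × Fin 2) ℂ)
        (x g.fst, x g.snd) (y g.fst, y g.snd)
    else 0

/-- A circuit is a list of two-qubit gates; its number of gates is the length of the list. -/
abbrev Circuit (q : Type*) : Type _ := List (TwoQubitGate q)

/-- The unitary operator of a circuit (the gates are composed as a matrix product). -/
def Circuit.toOp {q : Type*} [Fintype q] [DecidableEq q] (C : Circuit q) : Op (BitString q) :=
  (C.map TwoQubitGate.toOp).prod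

/-- `ρ ↦ ρ ⊗ |0⋯0⟩⟨0⋯0|`: adjoin ancilla qubits `a`, all in the state `|0⟩`. -/
def adjoinZero (q a : Type*) [Fintype a] :
    Op (BitString q) →ₗ[ℂ] Op (BitString (q ⊕ a)) where
  toFun ρ := Matrix.of fun x y =>
    if (∀ k : a, x (Sum.inr k) = 0) ∧ (∀ k : a, y (Sum.inr k) = 0) then
      ρ (fun i => x (Sum.inl i)) (fun i => y (Sum.inl i)) else 0
  map_add' X Y := by
    ext x y
    simp only [Matrix.of_apply, Matrix.add_apply]
    split_ifs <;> simp
  map_smul' r X := by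
    ext x y
    simp [Matrix.of_apply, Matrix.smul_apply]

/-- The partial trace over the ancilla qubits `a`. -/
def traceOutAncilla (q a : Type*) [Fintype a] [DecidableEq a] :
    Op (BitString (q ⊕ a)) →ₗ[ℂ] Op (BitString q) where
  toFun M := Matrix.of fun u v =>
    ∑ z : BitString a, M (Sum.elim u z) (Sum.elim v z)
  map_add' X Y := by
    ext u v
    simp [Finset.sum_add_distrib]
  map_smul' r X := by
    ext u v
    simp [Finset.mul_sum]

/-- The quantum operation implemented by a circuit with ancilla qubits `a`: adjoin ancillas
in the state `|0⟩`, apply the circuit, and discard the ancillas. -/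
def Circuit.channel {q a : Type*} [Fintype q] [DecidableEq q] [Fintype a] [DecidableEq a]
    (C : Circuit (q ⊕ a)) : SuperOp (BitString q) :=
  traceOutAncilla q a ∘ₗ
    LinearMap.mulLeft ℂ (Circuit.toOp C) ∘ₗ
    LinearMap.mulRight ℂ (Circuit.toOp C).conjTranspose ∘ₗ
    adjoinZero q a

/-- For `n` qubits, the evolution generated by `T` can be simulated for time `t` within error
`ε` (in diamond norm) using at most `G` two-qubit gates. -/
def CanSimulate (n : ℕ) (T : SuperOp (BitString (Fin n))) (t ε G : ℝ) : Prop :=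
  ∃ (a : ℕ) (C : Circuit (Fin n ⊕ Fin a)),
    (C.length : ℝ) ≤ G ∧
      diamondNorm (Circuit.channel C - superExp ((t : ℂ) • T)) < ε

end OpenQuantum

end

/-!
The evolution is simulated by the symmetric (second-order) product formula, with one factor for
each set of `d = min c n` qubits; the factors are implemented exactly.

*Decomposition.* A `c`-local Lindbladian is first written with traceless Lindblad operators, and
the terms are grouped into one Lindbladian `F S` for each set `S` of exactly `d` qubits. The pieces
have to be controlled by the diamond norm of the sum, although the given terms may be large and
cancel. The overlap of `(𝓛 ⊗ 1)(|Ω⟩⟨Ω|)` with suitable vectors, `Ω` being the unnormalized maximally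
entangled vector, bounds the total Hilbert-Schmidt norm of the traceless Lindblad operators and
every Pauli coefficient of the Hamiltonian by a multiple of `‖𝓛‖_⋄`. Redistributing the Hamiltonian
among the sets `S` by its Pauli expansion gives `‖F S‖_⋄ ≤ 5 * 4 ^ d * ‖𝓛‖_⋄`
(`IsLocalLindbladian.exists_decomposition`).

*Product formula.* Superoperators with the diamond norm form a normed algebra (`DiamondAlgebra`),
where a comparison with the exponential series bounds the error of one step by the cube of the
total strength of the factors (`diamondNorm_strang_sub_superExp_le`). The errors of the steps add
up because evolutions of Lindbladians are channels: they are completely positive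
(`IsLindbladian.isCP_superExp`) and trace preserving, and so are contractions in the diamond norm.

*Exact synthesis.* A channel on `d` qubits has a Kraus representation with `4 ^ d` operators, which
a Stinespring isometry on `3 * d` qubits implements. The isometry is a product of Householder
reflections, one for each basis state, and a reflection is a diagonal unitary conjugated by a
circuit that maps its axis to a multiple of `|0⟩`. All together this takes at most `38 * 108 ^ d`
gates (`hasChannelCircuit_of_isCP`, `reflectionCost_le`).

*Counting.* There are `n.choose d ≤ n ^ d / d!` factors, and the factorial absorbs all the
constants of the form `b ^ d` (`choose_mul_pow_le`). Hence `O(max (τ^1.5 * n^(1.5 * d) / √ε) 1)`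
steps of `O(n ^ d)` gates each are enough (`exists_stepCount`, `gateCount_le`).
-/

noncomputable section

namespace OpenQuantum

open scoped Matrix.Norms.L2Operator ComplexOrder MatrixOrder Kronecker
open Matrix Module

/-! ### The trace norm -/

section TraceNorm

variable {ι : Type*} [Fintype ι] [DecidableEq ι]

/-- The right singular vectors of `A` form an orthonormal basis on which the trace norm is read
off. -/
theorem exists_orthonormalBasis_traceNorm (A : Op ι) :
    ∃ b : OrthonormalBasis (Fin (finrank ℂ (EuclideanSpace ℂ ι))) ℂ (EuclideanSpace ℂ ι),
      traceNorm A = ∑ i, ‖toEuclideanLin A (b i)‖ ∧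
      ∀ i j, i ≠ j → inner ℂ (toEuclideanLin A (b i)) (toEuclideanLin A (b j)) = 0 := by
  set T := toEuclideanLin A with hT
  have hs := T.isSymmetric_adjoint_comp_self
  refine ⟨hs.eigenvectorBasis rfl, ?_, ?_⟩
  · have h1 : traceNorm A = ∑ i ∈ Finset.range (finrank ℂ (EuclideanSpace ℂ ι)),
        T.singularValues i := by
      rw [finrank_euclideanSpace]; rfl
    rw [h1, Finset.sum_range]
    refine Finset.sum_congr rfl fun i _ => ?_
    rw [← sq_eq_sq₀ (T.singularValues_nonneg _) (norm_nonneg _), T.sq_singularValues_fin rfl i]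
    have h2 : inner ℂ (T (hs.eigenvectorBasis rfl i)) (T (hs.eigenvectorBasis rfl i)) =
        ((hs.eigenvalues rfl i : ℝ) : ℂ) := by
      rw [← LinearMap.adjoint_inner_right, ← LinearMap.comp_apply, hs.apply_eigenvectorBasis,
        inner_smul_right, inner_self_eq_norm_sq_to_K, (hs.eigenvectorBasis rfl).norm_eq_one]
      simp
    rw [inner_self_eq_norm_sq_to_K] at h2
    exact (Complex.ofReal_injective (by simpa using h2)).symm
  · intro i j hij
    rw [← LinearMap.adjoint_inner_right, ← LinearMap.comp_apply, hs.apply_eigenvectorBasis,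
      inner_smul_right, (hs.eigenvectorBasis rfl).inner_eq_zero hij, mul_zero]

theorem norm_toEuclideanLin_le (M : Op ι) (x : EuclideanSpace ℂ ι) :
    ‖toEuclideanLin M x‖ ≤ ‖M‖ * ‖x‖ :=
  Matrix.l2_opNorm_mulVec M x

theorem opNorm_le_of_toEuclideanLin {M : Op ι} {c : ℝ} (hc : 0 ≤ c)
    (h : ∀ x, ‖toEuclideanLin M x‖ ≤ c * ‖x‖) : ‖M‖ ≤ c := by
  rw [Matrix.l2_opNorm_def]
  exact ContinuousLinearMap.opNorm_le_bound _ hc h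

theorem trace_mul_eq_sum_inner {m : Type*} [Fintype m] (M A : Op ι)
    (b : OrthonormalBasis m ℂ (EuclideanSpace ℂ ι)) :
    (M * A).trace = ∑ i, inner ℂ (b i) (toEuclideanLin M (toEuclideanLin A (b i))) := by
  have h : toEuclideanLin (M * A) = toEuclideanLin M ∘ₗ toEuclideanLin A := by
    ext x i; simp [Matrix.toLpLin_apply, Matrix.mulVec_mulVec]
  have h3 := LinearMap.trace_eq_sum_inner (toEuclideanLin (M * A)) b
  have h4 : LinearMap.trace ℂ _ (toEuclideanLin (M * A)) = (M * A).trace := by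
    rw [LinearMap.trace_eq_matrix_trace ℂ (EuclideanSpace.basisFun ι ℂ).toBasis]
    congr 1
    ext i j
    simp [LinearMap.toMatrix_apply, Matrix.toLpLin_apply, Matrix.mulVec_single, Matrix.mulVec,
      Matrix.mul_apply, dotProduct]
  rw [← h4, h3, h]
  rfl

/-- Hölder's inequality for the operator norm and the trace norm. -/
theorem norm_trace_mul_le (M A : Op ι) : ‖(M * A).trace‖ ≤ ‖M‖ * traceNorm A := by
  obtain ⟨b, hb, -⟩ := exists_orthonormalBasis_traceNorm A
  rw [trace_mul_eq_sum_inner M A b, hb, Finset.mul_sum]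
  refine (norm_sum_le _ _).trans (Finset.sum_le_sum fun i _ => ?_)
  refine (norm_inner_le_norm _ _).trans ?_
  rw [b.norm_eq_one, one_mul]
  exact norm_toEuclideanLin_le _ _

/-- Hölder's inequality is attained, at the adjoint of the partial isometry of a polar
decomposition. -/
theorem exists_trace_mul_eq_traceNorm (A : Op ι) :
    ∃ M : Op ι, ‖M‖ ≤ 1 ∧ (M * A).trace = (traceNorm A : ℂ) := by
  obtain ⟨b, hb, hort⟩ := exists_orthonormalBasis_traceNorm A
  set T := toEuclideanLin A with hT
  let f : EuclideanSpace ℂ ι →ₗ[ℂ] EuclideanSpace ℂ ι :=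
    ∑ i, (LinearMap.toSpanSingleton ℂ _ (b i)) ∘ₗ
      ((((‖T (b i)‖⁻¹ : ℝ) : ℂ)) • (innerSL ℂ (T (b i))).toLinearMap)
  have hf : ∀ y, f y = ∑ i, ((((‖T (b i)‖⁻¹ : ℝ) : ℂ)) * inner ℂ (T (b i)) y) • b i := by
    intro y
    simp [f, LinearMap.sum_apply]
  refine ⟨toEuclideanLin.symm f, ?_, ?_⟩
  · refine opNorm_le_of_toEuclideanLin zero_le_one fun y => ?_
    rw [LinearEquiv.apply_symm_apply, one_mul]
    rw [← sq_le_sq₀ (norm_nonneg _) (norm_nonneg _), ← b.sum_sq_norm_inner_right]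
    have h1 : ∀ i, inner ℂ (b i) (f y) = inner ℂ (((((‖T (b i)‖⁻¹ : ℝ) : ℂ))) • T (b i)) y := by
      intro i
      rw [hf, b.orthonormal.inner_right_fintype, inner_smul_left]
      simp
    simp_rw [h1]
    let s : Set (Fin (finrank ℂ (EuclideanSpace ℂ ι))) := {i | T (b i) ≠ 0}
    have hon : Orthonormal ℂ
        (fun i : s => ((((‖T (b i)‖⁻¹ : ℝ) : ℂ))) • T (b i)) := by
      constructor
      · rintro ⟨i, hi⟩
        have : ‖T (b i)‖ ≠ 0 := norm_ne_zero_iff.mpr hi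
        simp [norm_smul, this]
      · rintro ⟨i, hi⟩ ⟨j, hj⟩ hij
        have : i ≠ j := fun h => hij (Subtype.ext h)
        simp [inner_smul_left, inner_smul_right, hort i j this]
    classical
    have h2 := hon.sum_inner_products_le y (s := Finset.univ)
    refine le_trans (le_of_eq ?_) h2
    rw [← Finset.sum_subtype (Finset.univ.filter (· ∈ s)) (by simp)
      (fun i => ‖inner ℂ (((((‖T (b i)‖⁻¹ : ℝ) : ℂ))) • T (b i)) y‖ ^ 2)]
    refine (Finset.sum_filter_of_ne fun i _ hi => ?_).symm
    contrapose! hi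
    have : T (b i) = 0 := by simpa [s] using hi
    simp [this]
  · rw [trace_mul_eq_sum_inner _ _ b, hb, LinearEquiv.apply_symm_apply]
    push_cast
    refine Finset.sum_congr rfl fun i _ => ?_
    rw [hf, b.orthonormal.inner_right_fintype, inner_self_eq_norm_sq_to_K]
    by_cases h : T (b i) = 0
    · simp [h]
    · have : ((‖T (b i)‖ : ℝ) : ℂ) ≠ 0 := by simpa using h
      simp only [Complex.ofReal_inv, Complex.coe_algebraMap]
      field_simp

theorem traceNorm_nonneg (A : Op ι) : 0 ≤ traceNorm A :=
  Finset.sum_nonneg fun i _ => LinearMap.singularValues_nonneg _ i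

theorem traceNorm_le_of_forall {A : Op ι} {c : ℝ}
    (h : ∀ M : Op ι, ‖M‖ ≤ 1 → ‖(M * A).trace‖ ≤ c) : traceNorm A ≤ c := by
  obtain ⟨M, hM, h1⟩ := exists_trace_mul_eq_traceNorm A
  have := h M hM
  rwa [h1, Complex.norm_real, Real.norm_of_nonneg (traceNorm_nonneg A)] at this

theorem norm_trace_mul_le_of_norm_le_one {M : Op ι} (hM : ‖M‖ ≤ 1) (A : Op ι) :
    ‖(M * A).trace‖ ≤ traceNorm A :=
  (norm_trace_mul_le M A).trans (mul_le_of_le_one_left (traceNorm_nonneg A) hM)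

theorem traceNorm_add_le (A B : Op ι) : traceNorm (A + B) ≤ traceNorm A + traceNorm B :=
  traceNorm_le_of_forall fun M hM => by
    rw [mul_add, trace_add]
    exact (norm_add_le _ _).trans (add_le_add (norm_trace_mul_le_of_norm_le_one hM A)
      (norm_trace_mul_le_of_norm_le_one hM B))

theorem traceNorm_smul_le (z : ℂ) (A : Op ι) : traceNorm (z • A) ≤ ‖z‖ * traceNorm A :=
  traceNorm_le_of_forall fun M hM => by
    rw [mul_smul_comm, trace_smul, norm_smul]
    gcongr
    exact norm_trace_mul_le_of_norm_le_one hM A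

theorem traceNorm_zero : traceNorm (0 : Op ι) = 0 :=
  le_antisymm (by simpa using traceNorm_smul_le 0 (0 : Op ι)) (traceNorm_nonneg _)

theorem traceNorm_smul (z : ℂ) (A : Op ι) : traceNorm (z • A) = ‖z‖ * traceNorm A := by
  refine le_antisymm (traceNorm_smul_le z A) ?_
  rcases eq_or_ne z 0 with rfl | hz
  · simp [traceNorm_zero]
  · have := traceNorm_smul_le z⁻¹ (z • A)
    rw [inv_smul_smul₀ hz, norm_inv] at this
    rwa [← le_inv_mul_iff₀ (norm_pos_iff.mpr hz)]

theorem traceNorm_eq_zero_iff (A : Op ι) : traceNorm A = 0 ↔ A = 0 := by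
  refine ⟨fun h => ?_, fun h => h ▸ traceNorm_zero⟩
  have := norm_trace_mul_le Aᴴ A
  rw [h, mul_zero, norm_le_zero_iff] at this
  exact trace_conjTranspose_mul_self_eq_zero_iff.mp this

/-- The operators on `ℂ^ι` as a normed space for the trace norm, a copy of `Op ι` on which no
other norm is registered. -/
def TraceClass (ι : Type*) : Type _ := Op ι

instance : AddCommGroup (TraceClass ι) := inferInstanceAs (AddCommGroup (Op ι))
instance : Module ℂ (TraceClass ι) := inferInstanceAs (Module ℂ (Op ι))
instance : FiniteDimensional ℂ (TraceClass ι) := inferInstanceAs (FiniteDimensional ℂ (Op ι))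
instance : Norm (TraceClass ι) := ⟨fun A => traceNorm (ι := ι) A⟩

theorem traceClass_core : NormedSpace.Core ℂ (TraceClass ι) where
  norm_nonneg := traceNorm_nonneg
  norm_smul := traceNorm_smul
  norm_triangle := traceNorm_add_le
  norm_eq_zero_iff := traceNorm_eq_zero_iff

instance : NormedAddCommGroup (TraceClass ι) := NormedAddCommGroup.ofCore traceClass_core
instance : NormedSpace ℂ (TraceClass ι) := NormedSpace.ofCore traceClass_core

end TraceNorm

/-! ### The diamond norm as an operator norm -/

section Diamond

variable {ι : Type*} [Fintype ι] [DecidableEq ι]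

theorem ampliation_mul {ι : Type*} (κ : Type*) (S T : SuperOp ι) :
    ampliation κ (S * T) = ampliation κ S * ampliation κ T := rfl

theorem ampliation_one {ι : Type*} (κ : Type*) : ampliation κ (1 : SuperOp ι) = 1 := rfl

theorem ampliation_add {ι : Type*} (κ : Type*) (S T : SuperOp ι) :
    ampliation κ (S + T) = ampliation κ S + ampliation κ T := rfl

theorem ampliation_smul {ι : Type*} (κ : Type*) (z : ℂ) (T : SuperOp ι) :
    ampliation κ (z • T) = z • ampliation κ T := rfl

/-- The ampliation of superoperators to an ancilla `κ`, as a homomorphism of algebras. -/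
def ampliationHom (ι κ : Type*) : SuperOp ι →ₐ[ℂ] SuperOp (ι × κ) :=
  AlgHom.ofLinearMap
    { toFun := ampliation κ
      map_add' := ampliation_add κ
      map_smul' := ampliation_smul κ } (ampliation_one κ) (ampliation_mul κ)

/-- The Banach algebra of operators on `TraceClass (ι × ι)`, whose norm restricts to the diamond
norm on the superoperators `T ⊗ I`. -/
abbrev DiamondAlgebra (ι : Type*) [Fintype ι] [DecidableEq ι] : Type _ :=
  TraceClass (ι × ι) →L[ℂ] TraceClass (ι × ι)

/-- The embedding `T ↦ T ⊗ I` into the Banach algebra that carries the diamond norm. -/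
def toDiamond (ι : Type*) [Fintype ι] [DecidableEq ι] : SuperOp ι →ₐ[ℂ] DiamondAlgebra ι :=
  ((Module.End.toContinuousLinearMap (TraceClass (ι × ι))).toAlgHom).comp (ampliationHom ι ι)

theorem traceNorm_ampliation_le_norm (T : SuperOp ι) (X : Op (ι × ι)) :
    traceNorm (ampliation ι T X) ≤ ‖toDiamond ι T‖ * traceNorm X :=
  (toDiamond ι T).le_opNorm X

theorem diamondNorm_bddAbove (T : SuperOp ι) :
    BddAbove {r : ℝ | ∃ X : Op (ι × ι), traceNorm X = 1 ∧ r = traceNorm (ampliation ι T X)} := by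
  refine ⟨‖toDiamond ι T‖, ?_⟩
  rintro r ⟨X, hX, rfl⟩
  simpa [hX] using traceNorm_ampliation_le_norm T X

theorem diamondNorm_nonneg (T : SuperOp ι) : 0 ≤ diamondNorm T := by
  refine Real.sSup_nonneg ?_
  rintro r ⟨X, -, rfl⟩
  exact traceNorm_nonneg _

theorem traceNorm_ampliation_le (T : SuperOp ι) (X : Op (ι × ι)) :
    traceNorm (ampliation ι T X) ≤ diamondNorm T * traceNorm X := by
  rcases eq_or_ne X 0 with rfl | hX
  · simp [traceNorm_zero]
  have hpos : 0 < traceNorm X :=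
    lt_of_le_of_ne (traceNorm_nonneg _) fun h => hX ((traceNorm_eq_zero_iff X).mp h.symm)
  have h1 : traceNorm (((traceNorm X)⁻¹ : ℂ) • X) = 1 := by
    rw [traceNorm_smul, norm_inv, Complex.norm_real, Real.norm_of_nonneg hpos.le,
      inv_mul_cancel₀ hpos.ne']
  have h2 := le_csSup (diamondNorm_bddAbove T) ⟨_, h1, rfl⟩
  rw [map_smul, traceNorm_smul, norm_inv, Complex.norm_real, Real.norm_of_nonneg hpos.le] at h2
  rwa [inv_mul_le_iff₀ hpos, mul_comm] at h2

theorem norm_toDiamond (T : SuperOp ι) : ‖toDiamond ι T‖ = diamondNorm T := by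
  refine le_antisymm ?_ ?_
  · exact ContinuousLinearMap.opNorm_le_bound _ (diamondNorm_nonneg T) (traceNorm_ampliation_le T)
  · refine Real.sSup_le ?_ (norm_nonneg _)
    rintro r ⟨X, hX, rfl⟩
    simpa [hX] using traceNorm_ampliation_le_norm T X

theorem diamondNorm_le_of_forall {T : SuperOp ι} {c : ℝ} (hc : 0 ≤ c)
    (h : ∀ X, traceNorm (ampliation ι T X) ≤ c * traceNorm X) : diamondNorm T ≤ c := by
  rw [← norm_toDiamond]
  exact ContinuousLinearMap.opNorm_le_bound _ hc h

theorem diamondNorm_add_le (S T : SuperOp ι) :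
    diamondNorm (S + T) ≤ diamondNorm S + diamondNorm T := by
  simp only [← norm_toDiamond, map_add]
  exact norm_add_le _ _

theorem diamondNorm_sub_le (S T : SuperOp ι) :
    diamondNorm (S - T) ≤ diamondNorm S + diamondNorm T := by
  simp only [← norm_toDiamond, map_sub]
  exact norm_sub_le _ _

theorem diamondNorm_smul (z : ℂ) (T : SuperOp ι) :
    diamondNorm (z • T) = ‖z‖ * diamondNorm T := by
  simp only [← norm_toDiamond, map_smul, norm_smul]

theorem diamondNorm_zero : diamondNorm (0 : SuperOp ι) = 0 := by
  rw [← norm_toDiamond, map_zero, norm_zero]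

theorem diamondNorm_sum_le {α : Type*} (s : Finset α) (T : α → SuperOp ι) :
    diamondNorm (∑ i ∈ s, T i) ≤ ∑ i ∈ s, diamondNorm (T i) := by
  simp only [← norm_toDiamond, map_sum]
  exact norm_sum_le _ _

end Diamond

/-! ### The exponential of a superoperator -/

section SuperExp

variable {ι : Type*} [Fintype ι] [DecidableEq ι]

/-- The identification of superoperators with matrices in the basis of matrix units. -/
def superMatrix (ι : Type*) [Fintype ι] [DecidableEq ι] :
    Matrix (ι × ι) (ι × ι) ℂ ≃ₐ[ℂ] SuperOp ι :=
  Matrix.toLinAlgEquiv (Matrix.stdBasis ℂ ι ι)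

theorem superExp_eq (T : SuperOp ι) :
    superExp T = superMatrix ι (NormedSpace.exp ((superMatrix ι).symm T)) := rfl

/-- Every linear map out of the superoperators may be applied to the exponential series term by
term. -/
theorem hasSum_superExp {E : Type*} [AddCommGroup E] [Module ℂ E] [TopologicalSpace E]
    [IsTopologicalAddGroup E] [ContinuousSMul ℂ E] (f : SuperOp ι →ₗ[ℂ] E) (T : SuperOp ι) :
    HasSum (fun n : ℕ => ((n.factorial : ℂ))⁻¹ • f (T ^ n)) (f (superExp T)) := by
  have h := NormedSpace.exp_series_hasSum_exp' (𝕂 := ℂ) ((superMatrix ι).symm T)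
  let g : Matrix (ι × ι) (ι × ι) ℂ →ₗ[ℂ] E := f ∘ₗ (superMatrix ι).toLinearMap
  have hg : Continuous g := LinearMap.continuous_of_finiteDimensional g
  have h2 := h.map g hg
  convert h2 using 2 with n
  · simp [g]
  · simp [g, superExp_eq]

theorem continuous_apply_superExp {E X : Type*} [AddCommGroup E] [Module ℂ E] [TopologicalSpace E]
    [IsTopologicalAddGroup E] [ContinuousSMul ℂ E] [TopologicalSpace X]
    (f : SuperOp ι →ₗ[ℂ] E) (A B : SuperOp ι) {g : X → ℂ} (hg : Continuous g) :
    Continuous fun s => f (superExp (A + g s • B)) := by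
  let f' : Matrix (ι × ι) (ι × ι) ℂ →ₗ[ℂ] E := f ∘ₗ (superMatrix ι).toLinearMap
  have hf : Continuous f' := LinearMap.continuous_of_finiteDimensional f'
  have h : ∀ s, f (superExp (A + g s • B)) = f' (NormedSpace.exp
      ((superMatrix ι).symm A + g s • (superMatrix ι).symm B)) := by
    intro s
    rw [superExp_eq, map_add, map_smul]; rfl
  simp_rw [h]
  let : NormedAlgebra ℚ (Matrix (ι × ι) (ι × ι) ℂ) := NormedAlgebra.restrictScalars ℚ ℂ _
  exact hf.comp (NormedSpace.exp_continuous.comp (continuous_const.add (hg.smul continuous_const)))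

theorem algHom_superExp {𝔸 : Type*} [NormedRing 𝔸] [NormedAlgebra ℂ 𝔸] [CompleteSpace 𝔸]
    (φ : SuperOp ι →ₐ[ℂ] 𝔸) (T : SuperOp ι) : φ (superExp T) = NormedSpace.exp (φ T) := by
  have h := hasSum_superExp φ.toLinearMap T
  have h2 := NormedSpace.exp_series_hasSum_exp' (𝕂 := ℂ) (φ T)
  refine h.unique ?_
  simpa using h2

theorem toDiamond_superExp (T : SuperOp ι) :
    toDiamond ι (superExp T) = NormedSpace.exp (toDiamond ι T) :=
  algHom_superExp _ _

theorem map_superExp {κ : Type*} [Fintype κ] [DecidableEq κ] (φ : SuperOp ι →ₐ[ℂ] SuperOp κ)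
    (T : SuperOp ι) : φ (superExp T) = superExp (φ T) := by
  have h := algHom_superExp (((superMatrix κ).symm.toAlgHom).comp φ) T
  exact (superMatrix κ).symm_apply_eq.mp h

theorem superExp_zero : superExp (0 : SuperOp ι) = 1 := by
  rw [superExp_eq, map_zero, NormedSpace.exp_zero, map_one]

theorem superExp_add_of_commute {S T : SuperOp ι} (h : Commute S T) :
    superExp (S + T) = superExp S * superExp T := by
  let : NormedAlgebra ℚ (Matrix (ι × ι) (ι × ι) ℂ) := NormedAlgebra.restrictScalars ℚ ℂ _
  rw [superExp_eq, map_add, NormedSpace.exp_add_of_commute (h.map (superMatrix ι).symm), map_mul]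
  rfl

theorem superExp_smul_one (z : ℂ) : superExp (z • (1 : SuperOp ι)) = Complex.exp z • 1 := by
  rw [superExp_eq, map_smul, map_one, ← Algebra.algebraMap_eq_smul_one,
    ← NormedSpace.algebraMap_exp_comm, Algebra.algebraMap_eq_smul_one, map_smul, map_one,
    Complex.exp_eq_exp_ℂ]

theorem superExp_nsmul (n : ℕ) (T : SuperOp ι) : superExp (n • T) = superExp T ^ n := by
  induction n with
  | zero => rw [zero_smul, pow_zero, superExp_zero]
  | succ n ih =>
    rw [succ_nsmul, pow_succ, superExp_add_of_commute ((Commute.refl T).smul_left n), ih]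

end SuperExp

/-! ### Operators that act on a tensor factor -/

section LiftOp

variable {ι κ X : Type*} [Fintype ι] [DecidableEq ι] [Fintype κ] [DecidableEq κ]
  [Fintype X] [DecidableEq X]

/-- The operator `a ⊗ 1` on `ℂ^X`, where `e` identifies `ℂ^X` with `ℂ^ι ⊗ ℂ^κ`. -/
def liftOp (e : X ≃ ι × κ) : Op ι →⋆ₐ[ℂ] Op X where
  toFun a := (a ⊗ₖ (1 : Op κ)).submatrix e e
  map_one' := by simp
  map_mul' a b := by
    rw [Matrix.submatrix_mul_equiv, ← Matrix.mul_kronecker_mul, one_mul]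
  map_zero' := by simp
  map_add' a b := by rw [Matrix.add_kronecker, Matrix.submatrix_add]; rfl
  commutes' z := by
    simp [Algebra.algebraMap_eq_smul_one, Matrix.smul_kronecker, Matrix.submatrix_smul]
  map_star' a := by
    simp [Matrix.star_eq_conjTranspose, Matrix.conjTranspose_submatrix,
      Matrix.conjTranspose_kronecker]

theorem liftOp_apply (e : X ≃ ι × κ) (a : Op ι) (x y : X) :
    liftOp e a x y = if (e x).2 = (e y).2 then a (e x).1 (e y).1 else 0 := by
  change (a ⊗ₖ (1 : Op κ)) (e x) (e y) = _
  rw [Matrix.kroneckerMap_apply, Matrix.one_apply]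
  split_ifs <;> simp

theorem liftOp_refl_apply (a : Op ι) (i j : ι) (u v : κ) :
    liftOp (Equiv.refl (ι × κ)) a (i, u) (j, v) = if u = v then a i j else 0 :=
  liftOp_apply _ _ _ _

theorem liftOp_prodComm_apply (a : Op ι) (i j : ι) (u v : κ) :
    liftOp (Equiv.prodComm κ ι) a (u, i) (v, j) = if u = v then a i j else 0 :=
  liftOp_apply _ _ _ _

theorem liftOp_conjTranspose (e : X ≃ ι × κ) (a : Op ι) : liftOp e aᴴ = (liftOp e a)ᴴ :=
  map_star (liftOp e) a

theorem norm_liftOp_le (e : X ≃ ι × κ) (a : Op ι) : ‖liftOp e a‖ ≤ ‖a‖ :=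
  NonUnitalStarAlgHom.norm_apply_le (liftOp e) a

end LiftOp

/-! ### Kraus maps -/

section Kraus

variable {ι : Type*} [Fintype ι] [DecidableEq ι]

/-- The superoperator `ρ ↦ A ρ B`. -/
def sandwich (A B : Op ι) : SuperOp ι := LinearMap.mulLeft ℂ A ∘ₗ LinearMap.mulRight ℂ B

theorem sandwich_apply (A B ρ : Op ι) : sandwich A B ρ = A * ρ * B := by
  simp [sandwich, mul_assoc]

theorem ampliation_sandwich {κ : Type*} [Fintype κ] [DecidableEq κ] (A B : Op ι)
    (X : Op (ι × κ)) :
    ampliation κ (sandwich A B) X =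
      liftOp (Equiv.refl (ι × κ)) A * X * liftOp (Equiv.refl (ι × κ)) B := by
  ext ⟨i, a⟩ ⟨j, b⟩
  simp [ampliation, sandwich_apply, Matrix.mul_apply, liftOp_refl_apply, Fintype.sum_prod_type]

theorem traceNorm_mul_mul_le (A X B : Op ι) :
    traceNorm (A * X * B) ≤ ‖A‖ * ‖B‖ * traceNorm X :=
  traceNorm_le_of_forall fun M hM => by
    have h : (M * (A * X * B)).trace = (B * M * A * X).trace := by
      rw [← mul_assoc, trace_mul_comm]; simp only [mul_assoc]
    rw [h]
    refine (norm_trace_mul_le _ _).trans ?_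
    gcongr
    · exact traceNorm_nonneg X
    · calc ‖B * M * A‖ ≤ ‖B‖ * ‖M‖ * ‖A‖ :=
            (norm_mul_le _ _).trans (mul_le_mul_of_nonneg_right (norm_mul_le _ _) (norm_nonneg _))
        _ ≤ ‖B‖ * 1 * ‖A‖ := by gcongr
        _ = ‖A‖ * ‖B‖ := by ring

theorem diamondNorm_sandwich_le (A B : Op ι) : diamondNorm (sandwich A B) ≤ ‖A‖ * ‖B‖ := by
  refine diamondNorm_le_of_forall (by positivity) fun X => ?_
  rw [ampliation_sandwich]
  refine (traceNorm_mul_mul_le _ _ _).trans ?_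
  gcongr
  · exact traceNorm_nonneg X
  · exact norm_liftOp_le _ _
  · exact norm_liftOp_le _ _

/-- The completely positive map `ρ ↦ ∑ k, K k ρ (K k)†`. -/
def krausMap {κ : Type*} [Fintype κ] (K : κ → Op ι) : SuperOp ι := ∑ k, sandwich (K k) (K k)ᴴ

theorem krausMap_apply {κ : Type*} [Fintype κ] (K : κ → Op ι) (ρ : Op ι) :
    krausMap K ρ = ∑ k, K k * ρ * (K k)ᴴ := by
  simp [krausMap, LinearMap.sum_apply, sandwich_apply]

/-- If `∑ k, (K k)† K k = 1`, then `M ↦ ∑ k, (K k)† M K k` is a contraction: it is the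
compression of `1 ⊗ M` by an isometry. -/
theorem norm_sum_conjTranspose_mul_mul_le {κ : Type*} [Fintype κ] {K : κ → Op ι}
    (hK : ∑ k, (K k)ᴴ * K k = 1) (M : Op ι) : ‖∑ k, (K k)ᴴ * M * K k‖ ≤ ‖M‖ := by
  classical
  let V : Matrix (κ × ι) ι ℂ := Matrix.of fun p y => K p.1 p.2 y
  have hV (N : Op ι) :
      Vᴴ * (liftOp (Equiv.prodComm κ ι) N * V) = ∑ k, (K k)ᴴ * N * K k := by
    ext x y
    simp only [V, Matrix.mul_apply, Matrix.sum_apply, liftOp_prodComm_apply,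
      Fintype.sum_prod_type, Matrix.conjTranspose_apply, Matrix.of_apply, mul_assoc]
    refine Finset.sum_congr rfl fun k _ => Finset.sum_congr rfl fun i _ => ?_
    simp
  have hVV : Vᴴ * V = 1 := by
    have := hV 1
    rw [map_one, Matrix.one_mul] at this
    simpa [this] using hK
  have hn : ‖V‖ * ‖V‖ ≤ 1 := by
    rw [← Matrix.l2_opNorm_conjTranspose_mul_self, hVV]
    refine opNorm_le_of_toEuclideanLin zero_le_one fun x => ?_
    simp
  have hVn : ‖V‖ ≤ 1 := by nlinarith [norm_nonneg V]
  rw [← hV]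
  calc _ ≤ ‖Vᴴ‖ * (‖liftOp (Equiv.prodComm κ ι) M‖ * ‖V‖) :=
        (Matrix.l2_opNorm_mul _ _).trans
          (mul_le_mul_of_nonneg_left (Matrix.l2_opNorm_mul _ _) (norm_nonneg _))
    _ ≤ 1 * (‖M‖ * 1) := by
        rw [Matrix.l2_opNorm_conjTranspose]
        gcongr
        exact norm_liftOp_le _ _
    _ = ‖M‖ := by ring

theorem diamondNorm_krausMap_le {κ : Type*} [Fintype κ] {K : κ → Op ι}
    (hK : ∑ k, (K k)ᴴ * K k = 1) : diamondNorm (krausMap K) ≤ 1 := by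
  refine diamondNorm_le_of_forall zero_le_one fun X => ?_
  set e := Equiv.refl (ι × ι)
  have hK' : ∑ k, (liftOp e (K k))ᴴ * liftOp e (K k) = 1 := by
    simp only [← liftOp_conjTranspose, ← map_mul, ← map_sum, hK, map_one]
  have hX : ampliation ι (krausMap K) X = ∑ k, liftOp e (K k) * X * (liftOp e (K k))ᴴ := by
    have : ampliation ι (krausMap K) = ∑ k, ampliation ι (sandwich (K k) (K k)ᴴ) :=
      map_sum (ampliationHom ι ι) _ _
    rw [this, LinearMap.sum_apply]
    exact Finset.sum_congr rfl fun k _ => by rw [ampliation_sandwich, liftOp_conjTranspose]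
  rw [hX, one_mul]
  refine traceNorm_le_of_forall fun M hM => ?_
  have h : (M * ∑ k, liftOp e (K k) * X * (liftOp e (K k))ᴴ).trace =
      ((∑ k, (liftOp e (K k))ᴴ * M * liftOp e (K k)) * X).trace := by
    rw [Finset.mul_sum, Finset.sum_mul, trace_sum, trace_sum]
    refine Finset.sum_congr rfl fun k _ => ?_
    rw [← mul_assoc, trace_mul_comm]; simp only [mul_assoc]
  rw [h]
  exact norm_trace_mul_le_of_norm_le_one
    ((norm_sum_conjTranspose_mul_mul_le hK' M).trans hM) X

end Kraus

/-! ### Complete positivity -/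

section CP

variable {ι : Type*}

/-- A superoperator is completely positive if `T ⊗ I` preserves positivity, with an ancilla of
the dimension of the system. -/
def IsCP (T : SuperOp ι) : Prop :=
  ∀ X : Op (ι × ι), X.PosSemidef → (ampliation ι T X).PosSemidef

theorem IsCP.add {S T : SuperOp ι} (hS : IsCP S) (hT : IsCP T) : IsCP (S + T) :=
  fun X hX => (hS X hX).add (hT X hX)

theorem IsCP.mul {S T : SuperOp ι} (hS : IsCP S) (hT : IsCP T) : IsCP (S * T) :=
  fun X hX => hS _ (hT X hX)

theorem isCP_one : IsCP (1 : SuperOp ι) := fun _ hX => hX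

theorem isCP_zero : IsCP (0 : SuperOp ι) := fun _ _ => Matrix.PosSemidef.zero

theorem IsCP.smul {T : SuperOp ι} (hT : IsCP T) {z : ℂ} (hz : 0 ≤ z) : IsCP (z • T) :=
  fun X hX => (hT X hX).smul hz

theorem IsCP.pow {T : SuperOp ι} (hT : IsCP T) (n : ℕ) : IsCP (T ^ n) := by
  induction n with
  | zero => exact isCP_one
  | succ n ih => rw [pow_succ]; exact ih.mul hT

theorem IsCP.sum {α : Type*} (s : Finset α) {T : α → SuperOp ι} (hT : ∀ i ∈ s, IsCP (T i)) :
    IsCP (∑ i ∈ s, T i) := by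
  classical
  induction s using Finset.induction_on with
  | empty => exact isCP_zero
  | insert a s ha ih =>
    rw [Finset.sum_insert ha]
    exact (hT a (by simp)).add (ih fun i hi => hT i (by simp [hi]))

variable [Fintype ι] [DecidableEq ι]

theorem posSemidef_of_forall_nonneg {M : Op ι} (h : ∀ v, 0 ≤ star v ⬝ᵥ (M *ᵥ v)) :
    M.PosSemidef := by
  rw [← Matrix.isPositive_toEuclideanLin_iff, LinearMap.isPositive_iff_complex]
  intro x
  have h1 := h x.ofLp
  have h2 : inner ℂ (toEuclideanLin M x) x = star (star x.ofLp ⬝ᵥ (M *ᵥ x.ofLp)) := by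
    rw [← inner_conj_symm]
    simp [Matrix.toLpLin_apply, PiLp.inner_apply, dotProduct, mul_comm]
  rw [Complex.le_def] at h1
  simp only [Complex.zero_re, Complex.zero_im] at h1
  rw [h2]
  refine ⟨?_, ?_⟩
  · apply Complex.ext <;> simp [← h1.2]
  · simpa using h1.1

theorem isCP_sandwich (A : Op ι) : IsCP (sandwich A Aᴴ) := fun X hX => by
  rw [ampliation_sandwich, liftOp_conjTranspose]
  exact hX.mul_mul_conjTranspose_same _

/-- The expectation value `⟨v| (T ⊗ I)(X) |v⟩`, as a linear functional of `T`. -/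
def expectation (X : Op (ι × ι)) (v : ι × ι → ℂ) : SuperOp ι →ₗ[ℂ] ℂ where
  toFun T := star v ⬝ᵥ (ampliation ι T X *ᵥ v)
  map_add' S T := by
    rw [ampliation_add, LinearMap.add_apply, add_mulVec, dotProduct_add]
  map_smul' z T := by
    rw [ampliation_smul, LinearMap.smul_apply, smul_mulVec, dotProduct_smul]; rfl

theorem isCP_iff_expectation {T : SuperOp ι} :
    IsCP T ↔ ∀ X : Op (ι × ι), X.PosSemidef → ∀ v, 0 ≤ expectation X v T :=
  ⟨fun h X hX v => (h X hX).dotProduct_mulVec_nonneg v,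
    fun h X hX => posSemidef_of_forall_nonneg (h X hX)⟩

theorem IsCP.superExp {T : SuperOp ι} (hT : IsCP T) : IsCP (superExp T) := by
  rw [isCP_iff_expectation]
  intro X hX v
  refine (hasSum_superExp (expectation X v) T).nonneg fun n => ?_
  have h1 := (isCP_iff_expectation.mp (hT.pow n)) X hX v
  have h2 : (0 : ℂ) ≤ ((n.factorial : ℂ))⁻¹ := by
    rw [← Complex.ofReal_natCast, ← Complex.ofReal_inv, Complex.zero_le_real]
    positivity
  exact mul_nonneg h2 h1

/-- A superoperator is trace preserving. -/
def IsTP (T : SuperOp ι) : Prop := ∀ ρ : Op ι, (T ρ).trace = ρ.trace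

/-- Kraus representation, from a factorization `J = B† B` of the Choi matrix. -/
theorem exists_krausMap {T : SuperOp ι} (hT : IsCP T) (hT' : IsTP T) :
    ∃ K : ι × ι → Op ι, ∑ k, (K k)ᴴ * K k = 1 ∧ T = krausMap K := by
  let ω : ι × ι → ℂ := fun p => if p.1 = p.2 then 1 else 0
  have hJ := hT _ (Matrix.posSemidef_vecMulVec_self_star ω)
  obtain ⟨B, hB⟩ := CStarAlgebra.nonneg_iff_eq_star_mul_self.mp hJ.nonneg
  have hent (i j a b : ι) : T (Matrix.single a b 1) i j =
      ∑ k, star (B k (i, a)) * B k (j, b) := by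
    have h1 := congrFun (congrFun hB (i, a)) (j, b)
    rw [Matrix.star_eq_conjTranspose, Matrix.mul_apply] at h1
    refine Eq.trans ?_ h1
    refine congrArg (fun M => T M i j) ?_
    ext p q
    simp [vecMulVec, ω, Matrix.single_apply, ← ite_and, eq_comm, and_comm]
  let K : ι × ι → Op ι := fun k => Matrix.of fun i a => star (B k (i, a))
  have hTK : T = krausMap K := by
    apply Matrix.ext_linearMap
    intro a b
    ext i j
    simp [hent, krausMap_apply, K, Matrix.sum_apply, Matrix.mul_apply, Matrix.single_apply, ite_and]
  refine ⟨K, ?_, hTK⟩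
  have htr : ∀ ρ : Op ι, ((∑ k, (K k)ᴴ * K k) * ρ).trace = (1 * ρ).trace := by
    intro ρ
    rw [one_mul, ← hT' ρ, hTK, krausMap_apply, Finset.sum_mul, trace_sum, trace_sum]
    refine Finset.sum_congr rfl fun k _ => ?_
    rw [trace_mul_comm (K k * ρ), mul_assoc]
  exact Matrix.ext_iff_trace_mul_right.mpr htr

end CP

/-! ### Lindbladians generate quantum channels -/

section Lindblad

variable {ι : Type*} [Fintype ι] [DecidableEq ι]

/-- The superoperator `ρ ↦ -i [H, ρ]`. -/
def hamiltonianPart (H : Op ι) : SuperOp ι := -Complex.I • (sandwich H 1 - sandwich 1 H)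

/-- The superoperator `ρ ↦ L ρ L† - ½ (L† L ρ + ρ L† L)`. -/
def dissipator (L : Op ι) : SuperOp ι :=
  sandwich L Lᴴ - (1 / 2 : ℂ) • (sandwich (Lᴴ * L) 1 + sandwich 1 (Lᴴ * L))

/-- The Lindbladian with Hamiltonian `H` and Lindblad operators `L j`. -/
def lindbladian {κ : Type*} [Fintype κ] (H : Op ι) (L : κ → Op ι) : SuperOp ι :=
  hamiltonianPart H + ∑ j, dissipator (L j)

theorem lindbladian_apply {κ : Type*} [Fintype κ] (H : Op ι) (L : κ → Op ι) (ρ : Op ι) :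
    lindbladian H L ρ = -Complex.I • (H * ρ - ρ * H) +
      ∑ j, (L j * ρ * (L j)ᴴ - (1 / 2 : ℂ) • ((L j)ᴴ * L j * ρ + ρ * ((L j)ᴴ * L j))) := by
  simp [lindbladian, hamiltonianPart, dissipator, sandwich_apply, LinearMap.sum_apply]

theorem isLindbladian_iff {T : SuperOp ι} :
    IsLindbladian T ↔ ∃ (H : Op ι) (k : ℕ) (L : Fin k → Op ι), H.IsHermitian ∧
      T = lindbladian H L := by
  refine exists_congr fun H => exists_congr fun k => exists_congr fun L =>
    and_congr_right fun _ => ?_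
  rw [LinearMap.ext_iff]
  refine forall_congr' fun ρ => ?_
  rw [lindbladian_apply]

theorem isLindbladian_lindbladian {κ : Type*} [Fintype κ] {H : Op ι} (hH : H.IsHermitian)
    (L : κ → Op ι) : IsLindbladian (lindbladian H L) := by
  refine isLindbladian_iff.mpr ⟨H, _, L ∘ (Fintype.equivFin κ).symm, hH, ?_⟩
  rw [lindbladian, lindbladian, ← Equiv.sum_comp (Fintype.equivFin κ).symm]
  rfl

theorem hamiltonianPart_add (H H' : Op ι) :
    hamiltonianPart (H + H') = hamiltonianPart H + hamiltonianPart H' := by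
  ext1 ρ
  simp only [hamiltonianPart, sandwich_apply, LinearMap.smul_apply, LinearMap.sub_apply,
    LinearMap.add_apply, add_mul, mul_add, one_mul, mul_one]
  module

theorem hamiltonianPart_smul (z : ℂ) (H : Op ι) :
    hamiltonianPart (z • H) = z • hamiltonianPart H := by
  ext1 ρ
  simp only [hamiltonianPart, sandwich_apply, LinearMap.smul_apply, LinearMap.sub_apply,
    smul_mul_assoc, mul_smul_comm, one_mul, mul_one]
  module

/-- `H ↦ -i [H, ·]` as a linear map. -/
def hamiltonianPartLinear (ι : Type*) [Fintype ι] [DecidableEq ι] : Op ι →ₗ[ℂ] SuperOp ι where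
  toFun := hamiltonianPart
  map_add' := hamiltonianPart_add
  map_smul' := hamiltonianPart_smul

theorem hamiltonianPart_sum {α : Type*} (s : Finset α) (H : α → Op ι) :
    hamiltonianPart (∑ i ∈ s, H i) = ∑ i ∈ s, hamiltonianPart (H i) :=
  map_sum (hamiltonianPartLinear ι) H s

theorem dissipator_smul (r : ℝ) (L : Op ι) :
    dissipator ((r : ℂ) • L) = ((r ^ 2 : ℝ) : ℂ) • dissipator L := by
  ext1 ρ
  simp only [dissipator, sandwich_apply, LinearMap.smul_apply, LinearMap.sub_apply,
    LinearMap.add_apply, smul_mul_assoc, mul_smul_comm, one_mul, mul_one,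
    conjTranspose_smul, Complex.star_def, Complex.conj_ofReal]
  push_cast
  module

theorem IsLindbladian.smul {T : SuperOp ι} (hT : IsLindbladian T) {t : ℝ} (ht : 0 ≤ t) :
    IsLindbladian ((t : ℂ) • T) := by
  obtain ⟨H, k, L, hH, rfl⟩ := isLindbladian_iff.mp hT
  have h : (t : ℂ) • lindbladian H L =
      lindbladian ((t : ℂ) • H) fun j => ((√t : ℝ) : ℂ) • L j := by
    simp only [lindbladian, dissipator_smul, hamiltonianPart_smul, Real.sq_sqrt ht, smul_add,
      Finset.smul_sum]
  rw [h]
  refine isLindbladian_lindbladian ?_ _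
  rw [Matrix.IsHermitian, conjTranspose_smul, hH.eq, Complex.star_def, Complex.conj_ofReal]

theorem lindbladian_add {κ κ' : Type*} [Fintype κ] [Fintype κ'] (H H' : Op ι) (L : κ → Op ι)
    (L' : κ' → Op ι) :
    lindbladian H L + lindbladian H' L' = lindbladian (H + H') (Sum.elim L L') := by
  simp only [lindbladian, hamiltonianPart_add, Fintype.sum_sum_type, Sum.elim_inl, Sum.elim_inr]
  abel

/-- The exponential of a Lindbladian is completely positive: up to multiples of the identity,
which only rescale the exponential, `𝓛` is a limit of completely positive maps. -/
theorem IsLindbladian.isCP_superExp {T : SuperOp ι} (hT : IsLindbladian T) :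
    IsCP (superExp T) := by
  obtain ⟨H, k, L, hH, rfl⟩ := isLindbladian_iff.mp hT
  set G : Op ι := -Complex.I • H - (1 / 2 : ℂ) • ∑ j, (L j)ᴴ * L j with hG
  -- `𝓛 + s (G · G†) + s⁻¹` is completely positive: the last two terms complete a square.
  have key (s : ℝ) (hs : 0 < s) :
      (lindbladian H L + (s : ℂ) • sandwich G Gᴴ) + ((s⁻¹ : ℝ) : ℂ) • (1 : SuperOp ι) =
        krausMap L + ((s⁻¹ : ℝ) : ℂ) • sandwich (1 + (s : ℂ) • G) (1 + (s : ℂ) • G)ᴴ := by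
    have hs' : (s : ℂ) ≠ 0 := by exact_mod_cast hs.ne'
    have hGH : Gᴴ = Complex.I • H - (1 / 2 : ℂ) • ∑ j, (L j)ᴴ * L j := by
      rw [hG]
      simp [conjTranspose_sub, conjTranspose_smul, conjTranspose_sum, hH.eq]
    ext1 ρ
    have h1 : lindbladian H L ρ = krausMap L ρ + (G * ρ + ρ * Gᴴ) := by
      rw [lindbladian_apply, krausMap_apply, hGH, hG, Finset.sum_sub_distrib, ← Finset.smul_sum,
        Finset.sum_add_distrib, ← Finset.sum_mul, ← Finset.mul_sum]
      simp only [sub_mul, mul_sub, smul_mul_assoc, mul_smul_comm]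
      module
    simp only [LinearMap.add_apply, LinearMap.smul_apply, h1, sandwich_apply, Module.End.one_apply,
      conjTranspose_add, conjTranspose_one, conjTranspose_smul, Complex.star_def,
      Complex.conj_ofReal, add_mul, mul_add, one_mul, mul_one, smul_mul_assoc, mul_smul_comm]
    match_scalars <;> field_simp
  have hpos (s : ℝ) (hs : 0 < s) :
      IsCP (superExp (lindbladian H L + (s : ℂ) • sandwich G Gᴴ)) := by
    have h2 : lindbladian H L + (s : ℂ) • sandwich G Gᴴ =
        (-((s⁻¹ : ℝ) : ℂ)) • (1 : SuperOp ι) +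
        (krausMap L + ((s⁻¹ : ℝ) : ℂ) • sandwich (1 + (s : ℂ) • G) (1 + (s : ℂ) • G)ᴴ) := by
      rw [← key s hs]; module
    rw [h2, superExp_add_of_commute ((Commute.one_left _).smul_left _), superExp_smul_one]
    refine (isCP_one.smul ?_).mul (IsCP.superExp ((IsCP.sum _ fun k _ => isCP_sandwich _).add
      ((isCP_sandwich _).smul ?_)))
    · rw [← Complex.ofReal_neg, ← Complex.ofReal_exp, Complex.zero_le_real]
      positivity
    · rw [Complex.zero_le_real]
      positivity
  rw [isCP_iff_expectation]
  intro X hX v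
  have hc := continuous_apply_superExp (expectation X v) (lindbladian H L) (sandwich G Gᴴ)
    Complex.continuous_ofReal
  have ht := (hc.tendsto 0).mono_left (nhdsWithin_le_nhds (s := Set.Ioi 0))
  rw [Complex.ofReal_zero, zero_smul, add_zero] at ht
  exact ge_of_tendsto ht (Filter.eventually_of_mem self_mem_nhdsWithin fun s hs =>
    isCP_iff_expectation.mp (hpos s hs) X hX v)

theorem IsLindbladian.trace_apply {T : SuperOp ι} (hT : IsLindbladian T) (ρ : Op ι) :
    (T ρ).trace = 0 := by
  obtain ⟨H, k, L, hH, rfl⟩ := isLindbladian_iff.mp hT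
  rw [lindbladian_apply, trace_add, trace_smul, trace_sub, trace_mul_comm H, sub_self, smul_zero,
    zero_add, trace_sum]
  refine Finset.sum_eq_zero fun j _ => ?_
  rw [trace_sub, trace_smul, trace_add, trace_mul_comm (L j * ρ), trace_mul_comm ρ, ← mul_assoc,
    smul_eq_mul]
  ring

theorem IsLindbladian.isTP_superExp {T : SuperOp ι} (hT : IsLindbladian T) :
    IsTP (superExp T) := by
  intro ρ
  let f : SuperOp ι →ₗ[ℂ] ℂ := Matrix.traceLinearMap ι ℂ ℂ ∘ₗ LinearMap.applyₗ ρ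
  have h := hasSum_superExp f T
  have h0 := hasSum_single (f := fun n : ℕ => ((n.factorial : ℂ))⁻¹ • f (T ^ n)) 0 (by
    intro n hn
    obtain ⟨m, rfl⟩ := Nat.exists_eq_succ_of_ne_zero hn
    have : f (T ^ (m + 1)) = 0 := by
      rw [pow_succ']
      exact hT.trace_apply _
    simp [this])
  have h1 := h.unique h0
  simpa [f] using h1

/-- The evolution that a Lindbladian generates is a quantum channel. -/
theorem IsLindbladian.exists_krausMap_superExp {T : SuperOp ι} (hT : IsLindbladian T) :
    ∃ K : ι × ι → Op ι, ∑ k, (K k)ᴴ * K k = 1 ∧ superExp T = krausMap K :=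
  exists_krausMap hT.isCP_superExp hT.isTP_superExp

theorem IsLindbladian.diamondNorm_superExp_le {T : SuperOp ι} (hT : IsLindbladian T) :
    diamondNorm (superExp T) ≤ 1 := by
  obtain ⟨K, hK, h⟩ := hT.exists_krausMap_superExp
  rw [h]
  exact diamondNorm_krausMap_le hK

theorem diamondNorm_hamiltonianPart_le (H : Op ι) : diamondNorm (hamiltonianPart H) ≤ 2 * ‖H‖ := by
  cases isEmpty_or_nonempty ι
  · have : hamiltonianPart H = 0 := by ext1 ρ; exact Subsingleton.elim _ _
    rw [this, diamondNorm_zero]; positivity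
  rw [hamiltonianPart, diamondNorm_smul, norm_neg, Complex.norm_I, one_mul]
  refine (diamondNorm_sub_le _ _).trans ?_
  have h1 := diamondNorm_sandwich_le H 1
  have h2 := diamondNorm_sandwich_le 1 H
  rw [norm_one] at h1 h2
  linarith

theorem diamondNorm_dissipator_le (L : Op ι) : diamondNorm (dissipator L) ≤ 2 * ‖L‖ ^ 2 := by
  cases isEmpty_or_nonempty ι
  · have : dissipator L = 0 := by ext1 ρ; exact Subsingleton.elim _ _
    rw [this, diamondNorm_zero]; positivity
  have h0 := diamondNorm_sandwich_le L Lᴴ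
  have h1 := diamondNorm_sandwich_le (Lᴴ * L) 1
  have h2 := diamondNorm_sandwich_le 1 (Lᴴ * L)
  rw [norm_one, Matrix.l2_opNorm_conjTranspose_mul_self] at h1 h2
  rw [Matrix.l2_opNorm_conjTranspose] at h0
  refine (diamondNorm_sub_le _ _).trans ?_
  rw [diamondNorm_smul]
  have h3 := diamondNorm_add_le (sandwich (Lᴴ * L) 1) (sandwich 1 (Lᴴ * L))
  have h4 : ‖(1 / 2 : ℂ)‖ = 1 / 2 := by simp
  rw [h4]
  nlinarith

end Lindblad

/-! ### The second-order product formula -/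

section Jet

variable {𝔸 : Type*} [NormedRing 𝔸]

/-- The remainder `e^x - 1 - x - x²/2` of the exponential series. -/
def expTail (x : ℝ) : ℝ := Real.exp x - 1 - x - x ^ 2 / 2

/-- `S` is the sum of a series `1 + P + Q + ⋯` whose terms are bounded by those of `e^p`: the
terms of degree one and two are `P` and `Q`, and only the sum of the others is controlled. -/
structure HasExpJet (S P Q : 𝔸) (p : ℝ) : Prop where
  norm_fst : ‖P‖ ≤ p
  norm_snd : ‖Q‖ ≤ p ^ 2 / 2
  norm_sub : ‖S - (1 + P + Q)‖ ≤ expTail p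

theorem hasExpJet_exp [NormedAlgebra ℂ 𝔸] [CompleteSpace 𝔸] {A : 𝔸} {a : ℝ} (h : ‖A‖ ≤ a) :
    HasExpJet (NormedSpace.exp A) A ((1 / 2 : ℂ) • A ^ 2) a where
  norm_fst := h
  norm_snd := by
    rw [norm_smul, show ‖(1 / 2 : ℂ)‖ = 1 / 2 by simp, one_div_mul_eq_div]
    gcongr
    exact (norm_pow_le' A two_pos).trans (pow_le_pow_left₀ (norm_nonneg _) h 2)
  norm_sub := by
    have h1 := NormedSpace.exp_series_hasSum_exp' (𝕂 := ℂ) A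
    have h2 := NormedSpace.exp_series_hasSum_exp' (𝕂 := ℝ) a
    rw [← Real.exp_eq_exp_ℝ] at h2
    rw [← hasSum_nat_add_iff' 3] at h1 h2
    have e1 : expTail a = Real.exp a - ∑ i ∈ Finset.range 3, ((i.factorial : ℝ))⁻¹ • a ^ i := by
      simp [Finset.sum_range_succ, expTail, Nat.factorial]
      ring
    have e2 : NormedSpace.exp A - (1 + A + (1 / 2 : ℂ) • A ^ 2) =
        NormedSpace.exp A - ∑ i ∈ Finset.range 3, ((i.factorial : ℂ))⁻¹ • A ^ i := by
      simp [Finset.sum_range_succ, Nat.factorial]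
    rw [e1, e2]
    refine h1.norm_le_of_bounded h2 fun n => ?_
    rw [norm_smul, norm_inv, Complex.norm_natCast, smul_eq_mul]
    gcongr
    exact (norm_pow_le' A (by omega)).trans (pow_le_pow_left₀ (norm_nonneg _) h _)

theorem HasExpJet.mul {S P Q S' P' Q' : 𝔸} {p q : ℝ} (h1 : ‖(1 : 𝔸)‖ ≤ 1)
    (h : HasExpJet S P Q p) (h' : HasExpJet S' P' Q' q) :
    HasExpJet (S * S') (P + P') (Q + Q' + P * P') (p + q) := by
  have hp : 0 ≤ p := (norm_nonneg _).trans h.norm_fst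
  have hq : 0 ≤ q := (norm_nonneg _).trans h'.norm_fst
  refine ⟨(norm_add_le _ _).trans (add_le_add h.norm_fst h'.norm_fst), ?_, ?_⟩
  · calc ‖Q + Q' + P * P'‖ ≤ ‖Q‖ + ‖Q'‖ + ‖P‖ * ‖P'‖ :=
          (norm_add_le _ _).trans (add_le_add (norm_add_le _ _) (norm_mul_le _ _))
      _ ≤ p ^ 2 / 2 + q ^ 2 / 2 + p * q :=
          add_le_add (add_le_add h.norm_snd h'.norm_snd)
            (mul_le_mul h.norm_fst h'.norm_fst (norm_nonneg _) hp)
      _ = (p + q) ^ 2 / 2 := by ring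
  · have hJ : ‖(1 + P + Q : 𝔸)‖ ≤ 1 + p + p ^ 2 / 2 :=
      (norm_add_le _ _).trans (add_le_add ((norm_add_le _ _).trans (add_le_add h1 h.norm_fst))
        h.norm_snd)
    have hJ' : ‖(1 + P' + Q' : 𝔸)‖ ≤ 1 + q + q ^ 2 / 2 :=
      (norm_add_le _ _).trans (add_le_add ((norm_add_le _ _).trans (add_le_add h1 h'.norm_fst))
        h'.norm_snd)
    have hS' : ‖S'‖ ≤ Real.exp q := by
      have : S' = (S' - (1 + P' + Q')) + (1 + P' + Q') := by abel
      rw [this]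
      refine (norm_add_le _ _).trans ((add_le_add h'.norm_sub hJ').trans (le_of_eq ?_))
      simp only [expTail]; ring
    have e : S * S' - (1 + (P + P') + (Q + Q' + P * P')) =
        (S - (1 + P + Q)) * S' + (1 + P + Q) * (S' - (1 + P' + Q')) +
          (P * Q' + Q * P' + Q * Q') := by noncomm_ring
    rw [e]
    calc _ ≤ expTail p * Real.exp q + (1 + p + p ^ 2 / 2) * expTail q +
          (p * (q ^ 2 / 2) + p ^ 2 / 2 * q + p ^ 2 / 2 * (q ^ 2 / 2)) := by
          refine norm_add_le_of_le (norm_add_le_of_le ?_ ?_)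
            (norm_add_le_of_le (norm_add_le_of_le ?_ ?_) ?_)
          · exact norm_mul_le_of_le h.norm_sub hS'
          · exact norm_mul_le_of_le hJ h'.norm_sub
          · exact norm_mul_le_of_le h.norm_fst h'.norm_snd
          · exact norm_mul_le_of_le h.norm_snd h'.norm_fst
          · exact norm_mul_le_of_le h.norm_snd h'.norm_snd
      _ = expTail (p + q) := by
          simp only [expTail, Real.exp_add]; ring

theorem two_mul_expTail_le {x : ℝ} (h0 : 0 ≤ x) (h1 : x ≤ 1) : 2 * expTail x ≤ x ^ 3 / 2 := by
  have h := Real.exp_bound' h0 h1 (n := 3) (by norm_num)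
  simp [Finset.sum_range_succ, Nat.factorial] at h
  have h3 : 0 ≤ x ^ 3 := by positivity
  simp only [expTail]
  nlinarith

/-- The errors of successive contractions add up. -/
theorem norm_pow_sub_pow_le {S E : 𝔸} (h1 : ‖(1 : 𝔸)‖ ≤ 1) (hS : ‖S‖ ≤ 1) (hE : ‖E‖ ≤ 1) (r : ℕ) :
    ‖S ^ r - E ^ r‖ ≤ r * ‖S - E‖ := by
  induction r with
  | zero => simp
  | succ r ih =>
    have hEr : ‖E ^ r‖ ≤ 1 := by
      rcases Nat.eq_zero_or_pos r with rfl | hr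
      · simpa using h1
      · exact (norm_pow_le' E hr).trans (pow_le_one₀ (norm_nonneg _) hE)
    have e : S ^ (r + 1) - E ^ (r + 1) = (S ^ r - E ^ r) * S + E ^ r * (S - E) := by
      rw [pow_succ, pow_succ]; noncomm_ring
    rw [e]
    calc _ ≤ (r * ‖S - E‖) * 1 + 1 * ‖S - E‖ :=
          norm_add_le_of_le (norm_mul_le_of_le ih hS) (norm_mul_le_of_le hEr le_rfl)
      _ = ((r + 1 : ℕ) : ℝ) * ‖S - E‖ := by push_cast; ring

end Jet

section Strang

variable {ι : Type*} [Fintype ι] [DecidableEq ι]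

/-- The symmetric product `e^{A₁/2} ⋯ e^{Aₘ/2} e^{Aₘ/2} ⋯ e^{A₁/2}`. -/
def strang : List (SuperOp ι) → SuperOp ι
  | [] => 1
  | A :: l => superExp ((1 / 2 : ℂ) • A) * strang l * superExp ((1 / 2 : ℂ) • A)

theorem norm_one_diamondAlgebra_le : ‖(1 : DiamondAlgebra ι)‖ ≤ 1 :=
  ContinuousLinearMap.norm_id_le

theorem hasExpJet_strang {Λ : ℝ} (l : List (SuperOp ι)) (h : ∀ A ∈ l, diamondNorm A ≤ Λ) :
    HasExpJet (toDiamond ι (strang l)) (toDiamond ι l.sum)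
      ((1 / 2 : ℂ) • (toDiamond ι l.sum) ^ 2) (l.length * Λ) := by
  induction l with
  | nil => constructor <;> simp [strang, expTail]
  | cons A l ih =>
    have hA : ‖toDiamond ι ((1 / 2 : ℂ) • A)‖ ≤ Λ / 2 := by
      rw [map_smul, norm_smul, norm_toDiamond, show ‖(1 / 2 : ℂ)‖ = 1 / 2 by simp]
      linarith [h A (by simp)]
    have hE := hasExpJet_exp hA
    rw [← toDiamond_superExp] at hE
    have := (hE.mul norm_one_diamondAlgebra_le (ih fun B hB => h B (by simp [hB]))).mul
      norm_one_diamondAlgebra_le hE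
    rw [← map_mul, ← map_mul] at this
    convert! this using 1
    · simp only [List.sum_cons, map_add, map_smul]; module
    · simp only [List.sum_cons, map_add, map_smul, pow_two, mul_add, add_mul, smul_mul_assoc,
        mul_smul_comm]
      module
    · simp; ring

/-- The error of the symmetric product formula is of third order. -/
theorem diamondNorm_strang_sub_superExp_le {Λ : ℝ} {l : List (SuperOp ι)}
    (h : ∀ A ∈ l, diamondNorm A ≤ Λ) (h1 : l.length * Λ ≤ 1) :
    diamondNorm (strang l - superExp l.sum) ≤ (l.length * Λ) ^ 3 / 2 := by
  have hJ := hasExpJet_strang l h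
  have hE := hasExpJet_exp hJ.norm_fst
  rw [← toDiamond_superExp] at hE
  rw [← norm_toDiamond, map_sub, ← sub_sub_sub_cancel_right _ _
    (1 + toDiamond ι l.sum + (1 / 2 : ℂ) • (toDiamond ι l.sum) ^ 2)]
  refine (norm_sub_le_of_le hJ.norm_sub hE.norm_sub).trans ?_
  rw [← two_mul]
  exact two_mul_expTail_le ((norm_nonneg _).trans hJ.norm_fst) h1

theorem diamondNorm_strang_le {l : List (SuperOp ι)} (h : ∀ A ∈ l, IsLindbladian A) :
    diamondNorm (strang l) ≤ 1 := by
  induction l with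
  | nil =>
    rw [strang, ← norm_toDiamond, map_one]
    exact norm_one_diamondAlgebra_le
  | cons A l ih =>
    have hA : ‖toDiamond ι (superExp ((1 / 2 : ℂ) • A))‖ ≤ 1 := by
      have := ((h A (by simp)).smul (t := 1 / 2) (by norm_num)).diamondNorm_superExp_le
      rw [norm_toDiamond]
      simpa using this
    rw [strang, ← norm_toDiamond, map_mul, map_mul]
    have h2 := ih fun B hB => h B (by simp [hB])
    rw [← norm_toDiamond] at h2
    simpa using norm_mul_le_of_le (norm_mul_le_of_le hA h2) hA

/-- The error of `r` steps of the symmetric product formula. -/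
theorem diamondNorm_strang_pow_sub_superExp_le {Λ : ℝ} {l : List (SuperOp ι)} (r : ℕ)
    (hl : ∀ A ∈ l, IsLindbladian A) (hsum : IsLindbladian l.sum)
    (h : ∀ A ∈ l, diamondNorm A ≤ Λ) (h1 : l.length * Λ ≤ 1) :
    diamondNorm (strang l ^ r - superExp ((r : ℂ) • l.sum)) ≤ r * ((l.length * Λ) ^ 3 / 2) := by
  rw [Nat.cast_smul_eq_nsmul, superExp_nsmul, ← norm_toDiamond, map_sub, map_pow, map_pow]
  have hS := diamondNorm_strang_le hl
  have hE := hsum.diamondNorm_superExp_le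
  have hD := diamondNorm_strang_sub_superExp_le h h1
  rw [← norm_toDiamond] at hS hE hD
  rw [map_sub] at hD
  exact (norm_pow_sub_pow_le norm_one_diamondAlgebra_le hS hE r).trans
    (mul_le_mul_of_nonneg_left hD (Nat.cast_nonneg r))

end Strang

/-! ### Operators on some of the qubits of a register -/

section Embed

variable {r q s : Type*}

/-- A bit string on `q` is a pair of bit strings, on the image of `f` and on its complement. -/
def bitSplit (f : r ↪ q) : BitString q ≃ BitString r × BitString {k // k ∉ Set.range f} :=
  Equiv.ofBijective (fun x => (fun i => x (f i), fun k => x k.1)) (by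
    classical
    constructor
    · intro x y h
      funext k
      by_cases hk : k ∈ Set.range f
      · obtain ⟨i, rfl⟩ := hk
        exact congrFun (congrArg Prod.fst h) i
      · exact congrFun (congrArg Prod.snd h) ⟨k, hk⟩
    · rintro ⟨u, w⟩
      refine ⟨fun k => if h : k ∈ Set.range f then u h.choose else w ⟨k, h⟩, ?_⟩
      refine Prod.ext ?_ ?_
      · funext i
        have h : f i ∈ Set.range f := ⟨i, rfl⟩
        simp only [dif_pos h]
        exact congrArg u (f.injective h.choose_spec)
      · funext k
        exact dif_neg k.2)

theorem bitSplit_apply (f : r ↪ q) (x : BitString q) :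
    bitSplit f x = (fun i => x (f i), fun k => x k.1) := rfl

variable [Fintype r] [DecidableEq r] [Fintype q] [DecidableEq q] [Fintype s] [DecidableEq s]

open scoped Classical in
/-- The operator on the qubits `q` that acts as `a` on the image of `f : r ↪ q` and as the
identity on the other qubits. -/
def embedOp (f : r ↪ q) : Op (BitString r) →⋆ₐ[ℂ] Op (BitString q) := liftOp (bitSplit f)

open scoped Classical in
theorem embedOp_apply (f : r ↪ q) (a : Op (BitString r)) (x y : BitString q) :
    embedOp f a x y = if ∀ k ∉ Set.range f, x k = y k then
      a (fun i => x (f i)) (fun i => y (f i)) else 0 := by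
  rw [embedOp, liftOp_apply]
  refine if_congr ?_ rfl rfl
  rw [bitSplit_apply, bitSplit_apply, funext_iff, Subtype.forall]

theorem embedOp_apply_of_forall {f : r ↪ q} (a : Op (BitString r)) {x y : BitString q}
    (h : ∀ k ∉ Set.range f, x k = y k) :
    embedOp f a x y = a (fun i => x (f i)) (fun i => y (f i)) := by
  rw [embedOp_apply, if_pos h]

theorem embedOp_conjTranspose (f : r ↪ q) (a : Op (BitString r)) :
    embedOp f aᴴ = (embedOp f a)ᴴ := map_star (embedOp f) a

theorem norm_embedOp_le (f : r ↪ q) (a : Op (BitString r)) : ‖embedOp f a‖ ≤ ‖a‖ :=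
  norm_liftOp_le _ _

theorem embedOp_embedOp (f : r ↪ q) (g : s ↪ r) (a : Op (BitString s)) :
    embedOp f (embedOp g a) = embedOp (g.trans f) a := by
  ext x y
  simp only [embedOp_apply, ← ite_and]
  refine if_congr ?_ rfl rfl
  constructor
  · rintro ⟨h1, h2⟩ k hk
    by_cases hf : k ∈ Set.range f
    · obtain ⟨i, rfl⟩ := hf
      exact h2 i fun ⟨j, hj⟩ => hk ⟨j, by simp [hj]⟩
    · exact h1 k hf
  · intro h
    refine ⟨fun k hk => h k fun ⟨j, hj⟩ => hk ⟨g j, hj⟩, fun i hi => h (f i) ?_⟩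
    rintro ⟨j, hj⟩
    exact hi ⟨j, f.injective hj⟩

/-- A matrix element `⟨x| a ⊗ 1` is a sum over the bit strings that agree with `x` off the
image of `f`. -/
theorem sum_embedOp_mul (f : r ↪ q) (a : Op (BitString r)) (x : BitString q)
    (G : BitString q → ℂ) :
    ∑ z, embedOp f a x z * G z =
      ∑ u, a (fun i => x (f i)) u * G ((bitSplit f).symm (u, (bitSplit f x).2)) := by
  classical
  rw [← Equiv.sum_comp (bitSplit f).symm, Fintype.sum_prod_type]
  refine Finset.sum_congr rfl fun u _ => ?_
  rw [Finset.sum_eq_single (bitSplit f x).2]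
  · rw [embedOp, liftOp_apply, Equiv.apply_symm_apply, if_pos rfl]; rfl
  · intro w _ hw
    rw [embedOp, liftOp_apply, Equiv.apply_symm_apply, if_neg (Ne.symm hw), zero_mul]
  · simp

theorem sum_mul_embedOp (f : r ↪ q) (a : Op (BitString r)) (y : BitString q)
    (G : BitString q → ℂ) :
    ∑ z, G z * embedOp f a z y =
      ∑ u, G ((bitSplit f).symm (u, (bitSplit f y).2)) * a u (fun i => y (f i)) := by
  classical
  rw [← Equiv.sum_comp (bitSplit f).symm, Fintype.sum_prod_type]
  refine Finset.sum_congr rfl fun u _ => ?_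
  rw [Finset.sum_eq_single (bitSplit f y).2]
  · rw [embedOp, liftOp_apply, Equiv.apply_symm_apply, if_pos rfl]; rfl
  · intro w _ hw
    rw [embedOp, liftOp_apply, Equiv.apply_symm_apply, if_neg hw, mul_zero]
  · simp

theorem trace_embedOp (f : r ↪ q) (a : Op (BitString r)) :
    2 ^ Fintype.card r * (embedOp f a).trace = 2 ^ Fintype.card q * a.trace := by
  classical
  have hcard : (2 : ℂ) ^ Fintype.card q =
      2 ^ Fintype.card r * (Fintype.card (BitString {k // k ∉ Set.range f}) : ℂ) := by
    have := Fintype.card_congr (bitSplit f)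
    rw [Fintype.card_prod, Fintype.card_fun, Fintype.card_fun, Fintype.card_fin] at this
    exact_mod_cast this
  have htr : (embedOp f a).trace =
      Fintype.card (BitString {k // k ∉ Set.range f}) * a.trace := by
    simp only [Matrix.trace, Matrix.diag_apply, embedOp, liftOp_apply, if_true]
    rw [← Equiv.sum_comp (bitSplit f).symm, Fintype.sum_prod_type]
    simp [Finset.mul_sum]
  rw [hcard, htr]; ring

end Embed

/-! ### Superoperators on some of the qubits -/

section Extend

variable {q : Type*} [DecidableEq q]

theorem glue_apply_mem (S : Finset q) (u : BitString S) (x : BitString q) (i : S) :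
    glue S u x i = u i := by simp [glue]

theorem glue_glue (S : Finset q) (u v : BitString S) (x : BitString q) :
    glue S u (glue S v x) = glue S u x := by
  funext i
  simp only [glue]
  split_ifs <;> rfl

/-- The inclusion of a set of qubits into the register. -/
abbrev qubitInclusion (S : Finset q) : S ↪ q := Function.Embedding.subtype (· ∈ S)

theorem bitSplit_symm_eq_glue (S : Finset q) (u : BitString S) (x : BitString q) :
    (bitSplit (qubitInclusion S)).symm (u, (bitSplit (qubitInclusion S) x).2) = glue S u x := by
  rw [Equiv.symm_apply_eq]
  refine Prod.ext ?_ ?_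
  · funext i
    exact (glue_apply_mem S u x i).symm
  · funext ⟨k, hk⟩
    have : k ∉ S := by simpa using hk
    change x k = glue S u x k
    simp [glue, this]

/-- `K ↦ K ⊗ I` as a homomorphism of algebras. -/
def extendHom (S : Finset q) : SuperOp (BitString S) →ₐ[ℂ] SuperOp (BitString q) :=
  AlgHom.ofLinearMap
    { toFun := extendByIdentity S
      map_add' := fun _ _ => rfl
      map_smul' := fun _ _ => rfl }
    (by
      ext1 X
      ext x y
      change X (glue S _ x) (glue S _ y) = X x y
      congr 1 <;>
      · funext i
        simp [glue])
    (by
      intro K K'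
      ext1 X
      ext x y
      change K (K' (of fun u v => X (glue S u x) (glue S v y))) _ _ =
        K (of fun u v => K' (of fun u' v' => X (glue S u' (glue S u x)) (glue S v' (glue S v y)))
          (fun i => glue S u x i) (fun i => glue S v y i)) _ _
      simp only [glue_glue, glue_apply_mem]
      rfl)

variable [Fintype q]

theorem extendHom_sandwich (S : Finset q) (a b : Op (BitString S)) :
    extendHom S (sandwich a b) =
      sandwich (embedOp (qubitInclusion S) a) (embedOp (qubitInclusion S) b) := by
  ext1 X
  ext x y
  rw [sandwich_apply, Matrix.mul_apply, sum_mul_embedOp]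
  simp only [Matrix.mul_apply, sum_embedOp_mul, bitSplit_symm_eq_glue]
  change sandwich a b (of fun u v => X (glue S u x) (glue S v y)) (fun i => x i) (fun i => y i) = _
  simp only [sandwich_apply, Matrix.mul_apply, of_apply]
  rfl

theorem extendHom_krausMap {κ : Type*} [Fintype κ] (S : Finset q) (K : κ → Op (BitString S)) :
    extendHom S (krausMap K) = krausMap fun k => embedOp (qubitInclusion S) (K k) := by
  simp only [krausMap, map_sum, extendHom_sandwich, embedOp_conjTranspose]

theorem extendHom_lindbladian {κ : Type*} [Fintype κ] (S : Finset q) (H : Op (BitString S))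
    (L : κ → Op (BitString S)) :
    extendHom S (lindbladian H L) = lindbladian (embedOp (qubitInclusion S) H)
      fun j => embedOp (qubitInclusion S) (L j) := by
  simp only [lindbladian, hamiltonianPart, dissipator, map_add, map_sub, map_smul, map_sum,
    extendHom_sandwich, map_one, map_mul, embedOp_conjTranspose]

theorem superExp_extendHom (S : Finset q) (K : SuperOp (BitString S)) :
    superExp (extendHom S K) = extendHom S (superExp K) := (map_superExp (extendHom S) K).symm

/-- An operator on the qubits in `S` is an operator on any larger set of qubits. -/
theorem exists_embedOp_of_subset {S S' : Finset q} (h : S ⊆ S') (a : Op (BitString S)) :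
    ∃ b, embedOp (qubitInclusion S') b = embedOp (qubitInclusion S) a := by
  refine ⟨embedOp ⟨fun i : S => (⟨i, h i.2⟩ : S'), fun i j hij => ?_⟩ a, ?_⟩
  · exact Subtype.ext (congrArg (fun k : S' => (k : q)) hij)
  · rw [embedOp_embedOp]; rfl

end Extend

/-! ### Lower bounds on the diamond norm of a Lindbladian -/

section Overlap

variable {ι : Type*} [Fintype ι]

theorem norm_toLp_sq (v : ι → ℂ) : ‖WithLp.toLp 2 v‖ ^ 2 = ∑ i, ‖v i‖ ^ 2 := by
  rw [EuclideanSpace.norm_sq_eq]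

/-- The squared Hilbert-Schmidt norm. -/
def hsSq (A : Op ι) : ℝ := ∑ i, ∑ j, ‖A i j‖ ^ 2

theorem hsSq_nonneg (A : Op ι) : 0 ≤ hsSq A := by unfold hsSq; positivity

theorem trace_conjTranspose_mul_self_eq_hsSq (A : Op ι) : (Aᴴ * A).trace = (hsSq A : ℂ) := by
  rw [hsSq, Finset.sum_comm]
  simp only [Matrix.trace, Matrix.diag_apply, Matrix.mul_apply, conjTranspose_apply]
  push_cast
  refine Finset.sum_congr rfl fun i _ => Finset.sum_congr rfl fun j _ => ?_
  rw [Complex.star_def, Complex.conj_mul']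

variable [DecidableEq ι]

theorem norm_star_dotProduct_mulVec_le (M : Op ι) (w u : ι → ℂ) :
    ‖star w ⬝ᵥ (M *ᵥ u)‖ ≤ ‖M‖ * (‖WithLp.toLp 2 w‖ * ‖WithLp.toLp 2 u‖) := by
  have h : star w ⬝ᵥ (M *ᵥ u) = inner ℂ (WithLp.toLp 2 w) (toEuclideanLin M (WithLp.toLp 2 u)) := by
    rw [EuclideanSpace.inner_eq_star_dotProduct, dotProduct_comm]
    simp [Matrix.toLpLin_apply]
  rw [h]
  calc _ ≤ ‖WithLp.toLp 2 w‖ * (‖M‖ * ‖WithLp.toLp 2 u‖) :=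
        (norm_inner_le_norm _ _).trans
          (mul_le_mul_of_nonneg_left (norm_toEuclideanLin_le _ _) (norm_nonneg _))
    _ = _ := by ring

theorem norm_vecMulVec_star_le (u w : ι → ℂ) :
    ‖(vecMulVec u (star w) : Op ι)‖ ≤ ‖WithLp.toLp 2 u‖ * ‖WithLp.toLp 2 w‖ := by
  refine opNorm_le_of_toEuclideanLin (by positivity) fun x => ?_
  have h : toEuclideanLin (vecMulVec u (star w) : Op ι) x =
      (inner ℂ (WithLp.toLp 2 w) x : ℂ) • WithLp.toLp 2 u := by
    ext i
    simp [Matrix.toLpLin_apply, Matrix.vecMulVec_mulVec, EuclideanSpace.inner_eq_star_dotProduct,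
      dotProduct_comm, mul_comm]
  rw [h, norm_smul]
  calc _ ≤ (‖WithLp.toLp 2 w‖ * ‖x‖) * ‖WithLp.toLp 2 u‖ :=
        mul_le_mul_of_nonneg_right (norm_inner_le_norm _ _) (norm_nonneg _)
    _ = _ := by ring

theorem opNorm_sq_le_hsSq (A : Op ι) : ‖A‖ ^ 2 ≤ hsSq A := by
  have h : ‖A‖ ≤ √(hsSq A) := by
    refine opNorm_le_of_toEuclideanLin (Real.sqrt_nonneg _) fun x => ?_
    rw [← sq_le_sq₀ (norm_nonneg _) (by positivity), mul_pow, Real.sq_sqrt (hsSq_nonneg A),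
      EuclideanSpace.norm_sq_eq, hsSq, Finset.sum_mul]
    refine Finset.sum_le_sum fun i _ => ?_
    have h1 : toEuclideanLin A x i = inner ℂ (WithLp.toLp 2 (star (A i))) x := by
      rw [EuclideanSpace.inner_eq_star_dotProduct, dotProduct_comm]
      simp [Matrix.toLpLin_apply, Matrix.mulVec]
    rw [h1]
    have h2 := norm_inner_le_norm (𝕜 := ℂ) (WithLp.toLp 2 (star (A i))) x
    have h3 := pow_le_pow_left₀ (norm_nonneg _) h2 2
    rw [mul_pow, norm_toLp_sq] at h3
    simpa using h3
  calc ‖A‖ ^ 2 ≤ √(hsSq A) ^ 2 := pow_le_pow_left₀ (norm_nonneg _) h 2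
    _ = hsSq A := Real.sq_sqrt (hsSq_nonneg A)

theorem norm_trace_mul_conjTranspose_mul_self_le (B L : Op ι) (hB : ‖B‖ ≤ 1) :
    ‖(B * (Lᴴ * L)).trace‖ ≤ hsSq L := by
  have h : (B * (Lᴴ * L)).trace = ∑ i, star (star (L i)) ⬝ᵥ (B *ᵥ star (L i)) := by
    rw [← mul_assoc, trace_mul_comm, ← mul_assoc]
    simp only [Matrix.trace, Matrix.diag_apply, Matrix.mul_apply, star_star, dotProduct,
      mulVec, conjTranspose_apply, Finset.sum_mul, Finset.mul_sum, Pi.star_apply]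
    refine Finset.sum_congr rfl fun i _ => ?_
    rw [Finset.sum_comm]
    simp only [mul_assoc]
  rw [h, hsSq]
  refine (norm_sum_le _ _).trans (Finset.sum_le_sum fun i _ => ?_)
  refine (norm_star_dotProduct_mulVec_le _ _ _).trans ?_
  rw [← pow_two, norm_toLp_sq]
  refine (mul_le_of_le_one_left (by positivity) hB).trans (le_of_eq ?_)
  simp

/-- The matrix element `⟨BΩ| (T ⊗ I)(|Ω⟩⟨Ω|) |Ω⟩`, where `Ω = ∑ x, |x⟩|x⟩` and
`BΩ = (B ⊗ 1) Ω`. It is linear in `T`, and it factors into traces if `T` is `X ↦ A X C`. -/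
def overlap (B : Op ι) : SuperOp ι →ₗ[ℂ] ℂ where
  toFun T := ∑ x, ∑ z, ∑ y, star (B x z) * T (Matrix.single z y 1) x y
  map_add' S T := by simp [mul_add, Finset.sum_add_distrib]
  map_smul' a T := by
    simp only [LinearMap.smul_apply, Matrix.smul_apply, smul_eq_mul, RingHom.id_apply,
      Finset.mul_sum]
    refine Finset.sum_congr rfl fun x _ => Finset.sum_congr rfl fun z _ =>
      Finset.sum_congr rfl fun y _ => ?_
    ring

theorem overlap_sandwich (B A C : Op ι) :
    overlap B (sandwich A C) = (Bᴴ * A).trace * C.trace := by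
  have h (x y z : ι) : sandwich A C (Matrix.single z y 1) x y = A x z * C y y := by
    rw [sandwich_apply, Matrix.mul_apply, Finset.sum_eq_single y]
    · rw [Matrix.mul_single_apply_same, mul_one]
    · intro j _ hj
      rw [Matrix.mul_single_apply_of_ne _ _ _ _ _ hj, zero_mul]
    · simp
  change ∑ x, ∑ z, ∑ y, star (B x z) * sandwich A C (Matrix.single z y 1) x y = _
  simp only [h, Matrix.trace, Matrix.diag_apply, Matrix.mul_apply, conjTranspose_apply]
  rw [Finset.sum_comm, Finset.sum_mul]
  refine Finset.sum_congr rfl fun z _ => ?_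
  rw [Finset.sum_mul]
  refine Finset.sum_congr rfl fun x _ => ?_
  rw [Finset.mul_sum]
  exact Finset.sum_congr rfl fun y _ => (mul_assoc _ _ _).symm

/-- Both `B Ω` and `Ω` have norm `√N`, where `N` is the dimension. -/
theorem norm_overlap_le {B : Op ι} (hB : Bᴴ * B = 1) (T : SuperOp ι) :
    ‖overlap B T‖ ≤ Fintype.card ι ^ 2 * diamondNorm T := by
  let ω : ι × ι → ℂ := fun p => if p.1 = p.2 then 1 else 0
  let β : ι × ι → ℂ := fun p => B p.1 p.2
  have hω : ‖WithLp.toLp 2 ω‖ ^ 2 = Fintype.card ι := by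
    rw [norm_toLp_sq, Fintype.sum_prod_type]
    have : ∀ x y : ι, ‖ω (x, y)‖ ^ 2 = if x = y then 1 else 0 := by
      intro x y; simp only [ω]; split_ifs <;> simp
    simp [this]
  have hβ : ‖WithLp.toLp 2 β‖ ^ 2 = Fintype.card ι := by
    rw [norm_toLp_sq, Fintype.sum_prod_type]
    have h1 := trace_conjTranspose_mul_self_eq_hsSq B
    rw [hB, trace_one] at h1
    exact_mod_cast h1.symm
  set Y := ampliation ι T (vecMulVec ω (star ω)) with hY
  have hYent (x y z w : ι) : Y (x, z) (y, w) = T (Matrix.single z w 1) x y := by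
    refine congrArg (fun M => T M x y) ?_
    ext p q
    simp [vecMulVec, ω, Matrix.single_apply, ← ite_and, eq_comm, and_comm]
  have hov : overlap B T = (vecMulVec ω (star β) * Y).trace := by
    rw [Matrix.vecMulVec_mul, Matrix.trace_vecMulVec]
    change ∑ x, ∑ z, ∑ y, star (B x z) * T (Matrix.single z y 1) x y = _
    simp only [dotProduct, vecMul, Fintype.sum_prod_type, hYent, ω, β, ite_mul, one_mul, zero_mul,
      Pi.star_apply, Finset.sum_ite_eq, Finset.mem_univ, if_true]
    conv_rhs => rw [Finset.sum_comm]
    exact Finset.sum_congr rfl fun x _ => Finset.sum_comm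
  have htn : traceNorm (vecMulVec ω (star ω)) ≤ Fintype.card ι := by
    refine traceNorm_le_of_forall fun M hM => ?_
    rw [Matrix.mul_vecMulVec, Matrix.trace_vecMulVec, dotProduct_comm]
    refine (norm_star_dotProduct_mulVec_le _ _ _).trans ?_
    rw [← pow_two, hω]
    exact mul_le_of_le_one_left (by positivity) hM
  rw [hov]
  have hn : ‖(vecMulVec ω (star β) : Op (ι × ι))‖ ≤ Fintype.card ι := by
    refine (norm_vecMulVec_star_le _ _).trans ?_
    have : ‖WithLp.toLp 2 ω‖ = ‖WithLp.toLp 2 β‖ := by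
      rw [← sq_eq_sq₀ (norm_nonneg _) (norm_nonneg _), hω, hβ]
    rw [this, ← pow_two, hβ]
  calc _ ≤ ‖(vecMulVec ω (star β) : Op (ι × ι))‖ * traceNorm Y := norm_trace_mul_le _ _
    _ ≤ Fintype.card ι * (diamondNorm T * Fintype.card ι) := by
        refine mul_le_mul hn ?_ (traceNorm_nonneg _) (by positivity)
        exact (traceNorm_ampliation_le _ _).trans
          (mul_le_mul_of_nonneg_left htn (diamondNorm_nonneg _))
    _ = _ := by ring

variable {κ : Type*} [Fintype κ]

/-- The terms `L ρ L†` do not contribute because the Lindblad operators are traceless. -/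
theorem overlap_lindbladian (B H : Op ι) (L : κ → Op ι) (hL : ∀ j, (L j).trace = 0) :
    overlap B (lindbladian H L) =
      -Complex.I * ((Bᴴ * H).trace * Fintype.card ι - Bᴴ.trace * H.trace) -
      (1 / 2) * ∑ j, ((Bᴴ * ((L j)ᴴ * L j)).trace * Fintype.card ι + Bᴴ.trace * hsSq (L j)) := by
  simp only [lindbladian, hamiltonianPart, dissipator, map_add, map_sub, map_smul, map_sum,
    overlap_sandwich, trace_conjTranspose, hL, star_zero, mul_zero, trace_one, mul_one,
    trace_conjTranspose_mul_self_eq_hsSq, smul_eq_mul, zero_sub, Finset.sum_neg_distrib,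
    Finset.mul_sum]
  ring

/-- The dissipative parts of a Lindbladian cannot cancel: if the Lindblad operators are
traceless, their Hilbert-Schmidt norms are controlled by the diamond norm. -/
theorem sum_hsSq_le [Nonempty ι] (H : Op ι) (L : κ → Op ι) (hL : ∀ j, (L j).trace = 0) :
    ∑ j, hsSq (L j) ≤ Fintype.card ι * diamondNorm (lindbladian H L) := by
  have h := norm_overlap_le (B := (1 : Op ι)) (by simp) (lindbladian H L)
  have e : overlap 1 (lindbladian H L) = -((Fintype.card ι * ∑ j, hsSq (L j) : ℝ) : ℂ) := by
    rw [overlap_lindbladian _ _ _ hL]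
    simp only [conjTranspose_one, one_mul, trace_one, trace_conjTranspose_mul_self_eq_hsSq,
      Finset.sum_add_distrib, ← Finset.sum_mul, ← Finset.mul_sum]
    push_cast
    ring
  have hd : (0 : ℝ) < Fintype.card ι := by exact_mod_cast Fintype.card_pos
  have h0 : 0 ≤ ∑ j, hsSq (L j) := Finset.sum_nonneg fun j _ => hsSq_nonneg _
  rw [e, norm_neg, Complex.norm_real, Real.norm_of_nonneg (by positivity)] at h
  rw [pow_two, mul_assoc] at h
  exact le_of_mul_le_mul_left h hd

/-- The component of the Hamiltonian along a traceless unitary is controlled by the diamond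
norm. -/
theorem norm_trace_mul_hamiltonian_le [Nonempty ι] {B : Op ι} (hB : Bᴴ * B = 1)
    (hB0 : B.trace = 0) (H : Op ι) (L : κ → Op ι) (hL : ∀ j, (L j).trace = 0) :
    ‖(Bᴴ * H).trace‖ ≤ 3 / 2 * (Fintype.card ι * diamondNorm (lindbladian H L)) := by
  have h := norm_overlap_le hB (lindbladian H L)
  have hd : (0 : ℝ) < Fintype.card ι := by exact_mod_cast Fintype.card_pos
  have hd' : (Fintype.card ι : ℂ) ≠ 0 := by exact_mod_cast hd.ne'
  have hBn : ‖Bᴴ‖ ≤ 1 := by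
    have h2 := Matrix.l2_opNorm_conjTranspose_mul_self B
    rw [hB, norm_one] at h2
    rw [Matrix.l2_opNorm_conjTranspose]
    nlinarith [norm_nonneg B]
  have e := overlap_lindbladian B H L hL
  simp only [trace_conjTranspose B, hB0, star_zero, zero_mul, sub_zero, add_zero,
    ← Finset.sum_mul] at e
  set s := ∑ j, (Bᴴ * ((L j)ᴴ * L j)).trace with hs
  have hsn : ‖s‖ ≤ Fintype.card ι * diamondNorm (lindbladian H L) :=
    (norm_sum_le _ _).trans ((Finset.sum_le_sum fun j _ =>
      norm_trace_mul_conjTranspose_mul_self_le _ _ hBn).trans (sum_hsSq_le H L hL))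
  have e2 : (Bᴴ * H).trace = Complex.I * ((Fintype.card ι : ℂ)⁻¹ * overlap B (lindbladian H L) +
      (1 / 2) * s) := by
    rw [e]
    field_simp
    linear_combination 2 * (Bᴴ * H).trace * Complex.I_sq
  rw [e2, norm_mul, Complex.norm_I, one_mul]
  refine (norm_add_le _ _).trans ?_
  rw [norm_mul, norm_mul, norm_inv, Complex.norm_natCast, show ‖(1 / 2 : ℂ)‖ = 1 / 2 by simp]
  have h3 : (Fintype.card ι : ℝ)⁻¹ * ‖overlap B (lindbladian H L)‖ ≤
      Fintype.card ι * diamondNorm (lindbladian H L) := by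
    rw [inv_mul_le_iff₀ hd]
    linarith
  linarith

/-- The gauge freedom of a Lindbladian: shifting a Lindblad operator by a multiple of the
identity changes only the Hamiltonian. -/
theorem dissipator_add_smul_one (A : Op ι) (z : ℂ) :
    dissipator (A + z • 1) = dissipator A +
      hamiltonianPart ((Complex.I / 2) • (star z • A - z • Aᴴ)) := by
  ext1 ρ
  simp only [dissipator, hamiltonianPart, sandwich_apply, LinearMap.smul_apply,
    LinearMap.sub_apply, LinearMap.add_apply, smul_mul_assoc, mul_smul_comm, one_mul, mul_one,
    conjTranspose_add, conjTranspose_smul, conjTranspose_one, add_mul, mul_add, sub_mul, mul_sub]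
  match_scalars <;> ring_nf <;> simp <;> ring

theorem exists_traceless_lindbladian [Nonempty ι] {H : Op ι} (hH : H.IsHermitian) (L : κ → Op ι) :
    ∃ (H' : Op ι) (L' : κ → Op ι), H'.IsHermitian ∧ (∀ j, (L' j).trace = 0) ∧
      lindbladian H L = lindbladian H' L' := by
  let z : κ → ℂ := fun j => (L j).trace / Fintype.card ι
  let L' : κ → Op ι := fun j => L j - z j • 1
  refine ⟨H + ∑ j, (Complex.I / 2) • (star (z j) • L' j - z j • (L' j)ᴴ), L', ?_, ?_, ?_⟩
  · refine hH.add ?_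
    rw [Matrix.IsHermitian, conjTranspose_sum]
    refine Finset.sum_congr rfl fun j _ => ?_
    simp only [conjTranspose_smul, conjTranspose_sub, conjTranspose_conjTranspose, star_star]
    simp only [Complex.star_def, map_div₀, Complex.conj_I, map_ofNat]
    module
  · intro j
    have hd : (Fintype.card ι : ℂ) ≠ 0 := by exact_mod_cast Fintype.card_ne_zero
    simp [L', z, trace_sub, trace_smul, hd]
  · have h (j : κ) : dissipator (L j) = dissipator (L' j) +
        hamiltonianPart ((Complex.I / 2) • (star (z j) • L' j - z j • (L' j)ᴴ)) := by
      rw [← dissipator_add_smul_one]; simp [L']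
    simp only [lindbladian, hamiltonianPart_add, hamiltonianPart_sum, h, Finset.sum_add_distrib]
    abel

end Overlap

/-! ### Pauli strings -/

section Pauli

/-- The identity and the three Pauli matrices. -/
def pauli : Fin 4 → Matrix (Fin 2) (Fin 2) ℂ :=
  ![!![1, 0; 0, 1], !![0, 1; 1, 0], !![0, -Complex.I; Complex.I, 0], !![1, 0; 0, -1]]

theorem pauli_zero : pauli 0 = 1 := by
  ext i j; fin_cases i <;> fin_cases j <;> simp [pauli]

theorem star_pauli (p : Fin 4) (i j : Fin 2) : star (pauli p i j) = pauli p j i := by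
  fin_cases p <;> fin_cases i <;> fin_cases j <;> simp [pauli]

theorem pauli_mul_self (p : Fin 4) : pauli p * pauli p = 1 := by
  fin_cases p <;> ext i j <;> fin_cases i <;> fin_cases j <;>
    simp [pauli, Matrix.mul_apply, Fin.sum_univ_two]

theorem trace_pauli {p : Fin 4} (hp : p ≠ 0) : (pauli p).trace = 0 := by
  fin_cases p <;> simp_all [pauli, Matrix.trace, Fin.sum_univ_two]

/-- The swap operator on two qubits is half the sum of the `σ ⊗ σ`. -/
theorem sum_pauli_mul_pauli (i j k l : Fin 2) :
    ∑ p, pauli p i j * pauli p k l = if i = l ∧ j = k then 2 else 0 := by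
  fin_cases i <;> fin_cases j <;> fin_cases k <;> fin_cases l <;>
    simp [pauli, Fin.sum_univ_four] <;> norm_num

variable {q : Type*} [Fintype q]

/-- The tensor product of the Pauli matrices with labels `P`. -/
def pauliString (P : q → Fin 4) : Op (BitString q) := of fun x y => ∏ i, pauli (P i) (x i) (y i)

theorem isHermitian_pauliString (P : q → Fin 4) : (pauliString P).IsHermitian := by
  ext x y
  simp only [conjTranspose_apply, pauliString, of_apply, star_prod, star_pauli]

theorem pauliString_zero : pauliString (0 : q → Fin 4) = 1 := by
  ext x y
  simp only [pauliString, of_apply, Pi.zero_apply, pauli_zero, Matrix.one_apply,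
    Finset.prod_ite_zero, Finset.prod_const_one, Finset.mem_univ, true_imp_iff, funext_iff]

variable [DecidableEq q]

theorem pauliString_mul_apply (P Q : q → Fin 4) (x y : BitString q) :
    (pauliString P * pauliString Q) x y = ∏ i, (pauli (P i) * pauli (Q i)) (x i) (y i) := by
  simp only [Matrix.mul_apply, pauliString, of_apply, ← Finset.prod_mul_distrib]
  rw [Finset.prod_univ_sum, Fintype.piFinset_univ]

theorem pauliString_mul_self (P : q → Fin 4) : pauliString P * pauliString P = 1 := by
  ext x y
  rw [pauliString_mul_apply]
  simp only [pauli_mul_self, Matrix.one_apply, Finset.prod_ite_zero, Finset.prod_const_one,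
    Finset.mem_univ, true_imp_iff, funext_iff]

theorem trace_pauliString_mul (P Q : q → Fin 4) :
    (pauliString P * pauliString Q).trace = ∏ i, (pauli (P i) * pauli (Q i)).trace := by
  simp only [Matrix.trace, Matrix.diag_apply, pauliString_mul_apply]
  rw [Finset.prod_univ_sum, Fintype.piFinset_univ]

theorem trace_pauliString_mul_eq_zero {P Q : q → Fin 4} {k : q} (hP : P k ≠ 0) (hQ : Q k = 0) :
    (pauliString P * pauliString Q).trace = 0 := by
  rw [trace_pauliString_mul]
  refine Finset.prod_eq_zero (Finset.mem_univ k) ?_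
  rw [hQ, pauli_zero, mul_one, trace_pauli hP]

theorem trace_pauliString {P : q → Fin 4} (hP : P ≠ 0) : (pauliString P).trace = 0 := by
  obtain ⟨k, hk⟩ := Function.ne_iff.mp hP
  rw [← mul_one (pauliString P), ← pauliString_zero]
  exact trace_pauliString_mul_eq_zero hk rfl

/-- The Pauli strings are a basis of the operators. -/
theorem eq_sum_pauliString (A : Op (BitString q)) :
    A = ∑ P, (((2 : ℂ) ^ Fintype.card q)⁻¹ * (pauliString P * A).trace) • pauliString P := by
  have h2 : ((2 : ℂ) ^ Fintype.card q) ≠ 0 := by positivity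
  have key (u v x y : BitString q) :
      ∑ P : q → Fin 4, pauliString P u v * pauliString P x y =
        if u = y ∧ v = x then 2 ^ Fintype.card q else 0 := by
    simp only [pauliString, of_apply, ← Finset.prod_mul_distrib]
    have := Finset.prod_univ_sum (fun _ : q => (Finset.univ : Finset (Fin 4)))
      (fun i p => pauli p (u i) (v i) * pauli p (x i) (y i))
    rw [Fintype.piFinset_univ] at this
    rw [← this]
    simp only [sum_pauli_mul_pauli, Finset.prod_ite_zero, Finset.prod_const, Finset.mem_univ,
      true_imp_iff, funext_iff, forall_and, Finset.card_univ]
  ext x y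
  have h3 : ∑ P : q → Fin 4, (pauliString P * A).trace * pauliString P x y =
      2 ^ Fintype.card q * A x y := by
    simp only [Matrix.trace, Matrix.diag_apply, Matrix.mul_apply, Finset.sum_mul]
    rw [Finset.sum_comm]
    simp only [Finset.sum_comm (s := (Finset.univ : Finset (q → Fin 4)))]
    have : ∀ u v : BitString q, ∑ P : q → Fin 4, pauliString P u v * A v u * pauliString P x y =
        if u = y ∧ v = x then 2 ^ Fintype.card q * A v u else 0 := by
      intro u v
      rw [← Finset.sum_congr rfl fun P _ => (mul_right_comm _ _ _), ← Finset.sum_mul, key,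
        ite_mul, zero_mul]
    simp only [this, ite_and]
    simp
  rw [Matrix.sum_apply]
  simp only [Matrix.smul_apply, smul_eq_mul, mul_assoc, ← Finset.mul_sum, h3]
  rw [inv_mul_cancel_left₀ h2]

/-- The labels of a Pauli string on the qubits in `S`, extended by the identity. -/
def extendLabels (S : Finset q) (P : S → Fin 4) : q → Fin 4 :=
  fun k => if h : k ∈ S then P ⟨k, h⟩ else 0

theorem embedOp_pauliString (S : Finset q) (P : S → Fin 4) :
    embedOp (qubitInclusion S) (pauliString P) = pauliString (extendLabels S P) := by
  ext x y
  have hsplit : pauliString (extendLabels S P) x y =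
      (∏ i : S, pauli (P i) (x i) (y i)) * ∏ i ∈ Sᶜ, if x i = y i then 1 else 0 := by
    rw [pauliString, of_apply, ← Finset.prod_mul_prod_compl S, ← Finset.prod_coe_sort S]
    congr 1
    · refine Finset.prod_congr rfl fun i _ => ?_
      simp [extendLabels]
    · refine Finset.prod_congr rfl fun i hi => ?_
      rw [extendLabels, dif_neg (Finset.mem_compl.mp hi), pauli_zero, Matrix.one_apply]
  rw [hsplit, Finset.prod_ite_zero, embedOp_apply]
  have hiff : (∀ k ∉ Set.range (qubitInclusion S), x k = y k) ↔ ∀ i ∈ Sᶜ, x i = y i := by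
    simp
  simp only [hiff]
  split_ifs <;> simp [pauliString]

/-- Operators on the qubits in `S` have no component along a Pauli string that acts outside
of `S`. -/
theorem trace_pauliString_mul_embedOp {S : Finset q} {P : q → Fin 4} {k : q} (hk : k ∉ S)
    (hP : P k ≠ 0) (a : Op (BitString S)) :
    (pauliString P * embedOp (qubitInclusion S) a).trace = 0 := by
  rw [eq_sum_pauliString a, map_sum, Finset.mul_sum, trace_sum]
  refine Finset.sum_eq_zero fun Q _ => ?_
  rw [map_smul, mul_smul_comm, trace_smul, embedOp_pauliString,
    trace_pauliString_mul_eq_zero hP (dif_neg hk), smul_zero]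

theorem norm_pauliString_le (P : q → Fin 4) : ‖pauliString P‖ ≤ 1 := by
  have h2 := Matrix.l2_opNorm_conjTranspose_mul_self (pauliString P)
  rw [(isHermitian_pauliString P).eq, pauliString_mul_self, norm_one] at h2
  nlinarith [norm_nonneg (pauliString P)]

end Pauli

/-! ### Decomposition of a local Lindbladian into pieces of bounded norm -/

section Decomposition

variable {q : Type*} [Fintype q] [DecidableEq q]

theorem hamiltonianPart_one {ι : Type*} [Fintype ι] [DecidableEq ι] :
    hamiltonianPart (1 : Op ι) = 0 := by
  rw [hamiltonianPart, sub_self, smul_zero]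

theorem star_trace_mul_of_isHermitian {ι : Type*} [Fintype ι] {A B : Op ι}
    (hA : A.IsHermitian) (hB : B.IsHermitian) : star (A * B).trace = (A * B).trace := by
  rw [← trace_conjTranspose, conjTranspose_mul, hA.eq, hB.eq, trace_mul_comm]

/-- An operator on few qubits has an operator norm comparable to its normalized Hilbert-Schmidt
norm, whatever the size of the register. -/
theorem opNorm_sq_embedOp_le (S : Finset q) (a : Op (BitString S)) :
    ‖embedOp (qubitInclusion S) a‖ ^ 2 * 2 ^ Fintype.card q ≤
      2 ^ S.card * hsSq (embedOp (qubitInclusion S) a) := by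
  have h1 := trace_embedOp (qubitInclusion S) (aᴴ * a)
  rw [map_mul, embedOp_conjTranspose, trace_conjTranspose_mul_self_eq_hsSq,
    trace_conjTranspose_mul_self_eq_hsSq, Fintype.card_coe] at h1
  have h2 : (2 : ℝ) ^ S.card * hsSq (embedOp (qubitInclusion S) a) =
      2 ^ Fintype.card q * hsSq a := by exact_mod_cast h1
  rw [h2, mul_comm]
  gcongr
  exact (pow_le_pow_left₀ (norm_nonneg _) (norm_embedOp_le _ _) 2).trans (opNorm_sq_le_hsSq a)

/-- The traceless gauge is chosen within each local term. -/
theorem isLocalLindbladian_exists_traceless {c : ℕ} {T : SuperOp (BitString q)}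
    (hT : IsLocalLindbladian c T) :
    ∃ (m : ℕ) (S : Fin m → Finset q) (k : Fin m → ℕ) (H : ∀ i, Op (BitString (S i)))
      (L : ∀ i, Fin (k i) → Op (BitString (S i))),
      (∀ i, (S i).card ≤ c) ∧ (∀ i, (H i).IsHermitian) ∧ (∀ i j, (L i j).trace = 0) ∧
      T = lindbladian (∑ i, embedOp (qubitInclusion (S i)) (H i))
        fun p : Σ i, Fin (k i) => embedOp (qubitInclusion (S p.1)) (L p.1 p.2) := by
  obtain ⟨m, F, hF, rfl⟩ := hT
  have h (i : Fin m) : ∃ (S : Finset q) (k : ℕ) (H : Op (BitString S))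
      (L : Fin k → Op (BitString S)), S.card ≤ c ∧ H.IsHermitian ∧ (∀ j, (L j).trace = 0) ∧
      F i = extendHom S (lindbladian H L) := by
    obtain ⟨S, hS, K, hK, hFK⟩ := hF i
    obtain ⟨H, k, L, hH, rfl⟩ := isLindbladian_iff.mp hK
    obtain ⟨H', L', hH', hL', he⟩ := exists_traceless_lindbladian hH L
    exact ⟨S, k, H', L', hS, hH', hL', by rw [hFK, he]; rfl⟩
  choose S k H L hS hH hL hF using h
  refine ⟨m, S, k, H, L, hS, hH, hL, ?_⟩
  simp only [hF, extendHom_lindbladian]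
  simp only [lindbladian, hamiltonianPart_sum, Finset.sum_add_distrib, Fintype.sum_sigma]

/-- A `c`-local Lindbladian is a sum of Lindbladians on sets of `c` qubits whose norms are at most
`5 · 4^c` times the norm of the sum. The dissipative parts are kept as they are, in the traceless
gauge, where they cannot cancel. The Hamiltonians may cancel, so the total Hamiltonian is
distributed anew, one Pauli string at a time. -/
theorem IsLocalLindbladian.exists_decomposition {c : ℕ} (hc : c ≤ Fintype.card q)
    {T : SuperOp (BitString q)} (hT : IsLocalLindbladian c T) :
    ∃ F : Finset q → SuperOp (BitString q),
      (∀ S ∈ Finset.powersetCard c Finset.univ,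
        (∃ K : SuperOp (BitString S), IsLindbladian K ∧ F S = extendByIdentity S K) ∧
        diamondNorm (F S) ≤ 5 * 4 ^ c * diamondNorm T) ∧
      T = ∑ S ∈ Finset.powersetCard c Finset.univ, F S := by
  classical
  obtain ⟨m, S, k, H, L, hS, hH, hL, hTeq⟩ := isLocalLindbladian_exists_traceless hT
  set 𝓗 := ∑ i, embedOp (qubitInclusion (S i)) (H i) with h𝓗
  set 𝓙 : (Σ i, Fin (k i)) → Op (BitString q) :=
    fun p => embedOp (qubitInclusion (S p.1)) (L p.1 p.2) with h𝓙
  set D : ℝ := diamondNorm T with hD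
  have hcard : (Fintype.card (BitString q) : ℝ) = 2 ^ Fintype.card q := by simp
  have h𝓙0 (p) : (𝓙 p).trace = 0 := by
    have := trace_embedOp (qubitInclusion (S p.1)) (L p.1 p.2)
    rw [hL, mul_zero, mul_eq_zero] at this
    exact this.resolve_left (by positivity)
  have h𝓗H : 𝓗.IsHermitian := by
    rw [Matrix.IsHermitian, h𝓗, conjTranspose_sum]
    exact Finset.sum_congr rfl fun i _ => by rw [← embedOp_conjTranspose, (hH i).eq]
  -- every term lives on a set of exactly `c` qubits
  have hA (i : Fin m) : ∃ A : Finset q, S i ⊆ A ∧ A.card = c :=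
    Finset.exists_superset_card_eq (hS i) hc
  choose A hSA hAc using hA
  obtain ⟨A₀, -, hA₀⟩ := Finset.exists_superset_card_eq (Finset.card_empty.trans_le c.zero_le) hc
  -- the Pauli coefficients of the Hamiltonian
  set h : (q → Fin 4) → ℂ :=
    fun P => ((2 : ℂ) ^ Fintype.card q)⁻¹ * (pauliString P * 𝓗).trace with hh
  have hreal (P) : star (h P) = h P := by
    simp only [hh, star_mul', star_trace_mul_of_isHermitian (isHermitian_pauliString P) h𝓗H]
    simp
  have hbound (P) (hP : P ≠ 0) : ‖h P‖ ≤ 3 / 2 * D := by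
    have h1 := norm_trace_mul_hamiltonian_le (B := pauliString P)
      (by rw [(isHermitian_pauliString P).eq, pauliString_mul_self]) (trace_pauliString hP) 𝓗 𝓙 h𝓙0
    rw [(isHermitian_pauliString P).eq, ← hTeq, hcard] at h1
    simp only [hh, norm_mul, norm_inv, norm_pow, Complex.norm_ofNat]
    rw [inv_mul_le_iff₀ (by positivity)]
    linarith
  have hsupp (P) : ∃ B : Finset q, B.card = c ∧ (h P ≠ 0 → ∀ k ∉ B, P k = 0) := by
    by_cases hP : ∃ i, ∀ k ∉ S i, P k = 0
    · obtain ⟨i, hi⟩ := hP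
      exact ⟨A i, hAc i, fun _ k hk => hi k fun hk' => hk (hSA i hk')⟩
    · refine ⟨A₀, hA₀, fun h0 => absurd ?_ h0⟩
      push Not at hP
      simp only [hh, h𝓗, Finset.mul_sum, trace_sum]
      rw [← Finset.mul_sum, Finset.sum_eq_zero, mul_zero]
      intro i _
      obtain ⟨k, hk, hPk⟩ := hP i
      exact trace_pauliString_mul_embedOp hk hPk _
  choose B hBc hB using hsupp
  -- the Pauli strings and the Lindblad operators that are assigned to a set
  let 𝓟 : Finset q → Finset (q → Fin 4) := fun s =>
    Finset.univ.filter fun P => P ≠ 0 ∧ h P ≠ 0 ∧ B P = s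
  let 𝓛 : Finset q → Finset (Σ i, Fin (k i)) := fun s => Finset.univ.filter fun p => A p.1 = s
  let F : Finset q → SuperOp (BitString q) := fun s =>
    lindbladian (∑ P ∈ 𝓟 s, h P • pauliString P) fun p : 𝓛 s => 𝓙 p
  refine ⟨F, fun s hs => ⟨?_, ?_⟩, ?_⟩
  · have hJ (p : 𝓛 s) : ∃ b, embedOp (qubitInclusion s) b = 𝓙 p := by
      have hp : A p.1.1 = s := (Finset.mem_filter.mp p.2).2
      exact exists_embedOp_of_subset ((hSA p.1.1).trans hp.subset) _
    choose b hb using hJ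
    refine ⟨lindbladian (∑ P ∈ 𝓟 s, h P • pauliString fun k : s => P k) b,
      isLindbladian_lindbladian ?_ _, ?_⟩
    · rw [Matrix.IsHermitian, conjTranspose_sum]
      exact Finset.sum_congr rfl fun P _ => by
        rw [conjTranspose_smul, hreal, (isHermitian_pauliString _).eq]
    · change _ = extendHom s _
      simp only [F, extendHom_lindbladian, hb, map_sum, map_smul, embedOp_pauliString]
      congr 1
      refine Finset.sum_congr rfl fun P hP => ?_
      obtain ⟨-, hP1, hP2⟩ := (Finset.mem_filter.mp hP).2
      congr 2
      funext k
      by_cases hk : k ∈ s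
      · simp [extendLabels, hk]
      · simp [extendLabels, hk, hB P hP1 k (hP2 ▸ hk)]
  · have hsc : s.card = c := (Finset.mem_powersetCard.mp hs).2
    have hD0 : 0 ≤ D := diamondNorm_nonneg T
    have hcount : (𝓟 s).card ≤ 4 ^ c := by
      have hcf : 4 ^ c = (Finset.univ : Finset (s → Fin 4)).card := by simp [hsc]
      rw [hcf]
      refine Finset.card_le_card_of_injOn (fun P k => P k) (by simp) ?_
      intro P hP Q hQ hPQ
      obtain ⟨-, hP1, hP2⟩ := (Finset.mem_filter.mp hP).2
      obtain ⟨-, hQ1, hQ2⟩ := (Finset.mem_filter.mp hQ).2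
      funext k
      by_cases hk : k ∈ s
      · exact congrFun hPQ ⟨k, hk⟩
      · rw [hB P hP1 k (hP2 ▸ hk), hB Q hQ1 k (hQ2 ▸ hk)]
    have hham : ‖∑ P ∈ 𝓟 s, h P • pauliString P‖ ≤ 4 ^ c * (3 / 2 * D) := by
      refine (norm_sum_le _ _).trans
        ((Finset.sum_le_sum (g := fun _ => 3 / 2 * D) fun P hP => ?_).trans ?_)
      · rw [norm_smul]
        have hP0 := (Finset.mem_filter.mp hP).2.1
        calc _ ≤ (3 / 2 * D) * 1 := by
              gcongr
              · exact hbound P hP0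
              · exact norm_pauliString_le P
          _ = 3 / 2 * D := mul_one _
      · rw [Finset.sum_const, nsmul_eq_mul]
        gcongr
        exact_mod_cast hcount
    have hdiss : ∑ p : 𝓛 s, diamondNorm (dissipator (𝓙 p)) ≤ 2 * 4 ^ c * D := by
      have h1 (p) : ‖𝓙 p‖ ^ 2 * 2 ^ Fintype.card q ≤ 4 ^ c * hsSq (𝓙 p) := by
        refine (opNorm_sq_embedOp_le _ _).trans ?_
        gcongr
        · exact hsSq_nonneg _
        · calc (2 : ℝ) ^ (S p.1).card ≤ 2 ^ c := pow_le_pow_right₀ one_le_two (hS p.1)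
            _ ≤ 4 ^ c := pow_le_pow_left₀ (by norm_num) (by norm_num) c
      have h2 : ∑ p : 𝓛 s, diamondNorm (dissipator (𝓙 p)) ≤ ∑ p, 2 * ‖𝓙 p‖ ^ 2 := by
        refine (Finset.sum_le_sum (g := fun p : 𝓛 s => 2 * ‖𝓙 p‖ ^ 2)
          fun p _ => diamondNorm_dissipator_le (𝓙 p)).trans ?_
        rw [Finset.sum_coe_sort (𝓛 s) fun p => 2 * ‖𝓙 p‖ ^ 2]
        exact Finset.sum_le_univ_sum_of_nonneg fun p => by positivity
      have h3 := sum_hsSq_le 𝓗 𝓙 h𝓙0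
      rw [← hTeq, hcard] at h3
      refine h2.trans ?_
      rw [← Finset.mul_sum]
      have h4 : (∑ p, ‖𝓙 p‖ ^ 2) * 2 ^ Fintype.card q ≤ (4 ^ c * D) * 2 ^ Fintype.card q := by
        rw [Finset.sum_mul]
        refine (Finset.sum_le_sum fun p _ => h1 p).trans ?_
        rw [← Finset.mul_sum]
        calc _ ≤ (4 : ℝ) ^ c * (2 ^ Fintype.card q * D) := by gcongr
          _ = _ := by ring
      have h5 := le_of_mul_le_mul_right h4 (by positivity)
      linarith
    calc diamondNorm (F s) ≤ 2 * (4 ^ c * (3 / 2 * D)) + 2 * 4 ^ c * D := by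
          refine (diamondNorm_add_le _ _).trans (add_le_add ?_ ?_)
          · exact (diamondNorm_hamiltonianPart_le _).trans (by gcongr)
          · exact (diamondNorm_sum_le _ _).trans hdiss
      _ = 5 * 4 ^ c * D := by ring
  · have e1 : ∑ s ∈ Finset.powersetCard c Finset.univ, hamiltonianPart
        (∑ P ∈ 𝓟 s, h P • pauliString P) = hamiltonianPart 𝓗 := by
      rw [eq_sum_pauliString 𝓗]
      simp only [hamiltonianPart_sum]
      have : ∀ s, ∑ P ∈ 𝓟 s, hamiltonianPart (h P • pauliString P) =
          ∑ P ∈ Finset.univ.filter (fun P => P ≠ 0 ∧ h P ≠ 0) with B P = s,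
            hamiltonianPart (h P • pauliString P) := by
        intro s
        rw [Finset.filter_filter]
        simp only [𝓟, and_assoc]
      simp only [this]
      rw [Finset.sum_fiberwise_of_maps_to
        (fun P _ => Finset.mem_powersetCard.mpr ⟨Finset.subset_univ _, hBc P⟩)]
      refine Finset.sum_subset (Finset.subset_univ _) fun P _ hP => ?_
      rw [hamiltonianPart_smul]
      by_cases hP0 : P = 0
      · rw [hP0, pauliString_zero, hamiltonianPart_one, smul_zero]
      · have : h P = 0 := by simpa [hP0] using hP
        rw [this, zero_smul]
    have e2 : ∑ s ∈ Finset.powersetCard c Finset.univ, ∑ p : 𝓛 s, dissipator (𝓙 p) =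
        ∑ p, dissipator (𝓙 p) := by
      have hcoe (s) : ∑ p : 𝓛 s, dissipator (𝓙 p) = ∑ p with A p.1 = s, dissipator (𝓙 p) :=
        Finset.sum_coe_sort (𝓛 s) fun p => dissipator (𝓙 p)
      simp only [hcoe]
      exact Finset.sum_fiberwise_of_maps_to
        (fun p _ => Finset.mem_powersetCard.mpr ⟨Finset.subset_univ _, hAc p.1⟩) _
    rw [hTeq]
    simp only [F, lindbladian, Finset.sum_add_distrib, e1, e2]

end Decomposition

/-! ### Circuits -/

section Circuits

variable {r q : Type*}

/-- The qubits of a gate. -/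
def TwoQubitGate.qubits (g : TwoQubitGate q) : Fin 2 ↪ q where
  toFun := ![g.fst, g.snd]
  inj' := by
    intro i j h
    have := g.ne
    fin_cases i <;> fin_cases j <;> simp_all

/-- The same gate on a register into which the qubits are embedded by `f`. -/
def TwoQubitGate.relabel (f : r ↪ q) (g : TwoQubitGate r) : TwoQubitGate q where
  fst := f g.fst
  snd := f g.snd
  ne h := g.ne (f.injective h)
  unitary := g.unitary

/-- The inverse gate. -/
def TwoQubitGate.inverse (g : TwoQubitGate q) : TwoQubitGate q :=
  { g with unitary := star g.unitary }

variable [Fintype r] [DecidableEq r] [Fintype q] [DecidableEq q]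

theorem TwoQubitGate.toOp_relabel (f : r ↪ q) (g : TwoQubitGate r) :
    (g.relabel f).toOp = embedOp f g.toOp := by
  ext x y
  simp only [embedOp_apply, TwoQubitGate.toOp, of_apply, ← ite_and]
  refine if_congr ?_ rfl rfl
  constructor
  · intro h
    refine ⟨fun k hk => h k ?_ ?_, fun i h1 h2 => h (f i) ?_ ?_⟩
    · rintro rfl; exact hk ⟨_, rfl⟩
    · rintro rfl; exact hk ⟨_, rfl⟩
    · exact fun h' => h1 (f.injective h')
    · exact fun h' => h2 (f.injective h')
  · rintro ⟨h1, h2⟩ k hk1 hk2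
    by_cases hk : k ∈ Set.range f
    · obtain ⟨i, rfl⟩ := hk
      exact h2 i (fun h' => hk1 (congrArg f h')) (fun h' => hk2 (congrArg f h'))
    · exact h1 k hk

theorem TwoQubitGate.toOp_eq_embedOp (g : TwoQubitGate q) :
    g.toOp = embedOp g.qubits
      ((g.unitary : Matrix (Fin 2 × Fin 2) (Fin 2 × Fin 2) ℂ).submatrix
        (finTwoArrowEquiv (Fin 2)) (finTwoArrowEquiv (Fin 2))) := by
  ext x y
  rw [embedOp_apply]
  simp only [TwoQubitGate.toOp, of_apply]
  refine if_congr ?_ rfl rfl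
  have h0 : g.qubits 0 = g.fst := rfl
  have h1 : g.qubits 1 = g.snd := rfl
  simp [h0, h1, eq_comm]

theorem TwoQubitGate.toOp_inverse (g : TwoQubitGate q) : g.inverse.toOp = (g.toOp)ᴴ := by
  ext x y
  simp only [TwoQubitGate.toOp, TwoQubitGate.inverse, of_apply, conjTranspose_apply]
  rw [apply_ite star, star_zero]
  exact if_congr ⟨fun h k h1 h2 => (h k h1 h2).symm, fun h k h1 h2 => (h k h1 h2).symm⟩ rfl rfl

theorem TwoQubitGate.conjTranspose_mul_self (g : TwoQubitGate q) : (g.toOp)ᴴ * g.toOp = 1 := by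
  rw [g.toOp_eq_embedOp, ← embedOp_conjTranspose, ← map_mul, conjTranspose_submatrix,
    Matrix.submatrix_mul_equiv, ← Matrix.star_eq_conjTranspose, Matrix.UnitaryGroup.star_mul_self,
    Matrix.submatrix_one_equiv, map_one]

theorem Circuit.toOp_append (C D : Circuit q) :
    Circuit.toOp (C ++ D) = Circuit.toOp C * Circuit.toOp D := by
  simp [Circuit.toOp]

/-- `U` is the operator of a circuit of at most `k` two-qubit gates. -/
def HasCircuit (U : Op (BitString q)) (k : ℕ) : Prop :=
  ∃ C : Circuit q, C.length ≤ k ∧ Circuit.toOp C = U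

theorem HasCircuit.mono {U : Op (BitString q)} {k l : ℕ} (h : HasCircuit U k) (hkl : k ≤ l) :
    HasCircuit U l :=
  let ⟨C, hC, hU⟩ := h
  ⟨C, hC.trans hkl, hU⟩

theorem hasCircuit_one : HasCircuit (1 : Op (BitString q)) 0 := ⟨[], le_rfl, rfl⟩

theorem hasCircuit_gate (g : TwoQubitGate q) : HasCircuit g.toOp 1 :=
  ⟨[g], le_rfl, by simp [Circuit.toOp]⟩

theorem HasCircuit.mul {U V : Op (BitString q)} {k l : ℕ} (hU : HasCircuit U k)
    (hV : HasCircuit V l) : HasCircuit (U * V) (k + l) := by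
  obtain ⟨C, hC, rfl⟩ := hU
  obtain ⟨D, hD, rfl⟩ := hV
  exact ⟨C ++ D, by simpa using add_le_add hC hD, Circuit.toOp_append C D⟩

theorem HasCircuit.conjTranspose {U : Op (BitString q)} {k : ℕ} (hU : HasCircuit U k) :
    HasCircuit Uᴴ k := by
  obtain ⟨C, hC, rfl⟩ := hU
  refine ⟨(C.map TwoQubitGate.inverse).reverse, by simpa using hC, ?_⟩
  clear hC
  induction C with
  | nil => simp [Circuit.toOp]
  | cons g C ih =>
    have h : Circuit.toOp (g :: C) = g.toOp * Circuit.toOp C := by simp [Circuit.toOp]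
    rw [h, conjTranspose_mul, ← ih, ← g.toOp_inverse, List.map_cons, List.reverse_cons,
      Circuit.toOp_append]
    simp [Circuit.toOp]

theorem HasCircuit.conjTranspose_mul_self {U : Op (BitString q)} {k : ℕ} (hU : HasCircuit U k) :
    Uᴴ * U = 1 := by
  obtain ⟨C, -, rfl⟩ := hU
  induction C with
  | nil => simp [Circuit.toOp]
  | cons g C ih =>
    have h : Circuit.toOp (g :: C) = g.toOp * Circuit.toOp C := by simp [Circuit.toOp]
    rw [h, conjTranspose_mul, mul_assoc, ← mul_assoc _ g.toOp, g.conjTranspose_mul_self, one_mul,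
      ih]

theorem HasCircuit.mul_conjTranspose_self {U : Op (BitString q)} {k : ℕ} (hU : HasCircuit U k) :
    U * Uᴴ = 1 :=
  mul_eq_one_comm.mp hU.conjTranspose_mul_self

theorem Circuit.toOp_relabel (f : r ↪ q) (C : Circuit r) :
    Circuit.toOp (C.map (TwoQubitGate.relabel f)) = embedOp f (Circuit.toOp C) := by
  simp only [Circuit.toOp, List.map_map, map_list_prod]
  congr 2
  funext g
  exact g.toOp_relabel f

theorem HasCircuit.embedOp {U : Op (BitString r)} {k : ℕ} (hU : HasCircuit U k) (f : r ↪ q) :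
    HasCircuit (embedOp f U) k := by
  obtain ⟨C, hC, rfl⟩ := hU
  exact ⟨C.map (TwoQubitGate.relabel f), by simpa using hC, Circuit.toOp_relabel f C⟩

end Circuits

/-! ### Channels of circuits with ancillas -/

section Channels

theorem adjoinZero_apply {q a : Type*} [Fintype a] (ρ : Op (BitString q)) (x y : BitString q)
    (z w : BitString a) :
    adjoinZero q a ρ (Sum.elim x z) (Sum.elim y w) = if z = 0 ∧ w = 0 then ρ x y else 0 := by
  change (if (∀ k : a, z k = 0) ∧ (∀ k : a, w k = 0) then ρ x y else 0) = _
  simp only [funext_iff, Pi.zero_apply]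

variable {q a b : Type} [Fintype q] [DecidableEq q] [Fintype a] [DecidableEq a]
  [Fintype b] [DecidableEq b]

/-- The Kraus operator `⟨z| U |0⟩` of a unitary `U` on a system `q` with ancillas `a`. -/
def ancillaKraus (U : Op (BitString (q ⊕ a))) (z : BitString a) : Op (BitString q) :=
  of fun u x => U (Sum.elim u z) (Sum.elim x 0)

theorem sum_bitString_sum (F : BitString (q ⊕ a) → ℂ) :
    ∑ s, F s = ∑ x : BitString q, ∑ z : BitString a, F (Sum.elim x z) := by
  rw [← Equiv.sum_comp (Equiv.sumArrowEquivProdArrow q a (Fin 2)).symm, Fintype.sum_prod_type]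
  rfl

theorem Circuit.channel_eq_krausMap (C : Circuit (q ⊕ a)) :
    Circuit.channel C = krausMap (ancillaKraus (Circuit.toOp C)) := by
  ext1 ρ
  ext u v
  rw [krausMap_apply, Matrix.sum_apply]
  change ∑ z, (Circuit.toOp C * (adjoinZero q a ρ * (Circuit.toOp C)ᴴ))
    (Sum.elim u z) (Sum.elim v z) = _
  refine Finset.sum_congr rfl fun z _ => ?_
  rw [mul_assoc]
  simp only [Matrix.mul_apply, sum_bitString_sum, adjoinZero_apply, ite_and, ite_mul, zero_mul,
    Finset.sum_ite_irrel, Finset.sum_ite_eq', Finset.sum_const_zero, Finset.mem_univ, if_true,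
    mul_ite, mul_zero]
  rfl

/-- `T` is the channel of a circuit of at most `k` two-qubit gates with some ancillas. -/
def HasChannelCircuit (T : SuperOp (BitString q)) (k : ℕ) : Prop :=
  ∃ (a : Type) (_ : Fintype a) (_ : DecidableEq a) (U : Op (BitString (q ⊕ a))),
    HasCircuit U k ∧ T = krausMap (ancillaKraus U)

theorem hasChannelCircuit_one : HasChannelCircuit (1 : SuperOp (BitString q)) 0 := by
  refine ⟨Empty, inferInstance, inferInstance, 1, hasCircuit_one, ?_⟩
  have h : ∀ z : BitString Empty, ancillaKraus (q := q) 1 z = 1 := by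
    intro z
    ext u x
    simp only [ancillaKraus, of_apply, Matrix.one_apply]
    refine if_congr ⟨fun h => ?_, fun h => ?_⟩ rfl rfl
    · exact funext fun i => congrFun h (Sum.inl i)
    · rw [h, Subsingleton.elim z 0]
  ext1 ρ
  simp [krausMap_apply, h]

/-- Circuits with separate ancillas are composed. -/
theorem ancillaKraus_comp (U : Op (BitString (q ⊕ a))) (V : Op (BitString (q ⊕ b)))
    (z : BitString a) (w : BitString b) :
    ancillaKraus (embedOp ((Function.Embedding.refl q).sumMap Function.Embedding.inr) V *
      embedOp ((Function.Embedding.refl q).sumMap Function.Embedding.inl) U)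
        (Sum.elim z w : BitString (a ⊕ b)) = ancillaKraus V w * ancillaKraus U z := by
  have hV (u u' : BitString q) (z z' : BitString a) (w w' : BitString b) :
      embedOp ((Function.Embedding.refl q).sumMap Function.Embedding.inr) V
        (Sum.elim u (Sum.elim z w)) (Sum.elim u' (Sum.elim z' w')) =
        if z = z' then V (Sum.elim u w) (Sum.elim u' w') else 0 := by
    rw [embedOp_apply]
    refine if_congr ?_ ?_ rfl
    · simp [funext_iff]
    · congr 1 <;> · funext k; cases k <;> rfl
  have hU (u u' : BitString q) (z z' : BitString a) (w w' : BitString b) :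
      embedOp ((Function.Embedding.refl q).sumMap Function.Embedding.inl) U
        (Sum.elim u (Sum.elim z w)) (Sum.elim u' (Sum.elim z' w')) =
        if w = w' then U (Sum.elim u z) (Sum.elim u' z') else 0 := by
    rw [embedOp_apply]
    refine if_congr ?_ ?_ rfl
    · simp [funext_iff]
    · congr 1 <;> · funext k; cases k <;> rfl
  have h0 : (0 : BitString (a ⊕ b)) = Sum.elim (0 : BitString a) (0 : BitString b) := by
    funext k; cases k <;> rfl
  ext u x
  simp only [ancillaKraus, of_apply, Matrix.mul_apply, sum_bitString_sum, h0, hV, hU, ite_mul,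
    zero_mul, mul_ite, mul_zero, Finset.sum_ite_eq', Finset.sum_ite_eq, Finset.mem_univ, if_true]

theorem krausMap_comp {ι κ κ' : Type*} [Fintype ι] [DecidableEq ι] [Fintype κ] [Fintype κ']
    (K : κ → Op ι) (K' : κ' → Op ι) :
    krausMap K * krausMap K' = krausMap fun p : κ' × κ => K p.2 * K' p.1 := by
  ext1 ρ
  rw [Module.End.mul_apply]
  simp only [krausMap_apply, Fintype.sum_prod_type, Finset.mul_sum, Finset.sum_mul,
    conjTranspose_mul, mul_assoc]
  rw [Finset.sum_comm]

theorem krausMap_equiv {ι κ κ' : Type*} [Fintype ι] [DecidableEq ι] [Fintype κ] [Fintype κ']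
    (e : κ' ≃ κ) (K : κ → Op ι) : krausMap (fun k => K (e k)) = krausMap K :=
  Equiv.sum_comp e fun k => sandwich (K k) (K k)ᴴ

theorem HasChannelCircuit.mul {S T : SuperOp (BitString q)} {k l : ℕ}
    (hS : HasChannelCircuit S k) (hT : HasChannelCircuit T l) :
    HasChannelCircuit (S * T) (k + l) := by
  obtain ⟨b, _, _, V, hV, rfl⟩ := hS
  obtain ⟨a, _, _, U, hU, rfl⟩ := hT
  refine ⟨a ⊕ b, inferInstance, inferInstance, _,
    (hV.embedOp ((Function.Embedding.refl q).sumMap Function.Embedding.inr)).mul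
      (hU.embedOp ((Function.Embedding.refl q).sumMap Function.Embedding.inl)), ?_⟩
  rw [krausMap_comp, ← krausMap_equiv (Equiv.sumArrowEquivProdArrow a b (Fin 2)).symm]
  simp only [← ancillaKraus_comp]
  rfl

theorem HasChannelCircuit.pow {T : SuperOp (BitString q)} {k : ℕ}
    (hT : HasChannelCircuit T k) (r : ℕ) : HasChannelCircuit (T ^ r) (r * k) := by
  induction r with
  | zero => rw [zero_mul]; exact hasChannelCircuit_one
  | succ r ih => rw [pow_succ, Nat.succ_mul]; exact ih.mul hT

theorem HasChannelCircuit.mono {T : SuperOp (BitString q)} {k l : ℕ}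
    (hT : HasChannelCircuit T k) (hkl : k ≤ l) : HasChannelCircuit T l :=
  let ⟨a, i, j, U, hU, h⟩ := hT
  ⟨a, i, j, U, hU.mono hkl, h⟩

theorem HasChannelCircuit.extendHom {S : Finset q} {T : SuperOp (BitString S)} {k : ℕ}
    (hT : HasChannelCircuit T k) : HasChannelCircuit (extendHom S T) k := by
  obtain ⟨a, _, _, U, hU, rfl⟩ := hT
  refine ⟨a, inferInstance, inferInstance, _,
    hU.embedOp ((qubitInclusion S).sumMap (Function.Embedding.refl a)), ?_⟩
  rw [extendHom_krausMap]
  congr 1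
  funext z
  ext u x
  simp only [ancillaKraus, of_apply, embedOp_apply]
  refine if_congr ?_ ?_ rfl
  · simp
  · congr 1 <;> · funext k; cases k <;> rfl

/-- The ancillas may be taken to be numbered. -/
theorem HasChannelCircuit.exists_circuit {T : SuperOp (BitString q)} {k : ℕ}
    (hT : HasChannelCircuit T k) :
    ∃ (m : ℕ) (C : Circuit (q ⊕ Fin m)), C.length ≤ k ∧ Circuit.channel C = T := by
  obtain ⟨a, _, _, U, hU, rfl⟩ := hT
  let e := Fintype.equivFin a
  obtain ⟨C, hC, hCU⟩ := hU.embedOp ((Function.Embedding.refl q).sumMap e.toEmbedding)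
  refine ⟨_, C, hC, ?_⟩
  rw [Circuit.channel_eq_krausMap, hCU,
    ← krausMap_equiv (Equiv.arrowCongr e.symm (Equiv.refl (Fin 2)))]
  congr 1
  funext z
  ext u x
  simp only [ancillaKraus, of_apply]
  rw [embedOp_apply_of_forall]
  · congr 1 <;> · funext k; cases k <;> rfl
  · intro k hk
    refine absurd ?_ hk
    rcases k with k | k
    · exact ⟨Sum.inl k, rfl⟩
    · exact ⟨Sum.inr (e.symm k), by simp⟩

end Channels

/-! ### Circuits for diagonal unitaries -/

section Diagonal

variable {r : Type*} [DecidableEq r]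

/-- The map `(x_i, x_j) ↦ (x_i, x_j + x_i)` on bit strings. -/
def cnot (i j : r) (x : BitString r) : BitString r := Function.update x j (x j + x i)

theorem cnot_cnot {i j : r} (hij : i ≠ j) (x : BitString r) : cnot i j (cnot i j x) = x := by
  have h : ∀ a b : Fin 2, a + b + b = a := by decide
  funext k
  by_cases hk : k = j
  · subst hk
    simp [cnot, hij, h]
  · simp [cnot, hk]

variable [Fintype r]

/-- The controlled-NOT gate. -/
def cnotGate {i j : r} (hij : i ≠ j) : TwoQubitGate r where
  fst := i
  snd := j
  ne := hij
  unitary := ⟨of fun p p' => if p = (p'.1, p'.2 + p'.1) then 1 else 0, by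
    rw [Matrix.mem_unitaryGroup_iff]
    ext ⟨a, b⟩ ⟨c, d⟩
    fin_cases a <;> fin_cases b <;> fin_cases c <;> fin_cases d <;>
      simp [Matrix.mul_apply, Fintype.sum_prod_type, Fin.sum_univ_two]⟩

theorem cnotGate_toOp {i j : r} (hij : i ≠ j) :
    (cnotGate hij).toOp = of fun x y => if x = cnot i j y then 1 else 0 := by
  ext x y
  have e : (cnotGate hij).toOp x y = if ∀ k, k ≠ i → k ≠ j → x k = y k then
      (if (x i, x j) = (y i, y j + y i) then 1 else 0) else 0 := rfl
  rw [e, ← ite_and, of_apply]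
  refine if_congr ?_ rfl rfl
  constructor
  · rintro ⟨h1, h2⟩
    rw [Prod.mk.injEq] at h2
    funext k
    by_cases hj : k = j
    · subst hj; simp [cnot, h2.2]
    · by_cases hi : k = i
      · subst hi; simp [cnot, hj, h2.1]
      · simp [cnot, hj, h1 k hi hj]
  · rintro rfl
    refine ⟨fun k _ hj => by simp [cnot, hj], ?_⟩
    simp [cnot, hij]

theorem hasCircuit_diagonal_comp_cnot {i j : r} (hij : i ≠ j) {g : BitString r → ℂ} {k : ℕ}
    (h : HasCircuit (Matrix.diagonal g) k) :
    HasCircuit (Matrix.diagonal fun x => g (cnot i j x)) (k + 2) := by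
  have h1 := ((hasCircuit_gate (cnotGate hij)).mul h).mul (hasCircuit_gate (cnotGate hij))
  have e : (cnotGate hij).toOp * Matrix.diagonal g * (cnotGate hij).toOp =
      Matrix.diagonal fun x => g (cnot i j x) := by
    ext x y
    rw [cnotGate_toOp, Matrix.mul_apply, Finset.sum_eq_single (cnot i j y)]
    · rw [Matrix.mul_diagonal, of_apply, of_apply, cnot_cnot hij, if_pos rfl, mul_one,
        Matrix.diagonal_apply]
      split_ifs with hxy
      · rw [one_mul, hxy]
      · rw [zero_mul]
    · intro z _ hz
      rw [of_apply, if_neg hz, mul_zero]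
    · simp
  rw [e] at h1
  exact h1.mono (by omega)

/-- The number of gates that suffice for a diagonal unitary that depends on `k` qubits. -/
def diagCost (k : ℕ) : ℕ := 2 * 3 ^ k - 1

theorem hasCircuit_diagonal_of_pair {i j : r} (hij : i ≠ j) {φ : BitString r → ℂ}
    (hφ : ∀ x, ‖φ x‖ = 1) (h : ∀ x y, x i = y i → x j = y j → φ x = φ y) :
    HasCircuit (Matrix.diagonal φ) 1 := by
  let ψ : Fin 2 × Fin 2 → ℂ := fun p => φ (Function.update (Function.update 0 i p.1) j p.2)
  let g : TwoQubitGate r :=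
    { fst := i
      snd := j
      ne := hij
      unitary := ⟨Matrix.diagonal ψ, by
        rw [Matrix.mem_unitaryGroup_iff, Matrix.star_eq_conjTranspose,
          Matrix.diagonal_conjTranspose, Matrix.diagonal_mul_diagonal, ← Matrix.diagonal_one]
        congr 1
        funext p
        rw [Pi.star_apply, Complex.star_def, Complex.mul_conj', hφ]
        simp⟩ }
  have e : g.toOp = Matrix.diagonal φ := by
    ext x y
    simp only [TwoQubitGate.toOp, g, of_apply, Matrix.diagonal_apply, ← ite_and]
    refine if_congr ?_ (h _ _ ?_ ?_) rfl
    · constructor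
      · rintro ⟨h1, h2⟩
        rw [Prod.mk.injEq] at h2
        funext k
        by_cases hi : k = i
        · rw [hi, h2.1]
        · by_cases hj : k = j
          · rw [hj, h2.2]
          · exact h1 k hi hj
      · rintro rfl; simp
    · simp [hij]
    · simp
  exact e ▸ hasCircuit_gate g

/-- A diagonal unitary that depends on the qubits in `A` only. If `i` and `j` are two of these
qubits, the phase is a product of three phases: the first depends on `x_i`, the second on `x_j`,
and the third on `x_i + x_j`, besides the other qubits. -/
theorem hasCircuit_diagonal_of_dependsOn (hr : 2 ≤ Fintype.card r) (n : ℕ) :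
    ∀ (A : Finset r) (φ : BitString r → ℂ), A.card = n → (∀ x, ‖φ x‖ = 1) →
      (∀ x y, (∀ k ∈ A, x k = y k) → φ x = φ y) → HasCircuit (Matrix.diagonal φ) (diagCost n) := by
  induction n using Nat.strong_induction_on with
  | _ n ih =>
  intro A φ hA hφ hdep
  by_cases hn : n ≤ 2
  · obtain ⟨B, hAB, hB⟩ := Finset.exists_superset_card_eq (hA.trans_le hn) hr
    obtain ⟨i, j, hij, rfl⟩ := Finset.card_eq_two.mp hB
    refine (hasCircuit_diagonal_of_pair hij hφ fun x y hi hj => hdep x y fun k hk => ?_).mono ?_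
    · have := hAB hk
      simp only [Finset.mem_insert, Finset.mem_singleton] at this
      rcases this with rfl | rfl <;> assumption
    · have : 0 < 3 ^ n := by positivity
      unfold diagCost; omega
  · obtain ⟨i, hi, j, hj, hij⟩ := Finset.one_lt_card.mp (by omega : 1 < A.card)
    let ψ : BitString r → Fin 2 → Fin 2 → ℂ :=
      fun x s t => φ (Function.update (Function.update x i s) j t)
    have hψ1 (x s t) : ‖ψ x s t‖ = 1 := hφ _
    have hψ0 (x s t) : ψ x s t ≠ 0 := fun h => by simpa [h] using hψ1 x s t
    have hψdep {x y : BitString r} (h : ∀ k ∈ A, k ≠ i → k ≠ j → x k = y k) : ψ x = ψ y := by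
      funext s t
      refine hdep _ _ fun k hk => ?_
      by_cases hkj : k = j
      · subst hkj; simp
      · by_cases hki : k = i
        · subst hki; simp [hkj]
        · simp [hkj, hki, h k hk hki hkj]
    -- `α` is a square root of `ψ₁₁ ψ₁₀ / (ψ₀₀ ψ₀₁)`
    have hsqrt (z : ℂ) : ∃ w : ℂ, w * w = z := by
      obtain ⟨w, hw⟩ := IsAlgClosed.exists_pow_nat_eq z two_pos
      exact ⟨w, by rw [← pow_two, hw]⟩
    choose sqrt hsq using hsqrt
    let α : (Fin 2 → Fin 2 → ℂ) → ℂ := fun m => sqrt (m 1 1 * m 1 0 / (m 0 0 * m 0 1))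
    have hα1 (x) : ‖α (ψ x)‖ = 1 := by
      have h := congrArg norm (hsq (ψ x 1 1 * ψ x 1 0 / (ψ x 0 0 * ψ x 0 1)))
      simp only [norm_mul, norm_div, hψ1] at h
      have h0 := norm_nonneg (α (ψ x))
      change ‖α (ψ x)‖ * ‖α (ψ x)‖ = _ at h
      nlinarith
    have hα0 (x) : α (ψ x) ≠ 0 := fun h => by simpa [h] using hα1 x
    have hαsq (x) : α (ψ x) * α (ψ x) * (ψ x 0 0 * ψ x 0 1) = ψ x 1 1 * ψ x 1 0 := by
      rw [show α (ψ x) * α (ψ x) = _ from hsq _, div_mul_cancel₀]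
      exact mul_ne_zero (hψ0 _ _ _) (hψ0 _ _ _)
    let a : BitString r → ℂ := fun x => if x i = 0 then 1 else α (ψ x)
    let b : BitString r → ℂ := fun x => if x j = 0 then 1 else ψ x 1 1 / (ψ x 0 0 * α (ψ x))
    let g : BitString r → ℂ := fun x => if x j = 0 then ψ x 0 0 else ψ x 1 0 / α (ψ x)
    have hcard {k : r} (hk : k ∈ A) : (A.erase k).card = n - 1 := by
      rw [Finset.card_erase_of_mem hk, hA]
    have ha : HasCircuit (Matrix.diagonal a) (diagCost (n - 1)) := by
      refine ih (n - 1) (by omega) _ a (hcard hj) (fun x => ?_) fun x y h => ?_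
      · simp only [a]; split_ifs <;> simp [hα1]
      · have h1 : ψ x = ψ y := hψdep fun k hk _ hkj => h k (Finset.mem_erase.mpr ⟨hkj, hk⟩)
        simp only [a, h1, h i (Finset.mem_erase.mpr ⟨hij, hi⟩)]
    have hb : HasCircuit (Matrix.diagonal b) (diagCost (n - 1)) := by
      refine ih (n - 1) (by omega) _ b (hcard hi) (fun x => ?_) fun x y h => ?_
      · simp only [b]; split_ifs <;> simp [hα1, hψ1]
      · have h1 : ψ x = ψ y := hψdep fun k hk hki _ => h k (Finset.mem_erase.mpr ⟨hki, hk⟩)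
        simp only [b, h1, h j (Finset.mem_erase.mpr ⟨hij.symm, hj⟩)]
    have hg : HasCircuit (Matrix.diagonal g) (diagCost (n - 1)) := by
      refine ih (n - 1) (by omega) _ g (hcard hi) (fun x => ?_) fun x y h => ?_
      · simp only [g]; split_ifs <;> simp [hα1, hψ1]
      · have h1 : ψ x = ψ y := hψdep fun k hk hki _ => h k (Finset.mem_erase.mpr ⟨hki, hk⟩)
        simp only [g, h1, h j (Finset.mem_erase.mpr ⟨hij.symm, hj⟩)]
    have hprod : Matrix.diagonal φ = Matrix.diagonal a * Matrix.diagonal b *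
        Matrix.diagonal fun x => g (cnot i j x) := by
      rw [Matrix.diagonal_mul_diagonal, Matrix.diagonal_mul_diagonal]
      congr 1
      funext x
      have hφx : φ x = ψ x (x i) (x j) := by
        simp [ψ, Function.update_eq_self]
      have hψc : ψ (cnot i j x) = ψ x := hψdep fun k _ _ hkj => by simp [cnot, hkj]
      have hcj : cnot i j x j = x j + x i := by simp [cnot]
      have hx := hαsq x
      have h00 := hψ0 x 0 0
      have hax := hα0 x
      simp only [a, b, g, hφx, hψc, hcj]
      have h2 : ∀ s : Fin 2, s = 0 ∨ s = 1 := by decide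
      rcases h2 (x i) with hi | hi <;> rcases h2 (x j) with hj | hj <;> simp only [hi, hj]
      · simp
      · simp
        field_simp
        linear_combination hx
      · simp
        field_simp
      · simp
        field_simp
    rw [hprod]
    refine ((ha.mul hb).mul (hasCircuit_diagonal_comp_cnot hij hg)).mono ?_
    obtain ⟨m, rfl⟩ : ∃ m, n = m + 1 := ⟨n - 1, by omega⟩
    have : 0 < 3 ^ m := by positivity
    simp only [diagCost, Nat.add_sub_cancel, pow_succ]
    omega

theorem hasCircuit_diagonal (hr : 2 ≤ Fintype.card r) {φ : BitString r → ℂ}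
    (hφ : ∀ x, ‖φ x‖ = 1) : HasCircuit (Matrix.diagonal φ) (diagCost (Fintype.card r)) :=
  hasCircuit_diagonal_of_dependsOn hr _ Finset.univ φ Finset.card_univ hφ fun x y h => by
    rw [funext fun k => h k (Finset.mem_univ k)]

end Diagonal

/-! ### Synthesis of isometries -/

section Synthesis

variable {r : Type*} [Fintype r] [DecidableEq r]

/-- The Hadamard matrix. -/
def hadamard : Matrix (Fin 2) (Fin 2) ℂ := ((√2 : ℝ) : ℂ)⁻¹ • !![1, 1; 1, -1]

theorem hadamard_mem_unitaryGroup : hadamard ∈ Matrix.unitaryGroup (Fin 2) ℂ := by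
  have h : ((√2 : ℝ) : ℂ)⁻¹ * ((√2 : ℝ) : ℂ)⁻¹ = 1 / 2 := by
    rw [← mul_inv, ← Complex.ofReal_mul, Real.mul_self_sqrt (by norm_num)]
    norm_num
  rw [Matrix.mem_unitaryGroup_iff, hadamard, star_smul, smul_mul_smul_comm, Complex.star_def,
    map_inv₀, Complex.conj_ofReal, h]
  ext i j
  fin_cases i <;> fin_cases j <;>
    simp [Matrix.vecMul, dotProduct, Fin.sum_univ_two, Matrix.star_eq_conjTranspose] <;> norm_num

/-- The Hadamard gate on the qubit `t`, as a two-qubit gate that ignores the qubit `t'`. -/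
def hadamardGate {t t' : r} (h : t ≠ t') : TwoQubitGate r where
  fst := t
  snd := t'
  ne := h
  unitary := ⟨liftOp (Equiv.refl (Fin 2 × Fin 2)) hadamard, by
    rw [Matrix.mem_unitaryGroup_iff, ← map_star, ← map_mul,
      Matrix.mem_unitaryGroup_iff.mp hadamard_mem_unitaryGroup, map_one]⟩

theorem hadamardGate_mulVec {t t' : r} (h : t ≠ t') (v : BitString r → ℂ) (x : BitString r) :
    ((hadamardGate h).toOp *ᵥ v) x = ((√2 : ℝ) : ℂ)⁻¹ * (v (Function.update x t 0) +
      (-1) ^ (x t : ℕ) * v (Function.update x t 1)) := by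
  have e (y) : (hadamardGate h).toOp x y =
      if ∀ k, k ≠ t → x k = y k then hadamard (x t) (y t) else 0 := by
    have e1 : (hadamardGate h).toOp x y = if ∀ k, k ≠ t → k ≠ t' → x k = y k then
      liftOp (Equiv.refl (Fin 2 × Fin 2)) hadamard (x t, x t') (y t, y t') else 0 := rfl
    rw [e1, liftOp_refl_apply, ← ite_and]
    refine if_congr ⟨fun h1 k hk => ?_, fun h1 => ⟨fun k hk _ => h1 k hk, h1 t' h.symm⟩⟩ rfl rfl
    by_cases hk' : k = t'
    · rw [hk', h1.2]
    · exact h1.1 k hk hk'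
  have hsub : ((hadamardGate h).toOp *ᵥ v) x = ∑ s : Fin 2,
      (hadamardGate h).toOp x (Function.update x t s) * v (Function.update x t s) := by
    rw [← Finset.sum_image (f := fun y => (hadamardGate h).toOp x y * v y)
      (g := fun s : Fin 2 => Function.update x t s)
      (fun s _ s' _ hs => Function.update_injective x t hs)]
    refine (Finset.sum_subset (Finset.subset_univ _) fun y _ hy => ?_).symm
    change (hadamardGate h).toOp x y * v y = 0
    rw [e, if_neg, zero_mul]
    intro hxy
    refine hy (Finset.mem_image.mpr ⟨y t, Finset.mem_univ _, ?_⟩)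
    funext k
    by_cases hk : k = t
    · subst hk; simp
    · simp [hk, hxy k hk]
  have h2 : ∀ s : Fin 2, s = 0 ∨ s = 1 := by decide
  rw [hsub, Fin.sum_univ_two, e, e, if_pos (by simp +contextual), if_pos (by simp +contextual)]
  simp only [Function.update_self, hadamard, Matrix.smul_apply, smul_eq_mul]
  rcases h2 (x t) with hx | hx <;> simp [hx] <;> ring

theorem exists_unit_mul_eq_norm (z : ℂ) : ∃ u : ℂ, ‖u‖ = 1 ∧ u * z = (‖z‖ : ℂ) := by
  by_cases hz : z = 0
  · exact ⟨1, by simp [hz]⟩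
  · have hn : (‖z‖ : ℂ) ≠ 0 := by simpa using hz
    refine ⟨(starRingEnd ℂ) z / ‖z‖, by simp [hz], ?_⟩
    rw [div_mul_eq_mul_div, Complex.conj_mul', pow_two, mul_div_assoc, div_self hn, mul_one]

/-- The number of gates that suffice to clear one qubit of a state of `k` qubits. -/
def clearCost (k : ℕ) : ℕ := 2 * diagCost k + 2

/-- One qubit of a state can be mapped to `|0⟩`: with suitable phases, a first Hadamard gate
makes the moduli of the two amplitudes equal, and a second one adds them up. -/
theorem exists_clear_qubit (hr : 2 ≤ Fintype.card r) (t : r) (v : BitString r → ℂ) :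
    ∃ W : Op (BitString r), HasCircuit W (clearCost (Fintype.card r)) ∧
      (∀ x : BitString r, x t = 1 → (W *ᵥ v) x = 0) ∧
      ∀ s, s ≠ t → (∀ x : BitString r, x s = 1 → v x = 0) →
        ∀ x : BitString r, x s = 1 → (W *ᵥ v) x = 0 := by
  obtain ⟨t', ht'⟩ : ∃ t', t ≠ t' := by
    have : Nontrivial r := Fintype.one_lt_card_iff_nontrivial.mp hr
    exact (exists_ne t).imp fun _ h => h.symm
  choose u hu huv using exists_unit_mul_eq_norm
  set 𝓗 := (hadamardGate ht').toOp with h𝓗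
  let φ : BitString r → ℂ := fun x => if x t = 0 then u (v x) else Complex.I * u (v x)
  have hφ (x) : ‖φ x‖ = 1 := by
    simp only [φ]; split_ifs <;> simp [hu]
  let v₁ := Matrix.diagonal φ *ᵥ v
  let v₂ := 𝓗 *ᵥ v₁
  let v₃ := (Matrix.diagonal fun x => u (v₂ x)) *ᵥ v₂
  have hv₁ (x) : v₁ x = if x t = 0 then (‖v x‖ : ℂ) else Complex.I * ‖v x‖ := by
    simp only [v₁, Matrix.mulVec_diagonal, φ, ite_mul, mul_assoc, huv]
  have hv₃ (x) : v₃ x = (‖v₂ x‖ : ℂ) := by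
    simp only [v₃, Matrix.mulVec_diagonal, huv]
  refine ⟨𝓗 * Matrix.diagonal (fun x => u (v₂ x)) * (𝓗 * Matrix.diagonal φ), ?_, ?_, ?_⟩
  · refine (((hasCircuit_gate _).mul (hasCircuit_diagonal hr fun x => hu _)).mul
      ((hasCircuit_gate _).mul (hasCircuit_diagonal hr hφ))).mono ?_
    unfold clearCost; omega
  · intro x hx
    have e : (𝓗 * Matrix.diagonal (fun x => u (v₂ x)) * (𝓗 * Matrix.diagonal φ)) *ᵥ v =
        𝓗 *ᵥ v₃ := by
      simp only [v₃, v₂, v₁, Matrix.mulVec_mulVec, mul_assoc]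
    have h0 : v₂ (Function.update x t 0) = ((√2 : ℝ) : ℂ)⁻¹ *
        (‖v (Function.update x t 0)‖ + Complex.I * ‖v (Function.update x t 1)‖) := by
      simp [v₂, h𝓗, hadamardGate_mulVec, hv₁]
    have h1 : v₂ (Function.update x t 1) = (starRingEnd ℂ) (v₂ (Function.update x t 0)) := by
      rw [h0]
      simp [v₂, h𝓗, hadamardGate_mulVec, hv₁]
    rw [e, h𝓗, hadamardGate_mulVec, hv₃, hv₃, h1, hx]
    simp
  · intro s hs h x hx
    have e : (𝓗 * Matrix.diagonal (fun x => u (v₂ x)) * (𝓗 * Matrix.diagonal φ)) *ᵥ v =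
        𝓗 *ᵥ v₃ := by
      simp only [v₃, v₂, v₁, Matrix.mulVec_mulVec, mul_assoc]
    have h2 (y : BitString r) (hy : y s = 1) : v₂ y = 0 := by
      have h3 (b) : v₁ (Function.update y t b) = 0 := by
        rw [hv₁, h _ (by simp [hs, hy])]; simp
      simp only [v₂, h𝓗, hadamardGate_mulVec, h3]; simp
    have h4 (b) : v₃ (Function.update x t b) = 0 := by
      rw [hv₃, h2 _ (by simp [hs, hx]), norm_zero, Complex.ofReal_zero]
    rw [e, h𝓗, hadamardGate_mulVec, h4, h4]; simp

theorem exists_map_to_zero (hr : 2 ≤ Fintype.card r) (v : BitString r → ℂ) :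
    ∃ W : Op (BitString r), HasCircuit W (Fintype.card r * clearCost (Fintype.card r)) ∧
      ∀ x, x ≠ 0 → (W *ᵥ v) x = 0 := by
  have key (A : Finset r) : ∃ W : Op (BitString r),
      HasCircuit W (A.card * clearCost (Fintype.card r)) ∧
      ∀ t ∈ A, ∀ x : BitString r, x t = 1 → (W *ᵥ v) x = 0 := by
    induction A using Finset.induction_on with
    | empty => exact ⟨1, by simpa using hasCircuit_one, by simp⟩
    | insert t A ht ih =>
      obtain ⟨W, hW, h⟩ := ih
      obtain ⟨W', hW', h1, h2⟩ := exists_clear_qubit hr t (W *ᵥ v)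
      refine ⟨W' * W, (hW'.mul hW).mono ?_, fun s hs x hx => ?_⟩
      · rw [Finset.card_insert_of_notMem ht]; exact (by ring : _ = _).le
      · rw [← Matrix.mulVec_mulVec]
        by_cases hst : s = t
        · subst hst; exact h1 x hx
        · exact h2 s hst (h s (Finset.mem_of_mem_insert_of_ne hs hst)) x hx
  obtain ⟨W, hW, h⟩ := key Finset.univ
  refine ⟨W, hW, fun x hx => ?_⟩
  obtain ⟨t, ht⟩ := Function.ne_iff.mp hx
  have h2 : ∀ s : Fin 2, s ≠ 0 → s = 1 := by decide
  exact h t (Finset.mem_univ t) x (h2 _ ht)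

/-- The number of gates that suffice for a reflection on `k` qubits. -/
def reflectionCost (k : ℕ) : ℕ := 2 * (k * clearCost k) + diagCost k

theorem star_mulVec_dotProduct {ι : Type*} [Fintype ι] (M : Op ι) (v w : ι → ℂ) :
    star (M *ᵥ v) ⬝ᵥ w = star v ⬝ᵥ (Mᴴ *ᵥ w) := by
  rw [Matrix.star_mulVec, Matrix.dotProduct_mulVec]

/-- The unitary `1 - μ |w⟩⟨w|`: a circuit that maps `w` to a multiple of `|0⟩` makes it
diagonal. -/
theorem hasCircuit_one_sub_vecMulVec (hr : 2 ≤ Fintype.card r) (μ : ℂ) (w : BitString r → ℂ)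
    (h : ‖1 - μ * (star w ⬝ᵥ w)‖ = 1) :
    HasCircuit (1 - μ • vecMulVec w (star w) : Op (BitString r))
      (reflectionCost (Fintype.card r)) := by
  obtain ⟨W, hW, hw⟩ := exists_map_to_zero hr w
  have hWW := hW.conjTranspose_mul_self
  have hnorm : star w ⬝ᵥ w = star ((W *ᵥ w) 0) * (W *ᵥ w) 0 := by
    have h1 : star (W *ᵥ w) ⬝ᵥ (W *ᵥ w) = star w ⬝ᵥ w := by
      rw [star_mulVec_dotProduct, Matrix.mulVec_mulVec, hWW, Matrix.one_mulVec]
    rw [← h1, dotProduct, Finset.sum_eq_single 0]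
    · rfl
    · intro x _ hx; rw [hw x hx, mul_zero]
    · simp
  let φ : BitString r → ℂ := fun x => if x = 0 then 1 - μ * (star w ⬝ᵥ w) else 1
  have hφ (x) : ‖φ x‖ = 1 := by
    simp only [φ]; split_ifs
    · exact h
    · simp
  have hd : (1 - μ • vecMulVec (W *ᵥ w) (star (W *ᵥ w)) : Op (BitString r)) =
      Matrix.diagonal φ := by
    ext x y
    simp only [Matrix.sub_apply, Matrix.smul_apply, Matrix.vecMulVec_apply, Pi.star_apply,
      smul_eq_mul, Matrix.one_apply, Matrix.diagonal_apply, φ, hnorm]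
    by_cases hx : x = 0
    · by_cases hy : y = 0
      · subst hx hy; simp only [if_true]; ring
      · have : ¬ (0 : BitString r) = y := fun h' => hy h'.symm
        subst hx; simp [this, hw y hy]
    · simp [hx, hw x hx]
  have e : (1 - μ • vecMulVec w (star w) : Op (BitString r)) = Wᴴ * Matrix.diagonal φ * W := by
    rw [← hd, mul_sub, sub_mul, mul_one, hWW, mul_smul_comm, smul_mul_assoc, Matrix.mul_vecMulVec,
      Matrix.vecMulVec_mul, Matrix.mulVec_mulVec, hWW, Matrix.one_mulVec, Matrix.star_mulVec,
      Matrix.vecMul_vecMul, hWW, Matrix.vecMul_one]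
  rw [e]
  exact ((hW.conjTranspose.mul (hasCircuit_diagonal hr hφ)).mul hW).mono
    (by unfold reflectionCost; omega)

/-- A Householder reflection maps any unit vector to any other one and fixes the vectors
orthogonal to both. -/
theorem exists_householder (hr : 2 ≤ Fintype.card r) {a b : BitString r → ℂ}
    (ha : star a ⬝ᵥ a = 1) (hb : star b ⬝ᵥ b = 1) :
    ∃ R : Op (BitString r), HasCircuit R (reflectionCost (Fintype.card r)) ∧ R *ᵥ a = b ∧
      ∀ c, star a ⬝ᵥ c = 0 → star b ⬝ᵥ c = 0 → R *ᵥ c = c := by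
  set β := star b ⬝ᵥ a with hβ
  have hβ' : star a ⬝ᵥ b = star β := by
    rw [hβ, ← star_dotProduct]
  by_cases h1 : β = 1
  · have hab : a = b := by
      rw [← sub_eq_zero, ← dotProduct_star_self_eq_zero, star_sub,
        sub_dotProduct, dotProduct_sub, dotProduct_sub, ha, hb, ← hβ, hβ', h1]
      simp
    exact ⟨1, hasCircuit_one.mono (Nat.zero_le _), by rw [Matrix.one_mulVec, hab],
      fun c _ _ => Matrix.one_mulVec c⟩
  have h1' : 1 - β ≠ 0 := sub_ne_zero.mpr (Ne.symm h1)
  have hww : star (a - b) ⬝ᵥ (a - b) = (1 - β) + (1 - star β) := by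
    rw [star_sub, sub_dotProduct, dotProduct_sub, dotProduct_sub, ha, hb, ← hβ, hβ']
    ring
  have hR (c : BitString r → ℂ) :
      (1 - (1 - β)⁻¹ • vecMulVec (a - b) (star (a - b)) : Op (BitString r)) *ᵥ c =
        c - ((1 - β)⁻¹ * (star (a - b) ⬝ᵥ c)) • (a - b) := by
    rw [Matrix.sub_mulVec, Matrix.one_mulVec, Matrix.smul_mulVec, Matrix.vecMulVec_mulVec,
      op_smul_eq_smul, smul_smul]
  refine ⟨_, hasCircuit_one_sub_vecMulVec hr (1 - β)⁻¹ (a - b) ?_, ?_, fun c hac hbc => ?_⟩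
  · have : 1 - (1 - β)⁻¹ * (star (a - b) ⬝ᵥ (a - b)) = -(star (1 - β) * (1 - β)⁻¹) := by
      rw [hww, star_sub, star_one]
      field_simp
      ring
    rw [this, norm_neg, norm_mul, norm_star, norm_inv, mul_inv_cancel₀ (norm_ne_zero_iff.mpr h1')]
  · rw [hR, star_sub, sub_dotProduct, ha, ← hβ, inv_mul_cancel₀ h1', one_smul, sub_sub_cancel]
  · rw [hR, star_sub, sub_dotProduct, hac, hbc, sub_zero, mul_zero, zero_smul, sub_zero]

/-- Any orthonormal family is the family of images of basis states under a circuit. -/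
theorem exists_circuit_of_orthonormal (hr : 2 ≤ Fintype.card r) (F : Finset (BitString r))
    (a : BitString r → BitString r → ℂ)
    (ha : ∀ x ∈ F, ∀ y ∈ F, star (a x) ⬝ᵥ a y = if x = y then 1 else 0) :
    ∃ U : Op (BitString r), HasCircuit U (F.card * reflectionCost (Fintype.card r)) ∧
      ∀ x ∈ F, U *ᵥ Pi.single x 1 = a x := by
  induction F using Finset.induction_on with
  | empty => exact ⟨1, by simpa using hasCircuit_one, by simp⟩
  | insert x F hx ih =>
    obtain ⟨U, hU, h⟩ := ih fun x hx y hy =>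
      ha x (Finset.mem_insert_of_mem hx) y (Finset.mem_insert_of_mem hy)
    have hUU := hU.mul_conjTranspose_self
    have hxx := ha x (Finset.mem_insert_self _ _) x (Finset.mem_insert_self _ _)
    rw [if_pos rfl] at hxx
    have hsingle (y z : BitString r) :
        star (Pi.single y 1 : BitString r → ℂ) ⬝ᵥ Pi.single z 1 = if y = z then 1 else 0 := by
      rw [dotProduct_single, mul_one, Pi.star_apply, Pi.single_apply, apply_ite star, star_one,
        star_zero]
      exact if_congr eq_comm rfl rfl
    obtain ⟨R, hR, hRx, hRc⟩ := exists_householder hr (a := Pi.single x 1) (b := Uᴴ *ᵥ a x)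
      (by rw [hsingle, if_pos rfl])
      (by rw [star_mulVec_dotProduct, conjTranspose_conjTranspose, Matrix.mulVec_mulVec, hUU,
        Matrix.one_mulVec, hxx])
    refine ⟨U * R, (hU.mul hR).mono ?_, fun y hy => ?_⟩
    · rw [Finset.card_insert_of_notMem hx]; exact (by ring : _ = _).le
    · rw [← Matrix.mulVec_mulVec]
      rcases Finset.mem_insert.mp hy with rfl | hyF
      · rw [hRx, Matrix.mulVec_mulVec, hUU, Matrix.one_mulVec]
      · have hxy : x ≠ y := fun h' => hx (h' ▸ hyF)
        rw [hRc, h y hyF]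
        · rw [hsingle, if_neg hxy]
        · rw [star_mulVec_dotProduct, conjTranspose_conjTranspose, h y hyF,
            ha x (Finset.mem_insert_self _ _) y hy, if_neg hxy]

end Synthesis

section Stinespring

variable {q a : Type} [Fintype q] [DecidableEq q] [Fintype a] [DecidableEq a]

/-- Stinespring dilation: a channel with `2^|a|` Kraus operators is implemented with the
ancillas `a`. -/
theorem hasChannelCircuit_krausMap (hqa : 2 ≤ Fintype.card q + Fintype.card a)
    {K : BitString a → Op (BitString q)} (hK : ∑ z, (K z)ᴴ * K z = 1) :
    HasChannelCircuit (krausMap K)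
      (2 ^ Fintype.card q * reflectionCost (Fintype.card q + Fintype.card a)) := by
  let ι : BitString q → BitString (q ⊕ a) := fun x => Sum.elim x 0
  have hι : Function.Injective ι := fun x y h => by
    funext i; exact congrFun h (Sum.inl i)
  let A : BitString (q ⊕ a) → BitString (q ⊕ a) → ℂ :=
    fun s s' => K (fun i => s' (Sum.inr i)) (fun i => s' (Sum.inl i)) (fun i => s (Sum.inl i))
  obtain ⟨U, hU, h⟩ := exists_circuit_of_orthonormal (r := q ⊕ a)
    (by rw [Fintype.card_sum]; exact hqa) (Finset.univ.image ι) A (by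
      simp only [Finset.mem_image, Finset.mem_univ, true_and]
      rintro _ ⟨x, rfl⟩ _ ⟨y, rfl⟩
      have h1 := congrFun (congrFun hK x) y
      rw [Matrix.sum_apply, Matrix.one_apply] at h1
      simp only [hι.eq_iff, ← h1, dotProduct, sum_bitString_sum, Matrix.mul_apply]
      rw [Finset.sum_comm]
      rfl)
  rw [Finset.card_image_of_injective _ hι, Finset.card_univ, Fintype.card_fun, Fintype.card_fin,
    Fintype.card_sum] at hU
  refine ⟨a, inferInstance, inferInstance, U, hU, ?_⟩
  congr 1
  funext z
  ext u x
  have h2 := congrFun (h (ι x) (Finset.mem_image_of_mem _ (Finset.mem_univ x))) (Sum.elim u z)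
  rw [Matrix.mulVec_single_one] at h2
  exact h2.symm

/-- A channel on `m ≥ 1` qubits is implemented exactly by `exp (O(m))` gates. -/
theorem hasChannelCircuit_of_isCP (hq : 1 ≤ Fintype.card q) {T : SuperOp (BitString q)}
    (hT : IsCP T) (hT' : IsTP T) :
    HasChannelCircuit T (2 ^ Fintype.card q * reflectionCost (3 * Fintype.card q)) := by
  obtain ⟨K, hK, rfl⟩ := exists_krausMap hT hT'
  let e := Equiv.sumArrowEquivProdArrow q q (Fin 2)
  have h := hasChannelCircuit_krausMap (q := q) (a := q ⊕ q)
    (by rw [Fintype.card_sum]; omega) (K := fun z => K (e z))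
    (by rw [← hK]; exact Equiv.sum_comp e fun k => (K k)ᴴ * K k)
  rw [krausMap_equiv e, Fintype.card_sum] at h
  exact h.mono (by rw [show 3 * Fintype.card q = Fintype.card q + (Fintype.card q + Fintype.card q)
    by ring])

theorem reflectionCost_le (c : ℕ) :
    2 ^ c * reflectionCost (3 * c) ≤ 38 * 108 ^ c := by
  have hD : diagCost (3 * c) ≤ 2 * 27 ^ c := by
    unfold diagCost
    rw [pow_mul]
    norm_num
  have h27 : 1 ≤ 27 ^ c := Nat.one_le_pow _ _ (by norm_num)
  have hc2 : c ≤ 2 ^ c := Nat.lt_two_pow_self.le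
  have h2 : 1 ≤ 2 ^ c := Nat.one_le_pow _ _ (by norm_num)
  have h1 : reflectionCost (3 * c) ≤ (36 * c + 2) * 27 ^ c := by
    unfold reflectionCost clearCost
    calc 2 * (3 * c * (2 * diagCost (3 * c) + 2)) + diagCost (3 * c)
        ≤ 2 * (3 * c * (2 * (2 * 27 ^ c) + 2 * 27 ^ c)) + 2 * 27 ^ c := by gcongr; omega
      _ = (36 * c + 2) * 27 ^ c := by ring
  calc 2 ^ c * reflectionCost (3 * c) ≤ 2 ^ c * ((36 * 2 ^ c + 2 * 2 ^ c) * 27 ^ c) := by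
        refine Nat.mul_le_mul_left _ (h1.trans (Nat.mul_le_mul_right _ ?_))
        omega
    _ = 38 * (2 * 2 * 27) ^ c := by rw [mul_pow, mul_pow]; ring
    _ = 38 * 108 ^ c := by norm_num

end Stinespring

/-! ### Simulation by the product formula -/

section Simulation

theorem IsLindbladian.add {ι : Type*} [Fintype ι] [DecidableEq ι] {T T' : SuperOp ι}
    (hT : IsLindbladian T) (hT' : IsLindbladian T') : IsLindbladian (T + T') := by
  obtain ⟨H, k, L, hH, rfl⟩ := isLindbladian_iff.mp hT
  obtain ⟨H', k', L', hH', rfl⟩ := isLindbladian_iff.mp hT'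
  rw [lindbladian_add]
  exact isLindbladian_lindbladian (hH.add hH') _

theorem isLindbladian_zero {ι : Type*} [Fintype ι] [DecidableEq ι] :
    IsLindbladian (0 : SuperOp ι) := by
  refine isLindbladian_iff.mpr ⟨0, 0, Fin.elim0, Matrix.isHermitian_zero, ?_⟩
  ext1 ρ
  simp [lindbladian_apply]

theorem isLindbladian_sum {ι α : Type*} [Fintype ι] [DecidableEq ι] {s : Finset α}
    {F : α → SuperOp ι} (h : ∀ i ∈ s, IsLindbladian (F i)) : IsLindbladian (∑ i ∈ s, F i) :=
  Finset.sum_induction F IsLindbladian (fun _ _ => IsLindbladian.add) isLindbladian_zero h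

/-- On a one-dimensional space the trace determines an operator, and `T ρ` is traceless. -/
theorem IsLindbladian.eq_zero {ι : Type*} [Fintype ι] [DecidableEq ι] [Subsingleton ι]
    {T : SuperOp ι} (hT : IsLindbladian T) : T = 0 := by
  ext ρ i j
  have h := hT.trace_apply ρ
  obtain rfl := Subsingleton.elim i j
  rwa [Matrix.trace, Fintype.sum_subsingleton _ i] at h

theorem IsLindbladian.extendByIdentity {q : Type*} [Fintype q] [DecidableEq q] {S : Finset q}
    {K : SuperOp (BitString S)} (hK : IsLindbladian K) :
    IsLindbladian (extendByIdentity S K) := by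
  obtain ⟨H, k, L, hH, rfl⟩ := isLindbladian_iff.mp hK
  change IsLindbladian (extendHom S _)
  rw [extendHom_lindbladian]
  refine isLindbladian_lindbladian ?_ _
  rw [Matrix.IsHermitian, ← embedOp_conjTranspose, hH.eq]

/-- For a register of `n < c` qubits, the locality can be taken to be `n`. -/
theorem IsLocalLindbladian.min_card {q : Type*} [Fintype q] [DecidableEq q] {c : ℕ}
    {T : SuperOp (BitString q)} (hT : IsLocalLindbladian c T) :
    IsLocalLindbladian (min c (Fintype.card q)) T := by
  obtain ⟨m, F, hF, rfl⟩ := hT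
  refine ⟨m, F, fun i => ?_, rfl⟩
  obtain ⟨S, hS, h⟩ := hF i
  exact ⟨S, le_min hS S.card_le_univ, h⟩

theorem IsLocalLindbladian.eq_zero {q : Type*} [DecidableEq q] {T : SuperOp (BitString q)}
    (hT : IsLocalLindbladian 0 T) : T = 0 := by
  obtain ⟨m, F, hF, rfl⟩ := hT
  refine Finset.sum_eq_zero fun i _ => ?_
  obtain ⟨S, hS, K, hK, h⟩ := hF i
  obtain rfl : S = ∅ := Finset.card_eq_zero.mp (Nat.le_zero.mp hS)
  rw [h, hK.eq_zero]
  rfl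

variable {q : Type} [Fintype q] [DecidableEq q]

theorem hasChannelCircuit_strang {G : ℕ} {l : List (SuperOp (BitString q))}
    (h : ∀ A ∈ l, HasChannelCircuit (superExp ((1 / 2 : ℂ) • A)) G) :
    HasChannelCircuit (strang l) (2 * l.length * G) := by
  induction l with
  | nil => simpa [strang] using hasChannelCircuit_one
  | cons A l ih =>
    have hA := h A (by simp)
    refine ((hA.mul (ih fun B hB => h B (by simp [hB]))).mul hA).mono (le_of_eq ?_)
    rw [List.length_cons]
    ring

/-- The evolution of a Lindbladian on few qubits is implemented exactly. -/
theorem hasChannelCircuit_superExp_extendByIdentity {S : Finset q} (hS : 1 ≤ S.card)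
    {K : SuperOp (BitString S)} (hK : IsLindbladian K) {s : ℝ} (hs : 0 ≤ s) :
    HasChannelCircuit (superExp ((s : ℂ) • extendByIdentity S K)) (38 * 108 ^ S.card) := by
  have e : (s : ℂ) • extendByIdentity S K = extendHom S ((s : ℂ) • K) :=
    (map_smul (extendHom S) (s : ℂ) K).symm
  have h := hasChannelCircuit_of_isCP (by rwa [Fintype.card_coe]) (hK.smul hs).isCP_superExp
    (hK.smul hs).isTP_superExp
  rw [e, superExp_extendHom]
  rw [Fintype.card_coe] at h
  exact (h.mono (reflectionCost_le _)).extendHom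

/-- The gate count and the error of `r` steps of the symmetric product formula for the
decomposition of a local Lindbladian into one term for each set of `d` qubits. -/
theorem IsLocalLindbladian.exists_hasChannelCircuit {d : ℕ} (hd : 1 ≤ d)
    (hdq : d ≤ Fintype.card q) {T : SuperOp (BitString q)} (hT : IsLocalLindbladian d T)
    {t x : ℝ} (ht : 0 ≤ t)
    (hx : x = (Fintype.card q).choose d * (5 * 4 ^ d * diamondNorm T) * t)
    {r : ℕ} (hr : 0 < r) (hxr : x ≤ r) :
    ∃ E : SuperOp (BitString q),
      HasChannelCircuit E (r * (2 * (Fintype.card q).choose d * (38 * 108 ^ d))) ∧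
      diamondNorm (E - superExp ((t : ℂ) • T)) ≤ r * ((x / r) ^ 3 / 2) := by
  obtain ⟨F, hF, hsum⟩ := hT.exists_decomposition hdq
  set P := Finset.powersetCard d (Finset.univ : Finset q) with hP
  have hs : 0 ≤ t / r := by positivity
  let l := P.toList.map fun S => ((t / r : ℝ) : ℂ) • F S
  have hlen : l.length = (Fintype.card q).choose d := by
    rw [List.length_map, Finset.length_toList, hP, Finset.card_powersetCard, Finset.card_univ]
  have hl : l.sum = ((t / r : ℝ) : ℂ) • T := by
    rw [Finset.sum_map_toList, ← Finset.smul_sum, ← hsum]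
  have hmem {A} (hA : A ∈ l) : ∃ S ∈ P, A = ((t / r : ℝ) : ℂ) • F S := by
    obtain ⟨S, hS, h⟩ := List.mem_map.mp hA
    exact ⟨S, Finset.mem_toList.mp hS, h.symm⟩
  have hFL {S} (hS : S ∈ P) : IsLindbladian (F S) := by
    obtain ⟨⟨K, hK, e⟩, -⟩ := hF S hS
    rw [e]
    exact hK.extendByIdentity
  have hr' : (r : ℝ) ≠ 0 := by positivity
  have hΛ : l.length * (t / r * (5 * 4 ^ d * diamondNorm T)) = x / r := by
    rw [hlen, hx]; ring
  have hrt : (r : ℂ) • l.sum = (t : ℂ) • T := by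
    rw [hl, smul_smul]
    congr 1
    push_cast
    rw [mul_div_cancel₀]
    exact_mod_cast hr'
  refine ⟨strang l ^ r, ?_, ?_⟩
  · rw [← hlen]
    refine (hasChannelCircuit_strang fun A hA => ?_).pow r
    obtain ⟨S, hS, rfl⟩ := hmem hA
    obtain ⟨⟨K, hK, e⟩, -⟩ := hF S hS
    have hSd : S.card = d := (Finset.mem_powersetCard.mp hS).2
    have := hasChannelCircuit_superExp_extendByIdentity (hd.trans hSd.ge) hK
      (s := 1 / 2 * (t / r)) (by positivity)
    rw [hSd, ← e] at this
    rw [smul_smul]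
    convert! this using 3
    push_cast
    ring
  · rw [← hrt, ← hΛ]
    refine diamondNorm_strang_pow_sub_superExp_le r (fun A hA => ?_) ?_ (fun A hA => ?_) ?_
    · obtain ⟨S, hS, rfl⟩ := hmem hA
      exact (hFL hS).smul hs
    · rw [hl, hsum]
      exact (isLindbladian_sum fun S hS => hFL hS).smul hs
    · obtain ⟨S, hS, rfl⟩ := hmem hA
      rw [diamondNorm_smul, Complex.norm_real, Real.norm_of_nonneg hs]
      exact mul_le_mul_of_nonneg_left (hF S hS).2 hs
    · rw [hΛ]
      exact div_le_one_of_le₀ hxr (Nat.cast_nonneg r)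

theorem canSimulate_of_hasChannelCircuit {n : ℕ} {T E : SuperOp (BitString (Fin n))} {k : ℕ}
    (hE : HasChannelCircuit E k) {t ε G : ℝ} (hG : (k : ℝ) ≤ G)
    (h : diamondNorm (E - superExp ((t : ℂ) • T)) < ε) : CanSimulate n T t ε G := by
  obtain ⟨m, C, hC, rfl⟩ := hE.exists_circuit
  exact ⟨m, C, (Nat.cast_le.mpr hC).trans hG, h⟩

end Simulation

/-! ### The number of steps and of gates -/

section Count

/-- The number of steps of the product formula. -/
theorem exists_stepCount {x ε : ℝ} (hx : 0 ≤ x) (hε : 0 < ε) (hε2 : ε ≤ 2) :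
    ∃ r : ℕ, 0 < r ∧ x ≤ r ∧ r * ((x / r) ^ 3 / 2) < ε ∧
      (r : ℝ) ≤ 4 * max (x ^ (1.5 : ℝ) / √ε) 1 := by
  have hsε : 0 < √ε := Real.sqrt_pos.mpr hε
  have hsε2 : √ε ≤ 2 := Real.sqrt_le_iff.mpr ⟨by norm_num, by linarith⟩
  set y := x ^ (1.5 : ℝ) with hy
  have hy0 : 0 ≤ y := Real.rpow_nonneg hx _
  have hy2 : y ^ 2 = x ^ 3 := by
    rw [hy, ← Real.rpow_natCast, ← Real.rpow_mul hx, ← Real.rpow_natCast]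
    norm_num
  set z := max (2 * y / √ε) 1 with hz
  have hz1 : 1 ≤ z := le_max_right _ _
  have hzr := Nat.le_ceil z
  have hr1 : (1 : ℝ) ≤ ⌈z⌉₊ := hz1.trans hzr
  have hyr : 2 * y / √ε ≤ ⌈z⌉₊ := (le_max_left _ _).trans hzr
  refine ⟨⌈z⌉₊, by exact_mod_cast hr1, ?_, ?_, ?_⟩
  · rcases le_total x 1 with h | h
    · exact h.trans hr1
    · refine le_trans ?_ hyr
      rw [le_div_iff₀ hsε]
      have hxy : x ≤ y := by
        simpa using Real.rpow_le_rpow_of_exponent_le h (by norm_num : (1 : ℝ) ≤ 1.5)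
      nlinarith
  · have hr0 : (0 : ℝ) < ⌈z⌉₊ := by linarith
    have h4 : 4 * x ^ 3 ≤ ε * (⌈z⌉₊ : ℝ) ^ 2 := by
      rw [div_le_iff₀ hsε] at hyr
      have := pow_le_pow_left₀ (by positivity) hyr 2
      rw [mul_pow, mul_pow, hy2, Real.sq_sqrt hε.le] at this
      linarith
    have e : (⌈z⌉₊ : ℝ) * ((x / ⌈z⌉₊) ^ 3 / 2) = x ^ 3 / (2 * (⌈z⌉₊ : ℝ) ^ 2) := by
      field_simp
    rw [e, div_lt_iff₀ (by positivity)]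
    have : 0 < ε * (⌈z⌉₊ : ℝ) ^ 2 := by positivity
    linarith
  · have h1 := (Nat.ceil_lt_add_one (by linarith : 0 ≤ z)).le
    have h2 : z ≤ 2 * max (y / √ε) 1 := by
      refine max_le ?_ (by linarith [le_max_right (y / √ε) 1])
      rw [mul_div_assoc]
      exact mul_le_mul_of_nonneg_left (le_max_left _ _) (by norm_num)
    linarith

/-- The factorial in `n.choose d ≤ n ^ d / d!` absorbs every factor that is exponential in
`d`. -/
theorem choose_mul_pow_le (n d : ℕ) {b : ℝ} (hb : 0 ≤ b) :
    n.choose d * b ^ d ≤ Real.exp b * n ^ d := by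
  have h1 : (n.choose d : ℝ) ≤ n ^ d / d.factorial := Nat.choose_le_pow_div d n
  calc (n.choose d : ℝ) * b ^ d ≤ n ^ d / d.factorial * b ^ d := by gcongr
    _ = b ^ d / d.factorial * n ^ d := by ring
    _ ≤ Real.exp b * n ^ d := by gcongr; exact Real.pow_div_factorial_le_exp b hb d

/-- The constant in the gate count. -/
def gateConstant : ℝ := 304 * Real.exp 108 * (5 * Real.exp 4) ^ (1.5 : ℝ)

theorem gateConstant_pos : 0 < gateConstant := by unfold gateConstant; positivity

theorem gateCount_le {n d r : ℕ} {τ x ε : ℝ} (hτ : 0 ≤ τ)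
    (hx : x = n.choose d * (5 * 4 ^ d) * τ)
    (hr : (r : ℝ) ≤ 4 * max (x ^ (1.5 : ℝ) / √ε) 1) :
    (r * (2 * n.choose d * (38 * 108 ^ d)) : ℝ) ≤
      gateConstant * max (τ ^ (1.5 : ℝ) / √ε * (n : ℝ) ^ (2.5 * (d : ℝ))) ((n : ℝ) ^ d) := by
  set A : ℝ := (n : ℝ) ^ d with hA
  have hA0 : 0 ≤ A := by positivity
  have hm : (n.choose d : ℝ) * 108 ^ d ≤ Real.exp 108 * A := choose_mul_pow_le n d (by norm_num)
  have hxA : x ≤ 5 * Real.exp 4 * A * τ := by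
    have := choose_mul_pow_le n d (b := 4) (by norm_num)
    rw [hx]
    calc (n.choose d * (5 * 4 ^ d) * τ : ℝ) = 5 * (n.choose d * 4 ^ d) * τ := by ring
      _ ≤ 5 * (Real.exp 4 * A) * τ := by gcongr
      _ = _ := by ring
  have hx0 : 0 ≤ x := by rw [hx]; positivity
  have hx15 : x ^ (1.5 : ℝ) ≤ (5 * Real.exp 4) ^ (1.5 : ℝ) * A ^ (1.5 : ℝ) * τ ^ (1.5 : ℝ) := by
    rw [← Real.mul_rpow (by positivity) hA0, ← Real.mul_rpow (by positivity) hτ]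
    exact Real.rpow_le_rpow hx0 hxA (by norm_num)
  have hA25 : A ^ (1.5 : ℝ) * A = (n : ℝ) ^ (2.5 * (d : ℝ)) := by
    rw [← Real.rpow_add_one' hA0 (by norm_num), hA, ← Real.rpow_natCast,
      ← Real.rpow_mul (Nat.cast_nonneg n)]
    norm_num [mul_comm]
  set κ : ℝ := (5 * Real.exp 4) ^ (1.5 : ℝ) with hκ
  have hκ1 : 1 ≤ κ := by
    refine Real.one_le_rpow ?_ (by norm_num)
    linarith [Real.one_le_exp (by norm_num : (0 : ℝ) ≤ 4)]
  have hmax : max (x ^ (1.5 : ℝ) / √ε) 1 * A ≤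
      κ * max (τ ^ (1.5 : ℝ) / √ε * (n : ℝ) ^ (2.5 * (d : ℝ))) A := by
    rw [max_mul_of_nonneg _ _ hA0, mul_max_of_nonneg _ _ (by linarith), one_mul]
    refine max_le_max ?_ (le_mul_of_one_le_left hA0 hκ1)
    calc x ^ (1.5 : ℝ) / √ε * A ≤ κ * A ^ (1.5 : ℝ) * τ ^ (1.5 : ℝ) / √ε * A := by gcongr
      _ = κ * (τ ^ (1.5 : ℝ) / √ε * (A ^ (1.5 : ℝ) * A)) := by ring
      _ = _ := by rw [hA25]
  calc (r * (2 * n.choose d * (38 * 108 ^ d)) : ℝ)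
      = 76 * r * (n.choose d * 108 ^ d) := by ring
    _ ≤ 76 * (4 * max (x ^ (1.5 : ℝ) / √ε) 1) * (Real.exp 108 * A) := by gcongr
    _ = 304 * Real.exp 108 * (max (x ^ (1.5 : ℝ) / √ε) 1 * A) := by ring
    _ ≤ 304 * Real.exp 108 * (κ * max (τ ^ (1.5 : ℝ) / √ε * (n : ℝ) ^ (2.5 * (d : ℝ))) A) := by
        gcongr
    _ = _ := by rw [gateConstant, ← hκ]; ring

end Count

end OpenQuantum

end

/-- On `n = log₂ N` qubits, with `τ = ‖𝓛‖_⋄ t`. The second entry of the maximum only matters when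
`τ ^ 1.5 * n ^ (1.5 * c) < √ε`. -/
theorem mainTheorem8 :
    ∃ C : ℝ, 0 < C ∧
      ∀ (n c : ℕ) (𝓛 : OpenQuantum.SuperOp (OpenQuantum.BitString (Fin n))),
        OpenQuantum.IsLocalLindbladian c 𝓛 →
        ∀ t ε : ℝ, 0 < t → 0 < ε →
          OpenQuantum.CanSimulate n 𝓛 t ε
            (C * max
              ((OpenQuantum.diamondNorm 𝓛 * t) ^ (1.5 : ℝ) / Real.sqrt ε *
                ((2 : ℝ) ^ (2 * c) * ((n : ℝ) + 2 ^ (6 * c)) * (n : ℝ) ^ (2.5 * (c : ℝ))))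
              ((2 : ℝ) ^ (2 * c) * ((n : ℝ) + 2 ^ (6 * c)) * (n : ℝ) ^ c)) := by
  open OpenQuantum in
  refine ⟨gateConstant, gateConstant_pos, fun n c 𝓛 h𝓛 t ε ht hε => ?_⟩
  have hC := gateConstant_pos
  have hτ : 0 ≤ diamondNorm 𝓛 * t := mul_nonneg (diamondNorm_nonneg 𝓛) ht.le
  have hd := h𝓛.min_card
  rw [Fintype.card_fin] at hd
  rcases Nat.eq_zero_or_pos (min c n) with h0 | h0
  -- A Lindbladian on no qubits is zero.
  · rw [h0] at hd
    refine canSimulate_of_hasChannelCircuit hasChannelCircuit_one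
      (by rw [Nat.cast_zero]; positivity) ?_
    rwa [hd.eq_zero, smul_zero, superExp_zero, sub_self, diamondNorm_zero]
  rcases lt_or_ge 2 ε with hε2 | hε2
  -- Any two channels are at distance at most `2`.
  · refine canSimulate_of_hasChannelCircuit hasChannelCircuit_one
      (by rw [Nat.cast_zero]; positivity) ?_
    have h1 : IsLindbladian 𝓛 := by
      obtain ⟨m, F, hF, rfl⟩ := h𝓛
      refine isLindbladian_sum fun i _ => ?_
      obtain ⟨S, -, K, hK, h⟩ := hF i
      rw [h]
      exact hK.extendByIdentity
    have h2 := (h1.smul ht.le).diamondNorm_superExp_le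
    have h3 := (isLindbladian_zero (ι := BitString (Fin n))).diamondNorm_superExp_le
    rw [superExp_zero] at h3
    linarith [diamondNorm_sub_le 1 (superExp ((t : ℂ) • 𝓛))]
  obtain ⟨x, hx⟩ : ∃ x : ℝ, x = n.choose (min c n) * (5 * 4 ^ min c n) * (diamondNorm 𝓛 * t) :=
    ⟨_, rfl⟩
  obtain ⟨r, hr0, hxr, herr, hr⟩ := exists_stepCount (by rw [hx]; positivity : 0 ≤ x) hε hε2
  obtain ⟨E, hE, hE'⟩ := hd.exists_hasChannelCircuit (x := x) h0 (by simp) ht.le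
    (by rw [hx, Fintype.card_fin]; ring) hr0 hxr
  refine canSimulate_of_hasChannelCircuit hE ?_ (hE'.trans_lt herr)
  rw [Fintype.card_fin]
  push_cast
  refine (gateCount_le hτ hx hr).trans (mul_le_mul_of_nonneg_left (max_le_max ?_ ?_) hC.le)
  all_goals
    have hn : (1 : ℝ) ≤ n := by exact_mod_cast h0.trans_le (min_le_right c n)
    have hcc : ((min c n : ℕ) : ℝ) ≤ c := by exact_mod_cast min_le_left c n
    have hw : (1 : ℝ) ≤ (2 : ℝ) ^ (2 * c) * ((n : ℝ) + 2 ^ (6 * c)) :=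
      one_le_mul_of_one_le_of_one_le (one_le_pow₀ (by norm_num))
        (by linarith [one_le_pow₀ (n := 6 * c) (by norm_num : (1 : ℝ) ≤ 2)])
  · refine mul_le_mul_of_nonneg_left ?_ (by positivity)
    exact (Real.rpow_le_rpow_of_exponent_le hn (by linarith)).trans
      (le_mul_of_one_le_left (by positivity) hw)
  · exact (pow_le_pow_right₀ hn (min_le_left c n)).trans
      (le_mul_of_one_le_left (by positivity) hw)
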